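/- Let $\mathbb K$ be a field of characteristic $0$, and let $(A,\mu,\Delta,\mathbb 1,\epsilon,\alpha,\beta)$ be a Hom-bialgebra over $\mathbb K$: $A$ is a vector space with linear maps $\mu:A\otimes A\to A$ (written $xy$), $\Delta:A\to A\otimes A$, $\alpha,\beta:A\to A$, $\epsilon:A\to\mathbb K$ and an element $\mathbb 1\in A$ such that * $\alpha(x)(yz)=(xy)\alpha(z)$, $\alpha(xy)=\alpha(x)\alpha(y)$, $\mathbb 1x=\alpha(x)=x\mathbb 1$, $\alpha(\mathbb 1)=\mathbb 1$; * $(\Delta\otimes\beta)\Delta=(\beta\otimes\Delta)\Delta$, $\Delta\beta=(\beta\otimes\beta)\Delta$, $(\mathrm{id}\otimes\epsilon)\Delta=\beta=(\epsilon\otimes\mathrm{id})\Delta$, $\epsilon\beta=\epsilon$; * $\alpha\beta=\beta\alpha$, $\Delta(xy)=\Delta(x)\Delta(y)$, $\Delta\alpha=(\alpha\otimes\alpha)\Delta$, $\beta(xy)=\beta(x)\beta(y)$, $\Delta(\mathbb 1)=\mathbb 1\otimes\mathbb 1$, $\beta(\mathbb 1)=\mathbb 1$, $\epsilon(xy)=\epsilon(x)\epsilon(y)$,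 $\epsilon\alpha=\epsilon$, $\epsilon(\mathbb 1)=1$. **Cochains.** Put $H^{n,m}=\operatorname{Hom}(A^{\otimes n},A^{\otimes m})$ if $n,m\ge1$, $H^{n,m}=0$ if $n\le0$ or $m\le 0$, and $$C_{GS}^{n,m}=H^{n,m}\oplus H^{n-1,m}\oplus H^{n,m-1}\oplus H^{n-1,m-1}\ni(\phi,\psi,\chi,\xi)\qquad(n,m\in\mathbb N).$$ **Actions and coactions.** Let $\Delta_\beta^1=\mathrm{id}$, $\Delta_\beta^{m+1}=(\Delta\otimes\beta^{\otimes(m-1)})\Delta_\beta^m$ and $\mu_\alpha^1=\mathrm{id}$, $\mu_\alpha^{n+1}=\mu_\alpha^n(\mu\otimes\alpha^{\otimes(n-1)})$. The usual left (right) action of $x\in A$ on $A^{\otimes m}$ is componentwise multiplication by $\Delta_\beta^m(x)$ from the left (right). The usual left and right coactions on $A^{\otimes n}$ are, in Sweedler notation for each factor, $$\rho(x_1\otimes\dots\otimes x_n)=\mu_\alpha^n(x_1^{(1)},\dots,x_n^{(1)})\otimes(x_1^{(2)}\otimes\dots\otimes x_n^{(2)}),\qquad \lambda(x_1\otimes\dots\otimes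 x_n)=(x_1^{(1)}\otimes\dots\otimes x_n^{(1)})\otimes\mu_\alpha^n(x_1^{(2)},\dots,x_n^{(2)}).$$ The $\beta$-twisted actions are $\beta(x)\cdot v$ and $v\cdot\beta(x)$; the $\alpha$-twisted coactions are $(\alpha\otimes\mathrm{id})\rho$ and $(\mathrm{id}\otimes\alpha)\lambda$. **Algebra differential** $\partial:C_{GS}^{n,m}\to C_{GS}^{n+1,m}$, $$\partial(\phi,\psi,\chi,\xi)=(\partial_{\mu\mu}\phi-\partial_{\alpha\mu}\psi,\ \partial_{\mu\alpha}\phi-\partial_{\alpha\alpha}\psi,\ \partial_{\mu\mu}\chi-\partial_{\alpha\mu}\xi,\ \partial_{\mu\alpha}\chi-\partial_{\alpha\alpha}\xi),$$ with the usual actions on $A^{\otimes m}$ for $\phi,\psi$ and the $\beta$-twisted actions on $A^{\otimes(m-1)}$ for $\chi,\xi$. Here, for a map $f$ of $k\ge1$ arguments with values in $A^{\otimes l}$, $$(d_ef)(x_1,\dots,x_{k+1})=\alpha^e(x_1)\cdot f(x_2,\dots,x_{k+1})+\sum_{i=1}^k(-1)^if(\alpha(x_1),\dots,x_ix_{i+1},\dots,\alpha(x_{k+1}))+(-1)^{k+1}f(x_1,\dots,x_k)\cdot\alpha^e(x_{k+1}),$$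 $\partial_{\mu\mu}f=d_{k-1}f$, $\partial_{\alpha\alpha}f=d_kf$, $\partial_{\mu\alpha}f=\alpha^{\otimes l}f-f\alpha^{\otimes k}$, and $$(\partial_{\alpha\mu}f)(x_1,\dots,x_{k+2})=\alpha^{k-1}(x_1x_2)\cdot f(x_3,\dots,x_{k+2})-f(x_1,\dots,x_k)\cdot\alpha^{k-1}(x_{k+1}x_{k+2}).$$ **Coalgebra differential** $\partial^c:C_{GS}^{n,m}\to C_{GS}^{n,m+1}$, obtained by reversing all arrows: $$\partial^c(\phi,\psi,\chi,\xi)=(\partial_{\Delta\Delta}\phi-\partial_{\beta\Delta}\chi,\ \partial_{\Delta\Delta}\psi-\partial_{\beta\Delta}\xi,\ \partial_{\Delta\beta}\phi-\partial_{\beta\beta}\chi,\ \partial_{\Delta\beta}\psi-\partial_{\beta\beta}\xi),$$ with the usual coactions on $A^{\otimes n}$ for $\phi,\chi$ and the $\alpha$-twisted coactions on $A^{\otimes(n-1)}$ for $\psi,\xi$. Here, for $f:A^{\otimes k}\to A^{\otimes l}$ with $k,l\ge1$ and the relevant coactions $\rho,\lambda$ on $A^{\otimes k}$, $$d^c_ef=(\beta^e\otimes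 f)\rho+\sum_{i=1}^l(-1)^i(\beta^{\otimes(i-1)}\otimes\Delta\otimes\beta^{\otimes(l-i)})f+(-1)^{l+1}(f\otimes\beta^e)\lambda,$$ $\partial_{\Delta\Delta}f=d^c_{l-1}f$, $\partial_{\beta\beta}f=d^c_lf$, $\partial_{\Delta\beta}f=f\beta^{\otimes k}-\beta^{\otimes l}f$ and $\partial_{\beta\Delta}f=(\Delta\beta^{l-1}\otimes f)\rho-(f\otimes\Delta\beta^{l-1})\lambda$. **Proposition.** $(C_{GS}^{\bullet,\bullet},\partial,\partial^c)$ is a bicomplex: $\partial\partial=0$, $\partial^c\partial^c=0$ and $\partial^c\partial=\partial\,\partial^c$ on every $C_{GS}^{n,m}$. Consequently the total spaces $\bigoplus_{n+m=k}C_{GS}^{n,m}$ with the differential $D=\partial+(-1)^n\partial^c$ on $C_{GS}^{n,m}$ satisfy $D^2=0$, so that the $\alpha$-type Gerstenhaber–Schack cohomology $\ker D/\operatorname{im}D$ is defined. -/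

import Mathlib

open scoped TensorProduct

noncomputable section

namespace AlphaGS

/-! ### Hom-associative algebras, Hom-coassociative coalgebras, Hom-bialgebras -/

/-- A (multiplicative) unital Hom-associative algebra structure on the module `A`:
`α(x)(yz) = (xy)α(z)`, `α(xy) = α(x)α(y)`, `1 x = α(x) = x 1`, `α(1) = 1`. -/
structure HomAssocAlgebra (R A : Type*) [CommRing R] [AddCommGroup A] [Module R A] where
  /-- the multiplication -/
  mul : A ⊗[R] A →ₗ[R] A
  /-- the structure map -/
  α : A →ₗ[R] A
  /-- the unit -/
  one : A
  hom_assoc : mul ∘ₗ TensorProduct.map mul α =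
    mul ∘ₗ TensorProduct.map α mul ∘ₗ (TensorProduct.assoc R A A A).toLinearMap
  multiplicative : α ∘ₗ mul = mul ∘ₗ TensorProduct.map α α
  one_mul : ∀ x, mul (one ⊗ₜ x) = α x
  mul_one : ∀ x, mul (x ⊗ₜ one) = α x
  map_one : α one = one

/-- A (comultiplicative) counital Hom-coassociative coalgebra structure on the module `A`:
`(Δ ⊗ β) Δ = (β ⊗ Δ) Δ`, `Δ β = (β ⊗ β) Δ`, `(id ⊗ ε) Δ = β = (ε ⊗ id) Δ`, `ε β = ε`. -/
structure HomCoassocCoalgebra (R A : Type*) [CommRing R] [AddCommGroup A] [Module R A] where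
  /-- the comultiplication -/
  comul : A →ₗ[R] A ⊗[R] A
  /-- the structure map -/
  β : A →ₗ[R] A
  /-- the counit -/
  counit : A →ₗ[R] R
  hom_coassoc : (TensorProduct.assoc R A A A).toLinearMap ∘ₗ TensorProduct.map comul β ∘ₗ comul =
    TensorProduct.map β comul ∘ₗ comul
  comultiplicative : comul ∘ₗ β = TensorProduct.map β β ∘ₗ comul
  id_counit : (TensorProduct.rid R A).toLinearMap ∘ₗ
    TensorProduct.map LinearMap.id counit ∘ₗ comul = β
  counit_id : (TensorProduct.lid R A).toLinearMap ∘ₗ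
    TensorProduct.map counit LinearMap.id ∘ₗ comul = β
  counit_comp : counit ∘ₗ β = counit

/-- A Hom-bialgebra `(A, μ, Δ, 1, ε, α, β)`: a Hom-associative algebra and a Hom-coassociative
coalgebra on the same module, with commuting structure maps, such that `Δ` and `ε` are morphisms
of Hom-algebras and `μ` and `1` are morphisms of Hom-coalgebras. -/
structure HomBialgebra (R A : Type*) [CommRing R] [AddCommGroup A] [Module R A] extends
    HomAssocAlgebra R A, HomCoassocCoalgebra R A where
  comm : α ∘ₗ β = β ∘ₗ α
  comul_mul : comul ∘ₗ mul = TensorProduct.map mul mul ∘ₗ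
    (TensorProduct.tensorTensorTensorComm R A A A A).toLinearMap ∘ₗ TensorProduct.map comul comul
  comul_alpha : comul ∘ₗ α = TensorProduct.map α α ∘ₗ comul
  beta_mul : β ∘ₗ mul = mul ∘ₗ TensorProduct.map β β
  comul_one : comul one = one ⊗ₜ one
  beta_one : β one = one
  counit_mul : ∀ x y, counit (mul (x ⊗ₜ y)) = counit x * counit y
  counit_alpha : counit ∘ₗ α = counit
  counit_one : counit one = 1

/-! ### Tensor powers -/

section TensorPowers

variable (R A : Type*) [CommRing R] [AddCommGroup A] [Module R A]

/-- `a ⊗ (x₁ ⊗ ⋯ ⊗ xₙ) ↦ a ⊗ x₁ ⊗ ⋯ ⊗ xₙ`. -/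
def consEquiv (n : ℕ) : A ⊗[R] (⨂[R]^n A) ≃ₗ[R] (⨂[R]^(n + 1) A) :=
  TensorProduct.congr (PiTensorProduct.subsingletonEquiv (R := R) (s := fun _ : Fin 1 => A) 0).symm
      (LinearEquiv.refl R _) ≪≫ₗ
    TensorPower.mulEquiv ≪≫ₗ TensorPower.cast R A (Nat.add_comm 1 n)

/-- `(x₁ ⊗ ⋯ ⊗ xₙ) ⊗ a ↦ x₁ ⊗ ⋯ ⊗ xₙ ⊗ a`. -/
def snocEquiv (n : ℕ) : (⨂[R]^n A) ⊗[R] A ≃ₗ[R] (⨂[R]^(n + 1) A) :=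
  TensorProduct.congr (LinearEquiv.refl R _)
      (PiTensorProduct.subsingletonEquiv (R := R) (s := fun _ : Fin 1 => A) 0).symm ≪≫ₗ
    TensorPower.mulEquiv

/-- `(a ⊗ b) ⊗ (x₁ ⊗ ⋯ ⊗ xₙ) ↦ a ⊗ b ⊗ x₁ ⊗ ⋯ ⊗ xₙ`. -/
def consTwoEquiv (n : ℕ) : (A ⊗[R] A) ⊗[R] (⨂[R]^n A) ≃ₗ[R] (⨂[R]^(n + 2) A) :=
  TensorProduct.assoc R A A (⨂[R]^n A) ≪≫ₗ
    TensorProduct.congr (LinearEquiv.refl R A) (consEquiv R A n) ≪≫ₗ consEquiv R A (n + 1)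

/-- `(x₁ ⊗ ⋯ ⊗ xₙ) ⊗ (a ⊗ b) ↦ x₁ ⊗ ⋯ ⊗ xₙ ⊗ a ⊗ b`. -/
def snocTwoEquiv (n : ℕ) : (⨂[R]^n A) ⊗[R] (A ⊗[R] A) ≃ₗ[R] (⨂[R]^(n + 2) A) :=
  (TensorProduct.assoc R (⨂[R]^n A) A A).symm ≪≫ₗ
    TensorProduct.congr (snocEquiv R A n) (LinearEquiv.refl R A) ≪≫ₗ snocEquiv R A (n + 1)

/-- `(a₁ ⊗ b₁) ⊗ ⋯ ⊗ (aₙ ⊗ bₙ) ↦ (a₁ ⊗ ⋯ ⊗ aₙ) ⊗ (b₁ ⊗ ⋯ ⊗ bₙ)`. -/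
def unzip : (n : ℕ) → (⨂[R]^n (A ⊗[R] A)) →ₗ[R] (⨂[R]^n A) ⊗[R] (⨂[R]^n A)
  | 0 => PiTensorProduct.lift (MultilinearMap.constOfIsEmpty R (fun _ : Fin 0 => A ⊗[R] A)
      ((PiTensorProduct.tprod R (fun _ : Fin 0 => (0 : A))) ⊗ₜ
        (PiTensorProduct.tprod R (fun _ : Fin 0 => (0 : A)))))
  | n + 1 => TensorProduct.map (consEquiv R A n).toLinearMap (consEquiv R A n).toLinearMap ∘ₗ
      (TensorProduct.tensorTensorTensorComm R A A (⨂[R]^n A) (⨂[R]^n A)).toLinearMap ∘ₗ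
      TensorProduct.map LinearMap.id (unzip n) ∘ₗ (consEquiv R (A ⊗[R] A) n).symm.toLinearMap

variable {R A}

/-- `f^{⊗ n}`. -/
def powMap (n : ℕ) (f : A →ₗ[R] A) : (⨂[R]^n A) →ₗ[R] (⨂[R]^n A) :=
  PiTensorProduct.map fun _ => f

end TensorPowers

/-! ### The components of the algebra differential, with values in `(M, α_M)`

`l : A ⊗ M → M` and `r : M ⊗ A → M` are the left and the right action. -/

namespace HomAssocAlgebra

variable {R A : Type*} [CommRing R] [AddCommGroup A] [Module R A] (H : HomAssocAlgebra R A)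
variable {M : Type*} [AddCommGroup M] [Module R M]

/-- For `i = 0, …, n - 1` the map
`x₀ ⊗ ⋯ ⊗ xₙ ↦ α(x₀) ⊗ ⋯ ⊗ α(xᵢ₋₁) ⊗ xᵢ xᵢ₊₁ ⊗ α(xᵢ₊₂) ⊗ ⋯ ⊗ α(xₙ)`. -/
def mulAt : (n : ℕ) → Fin n → ((⨂[R]^(n + 1) A) →ₗ[R] (⨂[R]^n A))
  | n + 1, i => Fin.cases
      ((consEquiv R A n).toLinearMap ∘ₗ TensorProduct.map H.mul (powMap n H.α) ∘ₗ
        (consTwoEquiv R A n).symm.toLinearMap)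
      (fun j => (consEquiv R A n).toLinearMap ∘ₗ TensorProduct.map H.α (mulAt n j) ∘ₗ
        (consEquiv R A (n + 1)).symm.toLinearMap) i

/-- The iterated product `μ_α^n : A^{⊗ n} → A`, with `μ_α^1 = id`, `μ_α^2 = μ` and
`μ_α^{n+1} = μ_α^n (μ ⊗ α^{⊗ (n-1)})`. It is only used for `n ≥ 1`. -/
def iterMul : (n : ℕ) → (⨂[R]^n A) →ₗ[R] A
  | 0 => 0
  | 1 => (PiTensorProduct.subsingletonEquiv (R := R) (s := fun _ : Fin 1 => A) 0).toLinearMap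
  | n + 2 => iterMul (n + 1) ∘ₗ H.mulAt (n + 1) 0

/-- The Hochschild-type differential
`φ ↦ α^e(x₁)·φ(x₂,…,xₙ₊₁) + ∑ᵢ₌₁ⁿ (-1)^i φ(α(x₁),…,xᵢxᵢ₊₁,…,α(xₙ₊₁))
  + (-1)^{n+1} φ(x₁,…,xₙ)·α^e(xₙ₊₁)`.
It is `∂_μμ` for `e = n - 1` and `∂_αα` for `e = n`. -/
def dHoch (l : A ⊗[R] M →ₗ[R] M) (r : M ⊗[R] A →ₗ[R] M) (e n : ℕ) :
    ((⨂[R]^n A) →ₗ[R] M) →ₗ[R] ((⨂[R]^(n + 1) A) →ₗ[R] M) where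
  toFun φ := l ∘ₗ TensorProduct.map (H.α ^ e) φ ∘ₗ (consEquiv R A n).symm.toLinearMap +
    ∑ i : Fin n, (-1 : R) ^ ((i : ℕ) + 1) • (φ ∘ₗ H.mulAt n i) +
    (-1 : R) ^ (n + 1) • (r ∘ₗ TensorProduct.map φ (H.α ^ e) ∘ₗ
      (snocEquiv R A n).symm.toLinearMap)
  map_add' φ ψ := by
    simp only [TensorProduct.map_add_right, TensorProduct.map_add_left, LinearMap.add_comp,
      LinearMap.comp_add, smul_add, Finset.sum_add_distrib]
    abel
  map_smul' c φ := by
    simp only [TensorProduct.map_smul_right, TensorProduct.map_smul_left, LinearMap.smul_comp,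
      LinearMap.comp_smul, smul_add, Finset.smul_sum, RingHom.id_apply, smul_comm c]

/-- `∂_μα φ = α_M φ - φ α^{⊗ n}`. -/
def dMuAlpha (αM : M →ₗ[R] M) (n : ℕ) :
    ((⨂[R]^n A) →ₗ[R] M) →ₗ[R] ((⨂[R]^n A) →ₗ[R] M) where
  toFun φ := αM ∘ₗ φ - φ ∘ₗ powMap n H.α
  map_add' φ ψ := by
    simp only [LinearMap.add_comp, LinearMap.comp_add]
    abel
  map_smul' c φ := by
    simp only [LinearMap.smul_comp, LinearMap.comp_smul, smul_sub, RingHom.id_apply]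

/-- `∂_αμ ψ = α^{n-1}(x₁x₂)·ψ(x₃,…,xₙ₊₂) - ψ(x₁,…,xₙ)·α^{n-1}(xₙ₊₁xₙ₊₂)`, for a map `ψ` of
`n ≥ 1` arguments. -/
def dAlphaMu (l : A ⊗[R] M →ₗ[R] M) (r : M ⊗[R] A →ₗ[R] M) (n : ℕ) :
    ((⨂[R]^n A) →ₗ[R] M) →ₗ[R] ((⨂[R]^(n + 2) A) →ₗ[R] M) where
  toFun ψ := l ∘ₗ TensorProduct.map ((H.α ^ (n - 1)) ∘ₗ H.mul) ψ ∘ₗ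
      (consTwoEquiv R A n).symm.toLinearMap -
    r ∘ₗ TensorProduct.map ψ ((H.α ^ (n - 1)) ∘ₗ H.mul) ∘ₗ (snocTwoEquiv R A n).symm.toLinearMap
  map_add' φ ψ := by
    simp only [TensorProduct.map_add_right, TensorProduct.map_add_left, LinearMap.add_comp,
      LinearMap.comp_add]
    abel
  map_smul' c φ := by
    simp only [TensorProduct.map_smul_right, TensorProduct.map_smul_left, LinearMap.smul_comp,
      LinearMap.comp_smul, smul_sub, RingHom.id_apply]

end HomAssocAlgebra

/-! ### The components of the coalgebra differential, on maps from `(N, β_N)`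

`l : N → A ⊗ N` and `r : N → N ⊗ A` are the left and the right coaction. Every map here is
obtained from its namesake above by reversing all arrows. -/

namespace HomCoassocCoalgebra

variable {R A : Type*} [CommRing R] [AddCommGroup A] [Module R A] (H : HomCoassocCoalgebra R A)
variable {N : Type*} [AddCommGroup N] [Module R N]

/-- For `i = 0, …, m - 1` the map `β^{⊗ i} ⊗ Δ ⊗ β^{⊗ (m-1-i)}`. -/
def comulAt : (m : ℕ) → Fin m → ((⨂[R]^m A) →ₗ[R] (⨂[R]^(m + 1) A))
  | m + 1, i => Fin.cases
      ((consTwoEquiv R A m).toLinearMap ∘ₗ TensorProduct.map H.comul (powMap m H.β) ∘ₗ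
        (consEquiv R A m).symm.toLinearMap)
      (fun j => (consEquiv R A (m + 1)).toLinearMap ∘ₗ TensorProduct.map H.β (comulAt m j) ∘ₗ
        (consEquiv R A m).symm.toLinearMap) i

/-- The iterated coproduct `Δ_β^m : A → A^{⊗ m}`, with `Δ_β^1 = id`, `Δ_β^2 = Δ` and
`Δ_β^{m+1} = (Δ ⊗ β^{⊗ (m-1)}) Δ_β^m`. It is only used for `m ≥ 1`. -/
def iterComul : (m : ℕ) → A →ₗ[R] (⨂[R]^m A)
  | 0 => 0
  | 1 => (PiTensorProduct.subsingletonEquiv (R := R) (s := fun _ : Fin 1 => A) 0).symm.toLinearMap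
  | m + 2 => H.comulAt (m + 1) 0 ∘ₗ iterComul (m + 1)

/-- The Cartier-type differential
`φ ↦ (β^e ⊗ φ) l + ∑ᵢ₌₁ᵐ (-1)^i (β^{⊗ (i-1)} ⊗ Δ ⊗ β^{⊗ (m-i)}) φ + (-1)^{m+1} (φ ⊗ β^e) r`.
It is `∂_ΔΔ` for `e = m - 1` and `∂_ββ` for `e = m`. -/
def dCoHoch (l : N →ₗ[R] A ⊗[R] N) (r : N →ₗ[R] N ⊗[R] A) (e m : ℕ) :
    (N →ₗ[R] (⨂[R]^m A)) →ₗ[R] (N →ₗ[R] (⨂[R]^(m + 1) A)) where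
  toFun φ := (consEquiv R A m).toLinearMap ∘ₗ TensorProduct.map (H.β ^ e) φ ∘ₗ l +
    ∑ i : Fin m, (-1 : R) ^ ((i : ℕ) + 1) • (H.comulAt m i ∘ₗ φ) +
    (-1 : R) ^ (m + 1) • ((snocEquiv R A m).toLinearMap ∘ₗ TensorProduct.map φ (H.β ^ e) ∘ₗ r)
  map_add' φ ψ := by
    simp only [TensorProduct.map_add_right, TensorProduct.map_add_left, LinearMap.add_comp,
      LinearMap.comp_add, smul_add, Finset.sum_add_distrib]
    abel
  map_smul' c φ := by
    simp only [TensorProduct.map_smul_right, TensorProduct.map_smul_left, LinearMap.smul_comp,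
      LinearMap.comp_smul, smul_add, Finset.smul_sum, RingHom.id_apply, smul_comm c]

/-- `∂_Δβ φ = φ β_N - β^{⊗ m} φ`. -/
def dDeltaBeta (βN : N →ₗ[R] N) (m : ℕ) :
    (N →ₗ[R] (⨂[R]^m A)) →ₗ[R] (N →ₗ[R] (⨂[R]^m A)) where
  toFun φ := φ ∘ₗ βN - powMap m H.β ∘ₗ φ
  map_add' φ ψ := by
    simp only [LinearMap.add_comp, LinearMap.comp_add]
    abel
  map_smul' c φ := by
    simp only [LinearMap.smul_comp, LinearMap.comp_smul, smul_sub, RingHom.id_apply]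

/-- `∂_βΔ χ = (Δ β^{m-1} ⊗ χ) l - (χ ⊗ Δ β^{m-1}) r`, for a map `χ` with values in `A^{⊗ m}`,
`m ≥ 1`. -/
def dBetaDelta (l : N →ₗ[R] A ⊗[R] N) (r : N →ₗ[R] N ⊗[R] A) (m : ℕ) :
    (N →ₗ[R] (⨂[R]^m A)) →ₗ[R] (N →ₗ[R] (⨂[R]^(m + 2) A)) where
  toFun χ := (consTwoEquiv R A m).toLinearMap ∘ₗ
      TensorProduct.map (H.comul ∘ₗ (H.β ^ (m - 1))) χ ∘ₗ l -
    (snocTwoEquiv R A m).toLinearMap ∘ₗ TensorProduct.map χ (H.comul ∘ₗ (H.β ^ (m - 1))) ∘ₗ r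
  map_add' φ ψ := by
    simp only [TensorProduct.map_add_right, TensorProduct.map_add_left, LinearMap.add_comp,
      LinearMap.comp_add]
    abel
  map_smul' c φ := by
    simp only [TensorProduct.map_smul_right, TensorProduct.map_smul_left, LinearMap.smul_comp,
      LinearMap.comp_smul, smul_sub, RingHom.id_apply]

end HomCoassocCoalgebra

/-! ### The cochain spaces -/

/-- `Hom(A^{⊗ n}, A^{⊗ m})` if `n, m ≥ 1`, and the zero subspace if `n = 0` or `m = 0`. -/
def homSubmodule (R A : Type*) [CommRing R] [AddCommGroup A] [Module R A] (n m : ℕ) :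
    Submodule R ((⨂[R]^n A) →ₗ[R] (⨂[R]^m A)) where
  carrier := {f | n = 0 ∨ m = 0 → f = 0}
  add_mem' {f g} hf hg h := by rw [hf h, hg h, add_zero]
  zero_mem' _ := rfl
  smul_mem' c f hf h := by rw [hf h, smul_zero]

/-- `H^{n,m} = Hom(A^{⊗ n}, A^{⊗ m})` for `n, m ≥ 1`, and `H^{n,m} = 0` if `n = 0` or `m = 0`. -/
def HomSpace (R A : Type*) [CommRing R] [AddCommGroup A] [Module R A] (n m : ℕ) : Type _ :=
  homSubmodule R A n m

namespace HomSpace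

variable {R A : Type*} [CommRing R] [AddCommGroup A] [Module R A] {n m n' m' : ℕ}

instance : AddCommGroup (HomSpace R A n m) :=
  inferInstanceAs (AddCommGroup (homSubmodule R A n m))

instance : Module R (HomSpace R A n m) :=
  inferInstanceAs (Module R (homSubmodule R A n m))

/-- The map `H^{n,m} → H^{n',m'}` given by a linear map between the Hom-spaces, where
`H^{n,m} = 0` whenever `H^{n',m'} = 0` by convention. -/
def restrict (f : ((⨂[R]^n A) →ₗ[R] (⨂[R]^m A)) →ₗ[R] ((⨂[R]^n' A) →ₗ[R] (⨂[R]^m' A)))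
    (h : n' = 0 ∨ m' = 0 → n = 0 ∨ m = 0) : HomSpace R A n m →ₗ[R] HomSpace R A n' m' :=
  f.restrict (p := homSubmodule R A n m) (q := homSubmodule R A n' m')
    fun x hx h' => by rw [hx (h h'), map_zero]

end HomSpace

/-- `H^{n,m} ⊕ H^{n',m} ⊕ H^{n,m'} ⊕ H^{n',m'}`. -/
abbrev GSQuad (R A : Type*) [CommRing R] [AddCommGroup A] [Module R A] (n n' m m' : ℕ) : Type _ :=
  HomSpace R A n m × HomSpace R A n' m × HomSpace R A n m' × HomSpace R A n' m'

/-- `C_GS^{n,m} = H^{n,m} ⊕ H^{n-1,m} ⊕ H^{n,m-1} ⊕ H^{n-1,m-1}`, the four summands being the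
components `μΔ`, `αΔ`, `μβ`, `αβ` in this order. For `n = 0` or `m = 0` all summands vanish. -/
abbrev GS (R A : Type*) [CommRing R] [AddCommGroup A] [Module R A] (n m : ℕ) : Type _ :=
  GSQuad R A n (n - 1) m (m - 1)

namespace HomBialgebra

variable {R A : Type*} [CommRing R] [AddCommGroup A] [Module R A] (B : HomBialgebra R A)

/-! ### Actions and coactions on tensor powers -/

/-- The componentwise product `A^{⊗ m} × A^{⊗ m} → A^{⊗ m}`. -/
def mulPow (m : ℕ) : (⨂[R]^m A) →ₗ[R] (⨂[R]^m A) →ₗ[R] (⨂[R]^m A) :=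
  PiTensorProduct.map₂ fun _ => TensorProduct.curry B.mul

/-- The usual left action of `A` on `A^{⊗ m}`: multiply by `Δ_β^m(x)` from the left. -/
def actL (m : ℕ) : A ⊗[R] (⨂[R]^m A) →ₗ[R] (⨂[R]^m A) :=
  TensorProduct.lift (B.mulPow m ∘ₗ B.iterComul m)

/-- The usual right action of `A` on `A^{⊗ m}`: multiply by `Δ_β^m(x)` from the right. -/
def actR (m : ℕ) : (⨂[R]^m A) ⊗[R] A →ₗ[R] (⨂[R]^m A) :=
  TensorProduct.lift ((B.mulPow m).compl₂ (B.iterComul m))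

/-- The twisted left action `x ⊗ v ↦ β(x) · v`. -/
def actLβ (m : ℕ) : A ⊗[R] (⨂[R]^m A) →ₗ[R] (⨂[R]^m A) :=
  B.actL m ∘ₗ TensorProduct.map B.β LinearMap.id

/-- The twisted right action `v ⊗ x ↦ v · β(x)`. -/
def actRβ (m : ℕ) : (⨂[R]^m A) ⊗[R] A →ₗ[R] (⨂[R]^m A) :=
  B.actR m ∘ₗ TensorProduct.map LinearMap.id B.β

/-- The usual left coaction
`x₁ ⊗ ⋯ ⊗ xₙ ↦ μ_α^n(x₁⁽¹⁾,…,xₙ⁽¹⁾) ⊗ (x₁⁽²⁾ ⊗ ⋯ ⊗ xₙ⁽²⁾)` of `A` on `A^{⊗ n}`. -/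
def coactL (n : ℕ) : (⨂[R]^n A) →ₗ[R] A ⊗[R] (⨂[R]^n A) :=
  TensorProduct.map (B.iterMul n) LinearMap.id ∘ₗ unzip R A n ∘ₗ
    PiTensorProduct.map fun _ => B.comul

/-- The usual right coaction
`x₁ ⊗ ⋯ ⊗ xₙ ↦ (x₁⁽¹⁾ ⊗ ⋯ ⊗ xₙ⁽¹⁾) ⊗ μ_α^n(x₁⁽²⁾,…,xₙ⁽²⁾)` of `A` on `A^{⊗ n}`. -/
def coactR (n : ℕ) : (⨂[R]^n A) →ₗ[R] (⨂[R]^n A) ⊗[R] A :=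
  TensorProduct.map LinearMap.id (B.iterMul n) ∘ₗ unzip R A n ∘ₗ
    PiTensorProduct.map fun _ => B.comul

/-- The twisted left coaction `x ↦ α(x₍₋₁₎) ⊗ x₍₀₎`. -/
def coactLα (n : ℕ) : (⨂[R]^n A) →ₗ[R] A ⊗[R] (⨂[R]^n A) :=
  TensorProduct.map B.α LinearMap.id ∘ₗ B.coactL n

/-- The twisted right coaction `x ↦ x₍₀₎ ⊗ α(x₍₁₎)`. -/
def coactRα (n : ℕ) : (⨂[R]^n A) →ₗ[R] (⨂[R]^n A) ⊗[R] A :=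
  TensorProduct.map LinearMap.id B.α ∘ₗ B.coactR n

/-! ### The two differentials -/

/-- The formula for the algebra differential `∂` on
`H^{n+1,m} ⊕ H^{n,m} ⊕ H^{n+1,m'} ⊕ H^{n,m'}`, `m' = m - 1`:
`∂(φ, ψ, χ, ξ) = (∂_μμ φ - ∂_αμ ψ, ∂_μα φ - ∂_αα ψ, ∂_μμ χ - ∂_αμ ξ, ∂_μα χ - ∂_αα ξ)`,
where `φ, ψ` take values in `A^{⊗ m}` with the usual actions and `χ, ξ` take values in
`A^{⊗ m'}` with the actions twisted by `β`. -/
def dAlgAux (n m m' : ℕ) : GSQuad R A (n + 1) n m m' →ₗ[R] GSQuad R A (n + 2) (n + 1) m m' where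
  toFun c :=
    (HomSpace.restrict (B.dHoch (B.actL m) (B.actR m) n (n + 1)) (by omega) c.1 -
      HomSpace.restrict (B.dAlphaMu (B.actL m) (B.actR m) n) (by omega) c.2.1,
     HomSpace.restrict (B.dMuAlpha (powMap m B.α) (n + 1)) (by omega) c.1 -
      HomSpace.restrict (B.dHoch (B.actL m) (B.actR m) n n) (by omega) c.2.1,
     HomSpace.restrict (B.dHoch (B.actLβ m') (B.actRβ m') n (n + 1)) (by omega) c.2.2.1 -
      HomSpace.restrict (B.dAlphaMu (B.actLβ m') (B.actRβ m') n) (by omega) c.2.2.2,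
     HomSpace.restrict (B.dMuAlpha (powMap m' B.α) (n + 1)) (by omega) c.2.2.1 -
      HomSpace.restrict (B.dHoch (B.actLβ m') (B.actRβ m') n n) (by omega) c.2.2.2)
  map_add' c d := by
    simp only [Prod.fst_add, Prod.snd_add, map_add, Prod.mk_add_mk, add_sub_add_comm]
  map_smul' a c := by
    simp only [Prod.smul_fst, Prod.smul_snd, map_smul, Prod.smul_mk, smul_sub, RingHom.id_apply]

/-- The formula for the coalgebra differential `∂ᶜ` on
`H^{n,m+1} ⊕ H^{n',m+1} ⊕ H^{n,m} ⊕ H^{n',m}`, `n' = n - 1`: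
`∂ᶜ(φ, ψ, χ, ξ) = (∂_ΔΔ φ - ∂_βΔ χ, ∂_ΔΔ ψ - ∂_βΔ ξ, ∂_Δβ φ - ∂_ββ χ, ∂_Δβ ψ - ∂_ββ ξ)`,
where `φ, χ` are maps from `A^{⊗ n}` with the usual coactions and `ψ, ξ` are maps from
`A^{⊗ n'}` with the coactions twisted by `α`. -/
def dCoalgAux (n n' m : ℕ) :
    GSQuad R A n n' (m + 1) m →ₗ[R] GSQuad R A n n' (m + 2) (m + 1) where
  toFun c :=
    (HomSpace.restrict (B.dCoHoch (B.coactL n) (B.coactR n) m (m + 1)) (by omega) c.1 -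
      HomSpace.restrict (B.dBetaDelta (B.coactL n) (B.coactR n) m) (by omega) c.2.2.1,
     HomSpace.restrict (B.dCoHoch (B.coactLα n') (B.coactRα n') m (m + 1)) (by omega) c.2.1 -
      HomSpace.restrict (B.dBetaDelta (B.coactLα n') (B.coactRα n') m) (by omega) c.2.2.2,
     HomSpace.restrict (B.dDeltaBeta (powMap n B.β) (m + 1)) (by omega) c.1 -
      HomSpace.restrict (B.dCoHoch (B.coactL n) (B.coactR n) m m) (by omega) c.2.2.1,
     HomSpace.restrict (B.dDeltaBeta (powMap n' B.β) (m + 1)) (by omega) c.2.1 -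
      HomSpace.restrict (B.dCoHoch (B.coactLα n') (B.coactRα n') m m) (by omega) c.2.2.2)
  map_add' c d := by
    simp only [Prod.fst_add, Prod.snd_add, map_add, Prod.mk_add_mk, add_sub_add_comm]
  map_smul' a c := by
    simp only [Prod.smul_fst, Prod.smul_snd, map_smul, Prod.smul_mk, smul_sub, RingHom.id_apply]

/-- The algebra differential `∂ : C_GS^{n,m} → C_GS^{n+1,m}`. -/
def dAlg : (n m : ℕ) → GS R A n m →ₗ[R] GS R A (n + 1) m
  | 0, _ => 0
  | n + 1, m => B.dAlgAux n m (m - 1)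

/-- The coalgebra differential `∂ᶜ : C_GS^{n,m} → C_GS^{n,m+1}`. -/
def dCoalg : (n m : ℕ) → GS R A n m →ₗ[R] GS R A n (m + 1)
  | _, 0 => 0
  | n, m + 1 => B.dCoalgAux n (n - 1) m

end HomBialgebra

/-! ### The total complex -/

/-- The total space `⨁_{n+m=k} C_GS^{n,m}`. -/
abbrev GSTot (R A : Type*) [CommRing R] [AddCommGroup A] [Module R A] (k : ℕ) : Type _ :=
  (p : Finset.HasAntidiagonal.antidiagonal k) → GS R A p.1.1 p.1.2

namespace HomBialgebra

variable {R A : Type*} [CommRing R] [AddCommGroup A] [Module R A] (B : HomBialgebra R A)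

/-- The total differential, equal to `∂ + (-1)^n ∂ᶜ` on `C_GS^{n,m}`. -/
def dTot (k : ℕ) : GSTot R A k →ₗ[R] GSTot R A (k + 1) :=
  ∑ p : Finset.HasAntidiagonal.antidiagonal k,
    (LinearMap.single R (fun q : Finset.HasAntidiagonal.antidiagonal (k + 1) => GS R A q.1.1 q.1.2)
        ⟨(p.1.1 + 1, p.1.2), by
          have := Finset.HasAntidiagonal.mem_antidiagonal.mp p.2; rw [Finset.HasAntidiagonal.mem_antidiagonal]; omega⟩ ∘ₗ
        B.dAlg p.1.1 p.1.2 +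
      (-1 : R) ^ p.1.1 •
        (LinearMap.single R (fun q : Finset.HasAntidiagonal.antidiagonal (k + 1) => GS R A q.1.1 q.1.2)
          ⟨(p.1.1, p.1.2 + 1), by
            have := Finset.HasAntidiagonal.mem_antidiagonal.mp p.2; rw [Finset.HasAntidiagonal.mem_antidiagonal]; omega⟩ ∘ₗ
          B.dCoalg p.1.1 p.1.2)) ∘ₗ
    LinearMap.proj p

end HomBialgebra

end AlphaGS

end

/-!
Both differentials are built from alternating sums of cofaces.

For the algebra direction let `M` be a Hom-bimodule over `A`. The cofaces of a map
`φ : A^{⊗ n} → M` are the left outer one `x ↦ α^e(x₁) · φ(x₂, …)`, the inner ones, which merge two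
neighbouring arguments and apply `α` to the others, and the right outer one. Hom-associativity gives
all cosimplicial identities, except that two equal-sided outer cofaces in a row merge their
arguments only up to `α` on `φ`. The defect of the squared differential (`alternating_cofaces_sq`,
`dHoch_dHoch`) is therefore concentrated at the two ends, where it is `∂_{αμ} ∂_{μα}`. Together with
`∂_{αα} ∂_{αα} = ∂_{μα} ∂_{αμ}`, `∂_{μα} ∂_{μμ} = ∂_{αα} ∂_{μα}` and `∂_{μμ} ∂_{αμ} = ∂_{αμ} ∂_{αα}`,
the last one from `alternating_cofaces_comm`, this is `∂∂ = 0`. The argument applies because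
`A^{⊗ m}` is a Hom-algebra and the iterated coproduct `A → A^{⊗ m}`, twisted by `β` or not, is a
morphism of Hom-algebras, so that it induces a bimodule (`isBimodule_of_hom`). Dually `A^{⊗ n}` is a
Hom-bicomodule along the iterated product, twisted by `α` or not, and `∂ᶜ∂ᶜ = 0` follows from
`dCoHoch_dCoHoch`.

For `∂ᶜ∂ = ∂∂ᶜ` each coface in one direction commutes with each coface in the other. An outer coface
in the algebra direction is described by a decomposition `N' = P ⊗ N` of the source for which the
iterated product becomes `c'(p ⊗ x) = g(p) c(x)` (`IsLeftSplitting`), with `P = A` for `∂_{μμ}` and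
`∂_{αα}` and `P = A ⊗ A` for `∂_{αμ}`. An outer coface in the coalgebra direction is described by a
decomposition `M' = Q ⊗ M` of the target for which the iterated coproduct becomes
`u'(a) = h(a⁽¹⁾) ⊗ u(a⁽²⁾)` (`IsLeftJoining`), with `Q = A` or `Q = A ⊗ A`. The compatibility of
product and coproduct then yields the four lemmas `coleftOp_leftOp`, `corightOp_leftOp`,
`coleftOp_rightOp` and `corightOp_rightOp`, from which all pairs of components commute. For
`P = A ⊗ A` Hom-associativity forces `c` to be the `α`-twisted iterated product, and for
`Q = A ⊗ A` Hom-coassociativity forces `u` to be the `β`-twisted iterated coproduct; this is where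
the twists in the definition of the bicomplex come from.

In low degrees, where some exponents `n - 1` are truncated and `A^{⊗ 0}` carries no (co)module
structure, the cochains concerned are zero.
-/

namespace AlphaGS

/-! ### Tensor powers -/

section TensorPowers

variable {R A : Type*} [CommRing R] [AddCommGroup A] [Module R A]

lemma consEquiv_tprod {n : ℕ} (a : A) (x : Fin n → A) :
    consEquiv R A n (a ⊗ₜ PiTensorProduct.tprod R x) =
      PiTensorProduct.tprod R (Fin.cons a x : Fin (n + 1) → A) := by
  simp only [consEquiv, LinearEquiv.trans_apply, TensorProduct.congr_tmul,
    PiTensorProduct.subsingletonEquiv_symm_apply', LinearEquiv.refl_apply]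
  rw [← TensorPower.gMul_def, TensorPower.tprod_mul_tprod, TensorPower.cast_tprod]
  congr 1
  ext i
  refine Fin.cases ?_ (fun j => ?_) i
  · simp [Fin.append, Fin.addCases]
  · simp [Fin.append, Fin.addCases]
    congr 1

lemma snocEquiv_tprod {n : ℕ} (a : A) (x : Fin n → A) :
    snocEquiv R A n (PiTensorProduct.tprod R x ⊗ₜ a) =
      PiTensorProduct.tprod R (Fin.snoc x a : Fin (n + 1) → A) := by
  simp only [snocEquiv, LinearEquiv.trans_apply, TensorProduct.congr_tmul,
    PiTensorProduct.subsingletonEquiv_symm_apply', LinearEquiv.refl_apply]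
  rw [← TensorPower.gMul_def, TensorPower.tprod_mul_tprod]
  congr 1
  ext i
  refine Fin.lastCases ?_ (fun j => ?_) i
  · simp [Fin.append, Fin.addCases]
  · simp [Fin.append, Fin.addCases]

@[elab_as_elim]
lemma consInduction {n : ℕ} {P : (⨂[R]^(n + 1) A) → Prop} (x : ⨂[R]^(n + 1) A)
    (cons : ∀ a y, P (consEquiv R A n (a ⊗ₜ y)))
    (add : ∀ x y, P x → P y → P (x + y)) : P x := by
  obtain ⟨z, rfl⟩ := (consEquiv R A n).surjective x
  induction z with
  | zero => simpa using cons 0 0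
  | tmul a y => exact cons a y
  | add z w hz hw => rw [map_add]; exact add _ _ hz hw

/-- `A^{⊗ 0}` is spanned by the empty tensor. The empty tensor is written as the elementary tensor
of a constant family, so that it can be matched syntactically. -/
@[elab_as_elim]
lemma zeroInduction {P : (⨂[R]^0 A) → Prop} (x : ⨂[R]^0 A)
    (smul : ∀ r : R, P (r • PiTensorProduct.tprod R (fun _ : Fin 0 => (0 : A)))) : P x := by
  obtain ⟨r, rfl⟩ := (TensorPower.algebraMap₀ (R := R) (M := A)).surjective x
  rw [TensorPower.algebraMap₀_eq_smul_one, TensorPower.gOne_def]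
  convert smul r using 3

@[simp]
lemma consTwoEquiv_tmul {n : ℕ} (a b : A) (x : ⨂[R]^n A) :
    consTwoEquiv R A n ((a ⊗ₜ b) ⊗ₜ x) = consEquiv R A (n + 1) (a ⊗ₜ consEquiv R A n (b ⊗ₜ x)) :=
  rfl

@[simp]
lemma snocTwoEquiv_tmul {n : ℕ} (a b : A) (x : ⨂[R]^n A) :
    snocTwoEquiv R A n (x ⊗ₜ (a ⊗ₜ b)) = snocEquiv R A (n + 1) (snocEquiv R A n (x ⊗ₜ a) ⊗ₜ b) :=
  rfl

/-- Two linear maps on a tensor power which agree on elementary tensors agree. -/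
lemma apply_eq_of_tprod {n : ℕ} {M : Type*} [AddCommGroup M] [Module R M]
    {f g : (⨂[R]^n A) →ₗ[R] M}
    (h : ∀ x, f (PiTensorProduct.tprod R x) = g (PiTensorProduct.tprod R x)) (x) : f x = g x := by
  have : f = g := PiTensorProduct.ext (MultilinearMap.ext h)
  rw [this]

lemma snocEquiv_consEquiv {n : ℕ} (a b : A) (x : ⨂[R]^n A) :
    snocEquiv R A (n + 1) (consEquiv R A n (a ⊗ₜ x) ⊗ₜ b) =
      consEquiv R A (n + 1) (a ⊗ₜ snocEquiv R A n (x ⊗ₜ b)) := by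
  refine apply_eq_of_tprod
    (f := (snocEquiv R A (n + 1)).toLinearMap ∘ₗ (TensorProduct.mk R _ _).flip b ∘ₗ
      (consEquiv R A n).toLinearMap ∘ₗ TensorProduct.mk R _ _ a)
    (g := (consEquiv R A (n + 1)).toLinearMap ∘ₗ TensorProduct.mk R _ _ a ∘ₗ
      (snocEquiv R A n).toLinearMap ∘ₗ (TensorProduct.mk R _ _).flip b) (fun x => ?_) x
  simp [consEquiv_tprod, snocEquiv_tprod, Fin.cons_snoc_eq_snoc_cons]

lemma snocEquiv_zero (a : A) (x : ⨂[R]^0 A) :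
    snocEquiv R A 0 (x ⊗ₜ a) = consEquiv R A 0 (a ⊗ₜ x) := by
  refine apply_eq_of_tprod
    (f := (snocEquiv R A 0).toLinearMap ∘ₗ (TensorProduct.mk R _ _).flip a)
    (g := (consEquiv R A 0).toLinearMap ∘ₗ TensorProduct.mk R _ _ a) (fun x => ?_) x
  simp only [LinearMap.coe_comp, LinearEquiv.coe_coe, Function.comp_apply, LinearMap.flip_apply,
    TensorProduct.mk_apply, consEquiv_tprod, snocEquiv_tprod]
  congr 1
  ext i
  fin_cases i
  rfl

@[elab_as_elim]
lemma snocInduction {n : ℕ} {P : (⨂[R]^(n + 1) A) → Prop} (x : ⨂[R]^(n + 1) A)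
    (snoc : ∀ y a, P (snocEquiv R A n (y ⊗ₜ a)))
    (add : ∀ x y, P x → P y → P (x + y)) : P x := by
  obtain ⟨z, rfl⟩ := (snocEquiv R A n).surjective x
  induction z with
  | zero => simpa using snoc 0 0
  | tmul y a => exact snoc y a
  | add z w hz hw => rw [map_add]; exact add _ _ hz hw

section HomExt

variable {M : Type*} [AddCommGroup M] [Module R M]

lemma hom_ext_cons {n : ℕ} {f g : (⨂[R]^(n + 1) A) →ₗ[R] M}
    (h : ∀ a x, f (consEquiv R A n (a ⊗ₜ x)) = g (consEquiv R A n (a ⊗ₜ x))) : f = g := by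
  refine LinearMap.ext fun x => ?_
  induction x using consInduction with
  | add x y hx hy => simp only [map_add, hx, hy]
  | cons a x => exact h a x

lemma hom_ext_snoc {n : ℕ} {f g : (⨂[R]^(n + 1) A) →ₗ[R] M}
    (h : ∀ x a, f (snocEquiv R A n (x ⊗ₜ a)) = g (snocEquiv R A n (x ⊗ₜ a))) : f = g := by
  refine LinearMap.ext fun x => ?_
  induction x using snocInduction with
  | add x y hx hy => simp only [map_add, hx, hy]
  | snoc x a => exact h x a

lemma hom_ext_cons_cons {n : ℕ} {f g : (⨂[R]^(n + 2) A) →ₗ[R] M}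
    (h : ∀ a b x, f (consEquiv R A (n + 1) (a ⊗ₜ consEquiv R A n (b ⊗ₜ x))) =
      g (consEquiv R A (n + 1) (a ⊗ₜ consEquiv R A n (b ⊗ₜ x)))) : f = g := by
  refine hom_ext_cons fun a x => ?_
  induction x using consInduction with
  | add x y hx hy => simp only [TensorProduct.tmul_add, map_add, hx, hy]
  | cons b x => exact h a b x

lemma hom_ext_snoc_snoc {n : ℕ} {f g : (⨂[R]^(n + 2) A) →ₗ[R] M}
    (h : ∀ x a b, f (snocEquiv R A (n + 1) (snocEquiv R A n (x ⊗ₜ a) ⊗ₜ b)) =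
      g (snocEquiv R A (n + 1) (snocEquiv R A n (x ⊗ₜ a) ⊗ₜ b))) : f = g := by
  refine hom_ext_snoc fun x b => ?_
  induction x using snocInduction with
  | add x y hx hy => simp only [TensorProduct.add_tmul, map_add, hx, hy]
  | snoc x a => exact h x a b

lemma hom_ext_cons_snoc {n : ℕ} {f g : (⨂[R]^(n + 2) A) →ₗ[R] M}
    (h : ∀ a x b, f (consEquiv R A (n + 1) (a ⊗ₜ snocEquiv R A n (x ⊗ₜ b))) =
      g (consEquiv R A (n + 1) (a ⊗ₜ snocEquiv R A n (x ⊗ₜ b)))) : f = g := by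
  refine hom_ext_cons fun a x => ?_
  induction x using snocInduction with
  | add x y hx hy => simp only [TensorProduct.tmul_add, map_add, hx, hy]
  | snoc x b => exact h a x b

end HomExt

lemma map_consEquiv {B : Type*} [AddCommGroup B] [Module R B] {n : ℕ} (f : A →ₗ[R] B) (a : A)
    (x : ⨂[R]^n A) :
    PiTensorProduct.map (fun _ : Fin (n + 1) => f) (consEquiv R A n (a ⊗ₜ x)) =
      consEquiv R B n (f a ⊗ₜ PiTensorProduct.map (fun _ : Fin n => f) x) := by
  refine apply_eq_of_tprod
    (f := PiTensorProduct.map (fun _ : Fin (n + 1) => f) ∘ₗ (consEquiv R A n).toLinearMap ∘ₗ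
      TensorProduct.mk R _ _ a)
    (g := (consEquiv R B n).toLinearMap ∘ₗ TensorProduct.mk R _ _ (f a) ∘ₗ
      PiTensorProduct.map (fun _ : Fin n => f)) (fun x => ?_) x
  simp only [LinearMap.coe_comp, LinearEquiv.coe_coe, Function.comp_apply,
    TensorProduct.mk_apply, consEquiv_tprod, PiTensorProduct.map_tprod]
  congr 1
  ext i
  refine Fin.cases ?_ (fun j => ?_) i <;> simp

lemma map_snocEquiv {B : Type*} [AddCommGroup B] [Module R B] {n : ℕ} (f : A →ₗ[R] B) (a : A)
    (x : ⨂[R]^n A) :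
    PiTensorProduct.map (fun _ : Fin (n + 1) => f) (snocEquiv R A n (x ⊗ₜ a)) =
      snocEquiv R B n (PiTensorProduct.map (fun _ : Fin n => f) x ⊗ₜ f a) := by
  refine apply_eq_of_tprod
    (f := PiTensorProduct.map (fun _ : Fin (n + 1) => f) ∘ₗ (snocEquiv R A n).toLinearMap ∘ₗ
      (TensorProduct.mk R _ _).flip a)
    (g := (snocEquiv R B n).toLinearMap ∘ₗ (TensorProduct.mk R _ _).flip (f a) ∘ₗ
      PiTensorProduct.map (fun _ : Fin n => f)) (fun x => ?_) x
  simp only [LinearMap.coe_comp, LinearEquiv.coe_coe, Function.comp_apply,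
    LinearMap.flip_apply, TensorProduct.mk_apply, snocEquiv_tprod, PiTensorProduct.map_tprod]
  congr 1
  ext i
  refine Fin.lastCases ?_ (fun j => ?_) i <;> simp

@[simp]
lemma powMap_cons {n : ℕ} (f : A →ₗ[R] A) (a : A) (x : ⨂[R]^n A) :
    powMap (n + 1) f (consEquiv R A n (a ⊗ₜ x)) = consEquiv R A n (f a ⊗ₜ powMap n f x) :=
  map_consEquiv f a x

@[simp]
lemma powMap_snoc {n : ℕ} (f : A →ₗ[R] A) (a : A) (x : ⨂[R]^n A) :
    powMap (n + 1) f (snocEquiv R A n (x ⊗ₜ a)) = snocEquiv R A n (powMap n f x ⊗ₜ f a) :=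
  map_snocEquiv f a x

lemma powMap_zero (f : A →ₗ[R] A) (x : ⨂[R]^0 A) : powMap 0 f x = x := by
  refine apply_eq_of_tprod (f := powMap 0 f) (g := LinearMap.id) (fun x => ?_) x
  simp only [powMap, PiTensorProduct.map_tprod, LinearMap.id_apply]
  congr 1
  exact Subsingleton.elim _ _

lemma powMap_comm {f g : A →ₗ[R] A} (h : ∀ a, f (g a) = g (f a)) (n : ℕ) (x : ⨂[R]^n A) :
    powMap n f (powMap n g x) = powMap n g (powMap n f x) := by
  induction n with
  | zero => simp only [powMap_zero]
  | succ n ih =>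
    induction x using consInduction with
    | cons a x => simp only [powMap_cons, h, ih]
    | add x y hx hy => simp only [map_add, hx, hy]

lemma powMap_consTwo {n : ℕ} (f : A →ₗ[R] A) (t : A ⊗[R] A) (x : ⨂[R]^n A) :
    powMap (n + 2) f (consTwoEquiv R A n (t ⊗ₜ x)) =
      consTwoEquiv R A n (TensorProduct.map f f t ⊗ₜ powMap n f x) := by
  induction t with
  | zero => simp
  | tmul a b => simp
  | add t s ht hs => simp only [TensorProduct.add_tmul, map_add, ht, hs]

lemma powMap_snocTwo {n : ℕ} (f : A →ₗ[R] A) (t : A ⊗[R] A) (x : ⨂[R]^n A) :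
    powMap (n + 2) f (snocTwoEquiv R A n (x ⊗ₜ t)) =
      snocTwoEquiv R A n (powMap n f x ⊗ₜ TensorProduct.map f f t) := by
  induction t with
  | zero => simp
  | tmul a b => simp
  | add t s ht hs => simp only [TensorProduct.tmul_add, map_add, ht, hs]

lemma snocEquiv_consTwoEquiv {n : ℕ} (t : A ⊗[R] A) (x : ⨂[R]^n A) (a : A) :
    snocEquiv R A (n + 2) (consTwoEquiv R A n (t ⊗ₜ x) ⊗ₜ a) =
      consTwoEquiv R A (n + 1) (t ⊗ₜ snocEquiv R A n (x ⊗ₜ a)) := by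
  induction t with
  | zero => simp
  | tmul a b => simp [snocEquiv_consEquiv]
  | add t s ht hs => simp only [TensorProduct.add_tmul, map_add, ht, hs]

lemma snocTwoEquiv_consEquiv {n : ℕ} (t : A ⊗[R] A) (x : ⨂[R]^n A) (a : A) :
    snocTwoEquiv R A (n + 1) (consEquiv R A n (a ⊗ₜ x) ⊗ₜ t) =
      consEquiv R A (n + 2) (a ⊗ₜ snocTwoEquiv R A n (x ⊗ₜ t)) := by
  induction t with
  | zero => simp
  | tmul a b => simp [snocEquiv_consEquiv]
  | add t s ht hs => simp only [TensorProduct.tmul_add, map_add, ht, hs]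

/-! ### Comultiplication of tensor powers -/

lemma unzip_cons {n : ℕ} (t : A ⊗[R] A) (x : ⨂[R]^n (A ⊗[R] A)) :
    unzip R A (n + 1) (consEquiv R (A ⊗[R] A) n (t ⊗ₜ x)) =
      TensorProduct.map (consEquiv R A n).toLinearMap (consEquiv R A n).toLinearMap
        (TensorProduct.tensorTensorTensorComm R A A (⨂[R]^n A) (⨂[R]^n A)
          (t ⊗ₜ unzip R A n x)) := by
  simp [unzip]

lemma unzip_snoc {n : ℕ} (t : A ⊗[R] A) (x : ⨂[R]^n (A ⊗[R] A)) :
    unzip R A (n + 1) (snocEquiv R (A ⊗[R] A) n (x ⊗ₜ t)) =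
      TensorProduct.map (snocEquiv R A n).toLinearMap (snocEquiv R A n).toLinearMap
        (TensorProduct.tensorTensorTensorComm R (⨂[R]^n A) (⨂[R]^n A) A A
          (unzip R A n x ⊗ₜ t)) := by
  induction n with
  | zero =>
    rw [snocEquiv_zero, unzip_cons]
    generalize unzip R A 0 x = w
    induction w with
    | zero => simp
    | add w w' hw hw' => simp only [TensorProduct.add_tmul, TensorProduct.tmul_add, map_add, hw, hw']
    | tmul u v =>
      induction t with
      | zero => simp
      | add t s ht hs => simp only [TensorProduct.add_tmul, TensorProduct.tmul_add, map_add, ht, hs]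
      | tmul a b => simp [snocEquiv_zero]
  | succ n ih =>
    induction x using consInduction with
    | add x y hx hy => simp only [TensorProduct.add_tmul, map_add, hx, hy]
    | cons s x =>
      rw [snocEquiv_consEquiv, unzip_cons, ih, unzip_cons]
      clear ih
      generalize unzip R A n x = w
      induction w with
      | zero => simp
      | add w w' hw hw' =>
        simp only [TensorProduct.add_tmul, TensorProduct.tmul_add, map_add, hw, hw']
      | tmul u v =>
        induction t with
        | zero => simp
        | add t s ht hs =>
          simp only [TensorProduct.tmul_add, map_add, ht, hs]
        | tmul a b =>
          induction s with
          | zero => simp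
          | add t s ht hs =>
            simp only [TensorProduct.add_tmul, map_add, ht, hs]
          | tmul c d => simp [snocEquiv_consEquiv]

/-- The componentwise comultiplication
`x₁ ⊗ ⋯ ⊗ xₙ ↦ (x₁⁽¹⁾ ⊗ ⋯ ⊗ xₙ⁽¹⁾) ⊗ (x₁⁽²⁾ ⊗ ⋯ ⊗ xₙ⁽²⁾)` of `A^{⊗ n}`. -/
noncomputable def comulPow (n : ℕ) (d : A →ₗ[R] A ⊗[R] A) :
    (⨂[R]^n A) →ₗ[R] (⨂[R]^n A) ⊗[R] (⨂[R]^n A) :=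
  unzip R A n ∘ₗ PiTensorProduct.map fun _ => d

lemma comulPow_cons {n : ℕ} (d : A →ₗ[R] A ⊗[R] A) (a : A) (x : ⨂[R]^n A) :
    comulPow (n + 1) d (consEquiv R A n (a ⊗ₜ x)) =
      TensorProduct.map (consEquiv R A n).toLinearMap (consEquiv R A n).toLinearMap
        (TensorProduct.tensorTensorTensorComm R A A (⨂[R]^n A) (⨂[R]^n A)
          (d a ⊗ₜ comulPow n d x)) := by
  rw [comulPow, LinearMap.comp_apply, map_consEquiv, unzip_cons]
  rfl

lemma comulPow_snoc {n : ℕ} (d : A →ₗ[R] A ⊗[R] A) (a : A) (x : ⨂[R]^n A) :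
    comulPow (n + 1) d (snocEquiv R A n (x ⊗ₜ a)) =
      TensorProduct.map (snocEquiv R A n).toLinearMap (snocEquiv R A n).toLinearMap
        (TensorProduct.tensorTensorTensorComm R (⨂[R]^n A) (⨂[R]^n A) A A
          (comulPow n d x ⊗ₜ d a)) := by
  rw [comulPow, LinearMap.comp_apply, map_snocEquiv, unzip_snoc]
  rfl

end TensorPowers

/-! ### Merging adjacent factors -/

namespace HomAssocAlgebra

variable {R A : Type*} [CommRing R] [AddCommGroup A] [Module R A] (H : HomAssocAlgebra R A)

lemma hom_assoc_apply (a b c : A) :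
    H.mul (H.mul (a ⊗ₜ b) ⊗ₜ H.α c) = H.mul (H.α a ⊗ₜ H.mul (b ⊗ₜ c)) :=
  LinearMap.congr_fun H.hom_assoc ((a ⊗ₜ b) ⊗ₜ c)

lemma alpha_mul (a b : A) : H.α (H.mul (a ⊗ₜ b)) = H.mul (H.α a ⊗ₜ H.α b) :=
  LinearMap.congr_fun H.multiplicative (a ⊗ₜ b)

lemma alpha_pow_mul (e : ℕ) (a b : A) :
    (H.α ^ e) (H.mul (a ⊗ₜ b)) = H.mul ((H.α ^ e) a ⊗ₜ (H.α ^ e) b) := by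
  induction e with
  | zero => rfl
  | succ e ih => simp only [pow_succ', Module.End.mul_apply, ih, alpha_mul]

lemma mulAt_zero_consTwo {n : ℕ} (t : A ⊗[R] A) (x : ⨂[R]^n A) :
    H.mulAt (n + 1) 0 (consTwoEquiv R A n (t ⊗ₜ x)) =
      consEquiv R A n (H.mul t ⊗ₜ powMap n H.α x) := by
  simp [mulAt]

@[simp]
lemma mulAt_zero_cons {n : ℕ} (a b : A) (x : ⨂[R]^n A) :
    H.mulAt (n + 1) 0 (consEquiv R A (n + 1) (a ⊗ₜ consEquiv R A n (b ⊗ₜ x))) =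
      consEquiv R A n (H.mul (a ⊗ₜ b) ⊗ₜ powMap n H.α x) := by
  rw [← consTwoEquiv_tmul, mulAt_zero_consTwo]

@[simp]
lemma mulAt_succ_cons {n : ℕ} (j : Fin n) (a : A) (x : ⨂[R]^(n + 1) A) :
    H.mulAt (n + 1) j.succ (consEquiv R A (n + 1) (a ⊗ₜ x)) =
      consEquiv R A n (H.α a ⊗ₜ H.mulAt n j x) := by
  simp [mulAt]

@[simp]
lemma mulAt_castSucc_snoc {n : ℕ} (j : Fin n) (a : A) (x : ⨂[R]^(n + 1) A) :
    H.mulAt (n + 1) j.castSucc (snocEquiv R A (n + 1) (x ⊗ₜ a)) =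
      snocEquiv R A n (H.mulAt n j x ⊗ₜ H.α a) := by
  induction n with
  | zero => exact j.elim0
  | succ n ih =>
    induction x using consInduction with
    | add x y hx hy => simp only [TensorProduct.add_tmul, map_add, hx, hy]
    | cons b x =>
      cases j using Fin.cases with
      | zero =>
        induction x using consInduction with
        | add x y hx hy =>
          simp only [TensorProduct.add_tmul, TensorProduct.tmul_add, map_add, hx, hy]
        | cons c x => simp [snocEquiv_consEquiv]
      | succ j => rw [← Fin.succ_castSucc, snocEquiv_consEquiv, mulAt_succ_cons, ih,
          mulAt_succ_cons, snocEquiv_consEquiv]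

@[simp]
lemma mulAt_last_snoc {n : ℕ} (a b : A) (x : ⨂[R]^n A) :
    H.mulAt (n + 1) (Fin.last n) (snocEquiv R A (n + 1) (snocEquiv R A n (x ⊗ₜ a) ⊗ₜ b)) =
      snocEquiv R A n (powMap n H.α x ⊗ₜ H.mul (a ⊗ₜ b)) := by
  induction n with
  | zero =>
    simp only [snocEquiv_zero, snocEquiv_consEquiv]
    exact H.mulAt_zero_cons a b x
  | succ n ih =>
    induction x using consInduction with
    | add x y hx hy => simp only [TensorProduct.add_tmul, map_add, hx, hy]
    | cons c x =>
      rw [← Fin.succ_last, snocEquiv_consEquiv, snocEquiv_consEquiv, mulAt_succ_cons, ih,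
        powMap_cons, snocEquiv_consEquiv]

lemma mulAt_last_snocTwo {n : ℕ} (t : A ⊗[R] A) (x : ⨂[R]^n A) :
    H.mulAt (n + 1) (Fin.last n) (snocTwoEquiv R A n (x ⊗ₜ t)) =
      snocEquiv R A n (powMap n H.α x ⊗ₜ H.mul t) := by
  induction t with
  | zero => simp
  | tmul a b => simp
  | add t s ht hs => simp only [TensorProduct.tmul_add, map_add, ht, hs]

lemma mulAt_powMap {f : A →ₗ[R] A} (hf : ∀ a b, f (H.mul (a ⊗ₜ b)) = H.mul (f a ⊗ₜ f b))
    (hα : ∀ a, f (H.α a) = H.α (f a)) {n : ℕ} (i : Fin n) (x : ⨂[R]^(n + 1) A) :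
    H.mulAt n i (powMap (n + 1) f x) = powMap n f (H.mulAt n i x) := by
  induction n with
  | zero => exact i.elim0
  | succ n ih =>
    induction x using consInduction with
    | add x y hx hy => simp only [map_add, hx, hy]
    | cons a x =>
      cases i using Fin.cases with
      | zero =>
        induction x using consInduction with
        | add x y hx hy => simp only [TensorProduct.tmul_add, map_add, hx, hy]
        | cons b x => simp [hf, powMap_comm hα]
      | succ i => simp [ih, hα]

/-- The maps merging two adjacent factors satisfy the presimplicial identities. For neighbouring
indices this is Hom-associativity. -/
lemma mulAt_mulAt {n : ℕ} {i j : Fin n} (hij : i ≤ j) (x : ⨂[R]^(n + 2) A) :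
    H.mulAt n j (H.mulAt (n + 1) i.castSucc x) = H.mulAt n i (H.mulAt (n + 1) j.succ x) := by
  induction n with
  | zero => exact i.elim0
  | succ n ih =>
    induction x using consInduction with
    | add x y hx hy => simp only [map_add, hx, hy]
    | cons a x =>
      cases i using Fin.cases with
      | zero =>
        induction x using consInduction with
        | add x y hx hy => simp only [TensorProduct.tmul_add, map_add, hx, hy]
        | cons b x =>
          cases j using Fin.cases with
          | zero =>
            induction x using consInduction with
            | add x y hx hy => simp only [TensorProduct.tmul_add, map_add, hx, hy]
            | cons c x =>
              rw [Fin.castSucc_zero, mulAt_zero_cons, powMap_cons, mulAt_zero_cons,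
                mulAt_succ_cons, mulAt_zero_cons, mulAt_zero_cons, hom_assoc_apply]
          | succ j =>
            rw [Fin.castSucc_zero, mulAt_zero_cons, mulAt_succ_cons, mulAt_succ_cons,
              mulAt_succ_cons, mulAt_zero_cons, alpha_mul,
              H.mulAt_powMap H.alpha_mul (fun _ => rfl)]
      | succ i =>
        cases j using Fin.cases with
        | zero => exact absurd hij (by simp)
        | succ j =>
          rw [← Fin.succ_castSucc, mulAt_succ_cons, mulAt_succ_cons, mulAt_succ_cons,
            mulAt_succ_cons, ih (Fin.succ_le_succ_iff.mp hij)]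

/-- Merging any two neighbouring arguments before multiplying does not change the iterated
product. The definition of the iterated product is the case of the first two arguments. -/
lemma iterMul_mulAt {n : ℕ} (i : Fin (n + 1)) (x : ⨂[R]^(n + 2) A) :
    H.iterMul (n + 1) (H.mulAt (n + 1) i x) = H.iterMul (n + 2) x := by
  induction n with
  | zero => obtain rfl : i = 0 := Fin.fin_one_eq_zero i; rfl
  | succ n ih =>
    cases i using Fin.cases with
    | zero => rfl
    | succ i =>
      calc H.iterMul (n + 2) (H.mulAt (n + 2) i.succ x)
          = H.iterMul (n + 1) (H.mulAt (n + 1) 0 (H.mulAt (n + 2) i.succ x)) := rfl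
        _ = H.iterMul (n + 1) (H.mulAt (n + 1) i (H.mulAt (n + 2) (Fin.castSucc 0) x)) := by
            rw [H.mulAt_mulAt (Fin.zero_le i)]
        _ = _ := ih i _

lemma iterMul_succ_succ (n : ℕ) (x : ⨂[R]^(n + 2) A) :
    H.iterMul (n + 2) x = H.iterMul (n + 1) (H.mulAt (n + 1) 0 x) := rfl

lemma iterMul_one_cons (a : A) (r : R) :
    H.iterMul 1 (consEquiv R A 0
      (a ⊗ₜ (r • PiTensorProduct.tprod R (fun _ : Fin 0 => (0 : A))))) = r • a := by
  rw [TensorProduct.tmul_smul, map_smul, map_smul, consEquiv_tprod]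
  simp [iterMul]

/-- Splitting off the first argument of an iterated product. The twist by `α ^ n` appears because
every merging of two of the other arguments applies `α` to the first one. -/
lemma iterMul_cons {n : ℕ} (a : A) (x : ⨂[R]^(n + 1) A) :
    H.iterMul (n + 2) (consEquiv R A (n + 1) (a ⊗ₜ x)) =
      H.mul ((H.α ^ n) a ⊗ₜ H.iterMul (n + 1) x) := by
  induction n generalizing a with
  | zero =>
    induction x using consInduction with
    | add x y hx hy => simp only [TensorProduct.tmul_add, map_add, hx, hy]
    | cons b x =>
      rw [iterMul_succ_succ, mulAt_zero_cons, powMap_zero]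
      induction x using zeroInduction with
      | smul r => rw [iterMul_one_cons, iterMul_one_cons]; simp
  | succ n ih =>
    -- Merging the second and the third argument first leaves `α a` in front.
    rw [← H.iterMul_mulAt (Fin.succ 0), mulAt_succ_cons, ih, ← iterMul_succ_succ, pow_succ]
    rfl

lemma iterMul_snoc {n : ℕ} (a : A) (x : ⨂[R]^(n + 1) A) :
    H.iterMul (n + 2) (snocEquiv R A (n + 1) (x ⊗ₜ a)) =
      H.mul (H.iterMul (n + 1) x ⊗ₜ (H.α ^ n) a) := by
  induction n generalizing a with
  | zero =>
    induction x using consInduction with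
    | add x y hx hy => simp only [TensorProduct.add_tmul, map_add, hx, hy]
    | cons b x =>
      rw [snocEquiv_consEquiv, snocEquiv_zero, iterMul_succ_succ, mulAt_zero_cons, powMap_zero]
      induction x using zeroInduction with
      | smul r =>
        rw [iterMul_one_cons, iterMul_one_cons, ← TensorProduct.smul_tmul', map_smul]
        rfl
  | succ n ih =>
    rw [← H.iterMul_mulAt (Fin.castSucc 0), mulAt_castSucc_snoc, ih, ← iterMul_succ_succ,
      pow_succ]
    rfl

lemma iterMul_powMap {f : A →ₗ[R] A} (hf : ∀ a b, f (H.mul (a ⊗ₜ b)) = H.mul (f a ⊗ₜ f b))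
    (hα : ∀ a, f (H.α a) = H.α (f a)) {n : ℕ} (x : ⨂[R]^n A) :
    H.iterMul n (powMap n f x) = f (H.iterMul n x) := by
  cases n with
  | zero => simp [iterMul]
  | succ n =>
    induction n with
    | zero =>
      induction x using consInduction with
      | add x y hx hy => simp only [map_add, hx, hy]
      | cons a x =>
        rw [powMap_cons, powMap_zero]
        induction x using zeroInduction with
        | smul r => rw [iterMul_one_cons, iterMul_one_cons, map_smul]
    | succ n ih => rw [iterMul_succ_succ, H.mulAt_powMap hf hα, ih, iterMul_succ_succ]

end HomAssocAlgebra

/-! ### Splitting factors -/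

namespace HomCoassocCoalgebra

variable {R A : Type*} [CommRing R] [AddCommGroup A] [Module R A] (H : HomCoassocCoalgebra R A)

lemma hom_coassoc_apply (a : A) :
    TensorProduct.assoc R A A A (TensorProduct.map H.comul H.β (H.comul a)) =
      TensorProduct.map H.β H.comul (H.comul a) :=
  LinearMap.congr_fun H.hom_coassoc a

lemma comul_beta (a : A) : H.comul (H.β a) = TensorProduct.map H.β H.β (H.comul a) :=
  LinearMap.congr_fun H.comultiplicative a

lemma comul_beta_pow (e : ℕ) (a : A) :
    H.comul ((H.β ^ e) a) = TensorProduct.map (H.β ^ e) (H.β ^ e) (H.comul a) := by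
  induction e with
  | zero => simp [Module.End.one_eq_id]
  | succ e ih =>
    rw [pow_succ', Module.End.mul_apply, comul_beta, ih, TensorProduct.map_map]
    rfl

@[simp]
lemma comulAt_zero_cons {n : ℕ} (a : A) (x : ⨂[R]^n A) :
    H.comulAt (n + 1) 0 (consEquiv R A n (a ⊗ₜ x)) =
      consTwoEquiv R A n (H.comul a ⊗ₜ powMap n H.β x) := by
  simp [comulAt]

@[simp]
lemma comulAt_succ_cons {n : ℕ} (j : Fin n) (a : A) (x : ⨂[R]^n A) :
    H.comulAt (n + 1) j.succ (consEquiv R A n (a ⊗ₜ x)) =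
      consEquiv R A (n + 1) (H.β a ⊗ₜ H.comulAt n j x) := by
  simp [comulAt]

@[simp]
lemma comulAt_castSucc_snoc {n : ℕ} (j : Fin n) (a : A) (x : ⨂[R]^n A) :
    H.comulAt (n + 1) j.castSucc (snocEquiv R A n (x ⊗ₜ a)) =
      snocEquiv R A (n + 1) (H.comulAt n j x ⊗ₜ H.β a) := by
  induction n with
  | zero => exact j.elim0
  | succ n ih =>
    induction x using consInduction with
    | add x y hx hy => simp only [TensorProduct.add_tmul, map_add, hx, hy]
    | cons b x =>
      cases j using Fin.cases with
      | zero =>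
        rw [snocEquiv_consEquiv, Fin.castSucc_zero, comulAt_zero_cons, comulAt_zero_cons,
          powMap_snoc, snocEquiv_consTwoEquiv]
      | succ j =>
        rw [← Fin.succ_castSucc, snocEquiv_consEquiv, comulAt_succ_cons, ih,
          comulAt_succ_cons, snocEquiv_consEquiv]

lemma snocTwoEquiv_zero (t : A ⊗[R] A) (x : ⨂[R]^0 A) :
    snocTwoEquiv R A 0 (x ⊗ₜ t) = consTwoEquiv R A 0 (t ⊗ₜ x) := by
  induction t with
  | zero => simp
  | tmul a b => simp [snocEquiv_zero, snocEquiv_consEquiv]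
  | add t s ht hs => simp only [TensorProduct.tmul_add, TensorProduct.add_tmul, map_add, ht, hs]

@[simp]
lemma comulAt_last_snoc {n : ℕ} (a : A) (x : ⨂[R]^n A) :
    H.comulAt (n + 1) (Fin.last n) (snocEquiv R A n (x ⊗ₜ a)) =
      snocTwoEquiv R A n (powMap n H.β x ⊗ₜ H.comul a) := by
  induction n with
  | zero =>
    rw [snocEquiv_zero, snocTwoEquiv_zero]
    exact H.comulAt_zero_cons a x
  | succ n ih =>
    induction x using consInduction with
    | add x y hx hy => simp only [TensorProduct.add_tmul, map_add, hx, hy]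
    | cons c x =>
      rw [← Fin.succ_last, snocEquiv_consEquiv, comulAt_succ_cons, ih, powMap_cons,
        snocTwoEquiv_consEquiv]

lemma comulAt_powMap {f : A →ₗ[R] A}
    (hf : ∀ a, H.comul (f a) = TensorProduct.map f f (H.comul a))
    (hβ : ∀ a, f (H.β a) = H.β (f a)) {n : ℕ} (i : Fin n) (x : ⨂[R]^n A) :
    H.comulAt n i (powMap n f x) = powMap (n + 1) f (H.comulAt n i x) := by
  induction n with
  | zero => exact i.elim0
  | succ n ih =>
    induction x using consInduction with
    | add x y hx hy => simp only [map_add, hx, hy]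
    | cons a x =>
      cases i using Fin.cases with
      | zero =>
        rw [powMap_cons, comulAt_zero_cons, comulAt_zero_cons, powMap_consTwo, hf,
          powMap_comm hβ]
      | succ i => simp [ih, hβ]

lemma comulAt_zero_consTwo {n : ℕ} (t : A ⊗[R] A) (x : ⨂[R]^n A) :
    H.comulAt (n + 2) 0 (consTwoEquiv R A n (t ⊗ₜ x)) =
      (consTwoEquiv R A (n + 1)).toLinearMap (TensorProduct.map LinearMap.id
        (consEquiv R A n).toLinearMap (TensorProduct.assoc R (A ⊗[R] A) A _
          (TensorProduct.map H.comul H.β t ⊗ₜ powMap n H.β x))) := by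
  induction t with
  | zero => simp
  | tmul a b => simp
  | add t s ht hs => simp only [TensorProduct.add_tmul, map_add, ht, hs]

lemma comulAt_one_consTwo {n : ℕ} (t : A ⊗[R] A) (x : ⨂[R]^n A) :
    H.comulAt (n + 2) (Fin.succ 0) (consTwoEquiv R A n (t ⊗ₜ x)) =
      (consEquiv R A (n + 2)).toLinearMap (TensorProduct.map LinearMap.id
        (consTwoEquiv R A n).toLinearMap (TensorProduct.assoc R A (A ⊗[R] A) _
          (TensorProduct.map H.β H.comul t ⊗ₜ powMap n H.β x))) := by
  induction t with
  | zero => simp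
  | tmul a b =>
    rw [consTwoEquiv_tmul, comulAt_succ_cons, comulAt_zero_cons]
    simp
  | add t s ht hs => simp only [TensorProduct.add_tmul, map_add, ht, hs]

lemma comulAt_succ_succ_consTwo {n : ℕ} (j : Fin n) (t : A ⊗[R] A) (x : ⨂[R]^n A) :
    H.comulAt (n + 2) j.succ.succ (consTwoEquiv R A n (t ⊗ₜ x)) =
      consTwoEquiv R A (n + 1) (TensorProduct.map H.β H.β t ⊗ₜ H.comulAt n j x) := by
  induction t with
  | zero => simp
  | tmul a b => simp
  | add t s ht hs => simp only [TensorProduct.add_tmul, map_add, ht, hs]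

/-- Hom-coassociativity in front of a tensor `x`. -/
lemma consTwo_cons_comul {n : ℕ} (a : A) (x : ⨂[R]^n A) :
    (consTwoEquiv R A (n + 1)).toLinearMap (TensorProduct.map LinearMap.id
        (consEquiv R A n).toLinearMap (TensorProduct.assoc R (A ⊗[R] A) A _
          (TensorProduct.map H.comul H.β (H.comul a) ⊗ₜ x))) =
    (consEquiv R A (n + 2)).toLinearMap (TensorProduct.map LinearMap.id
        (consTwoEquiv R A n).toLinearMap (TensorProduct.assoc R A (A ⊗[R] A) _
          (TensorProduct.map H.β H.comul (H.comul a) ⊗ₜ x))) := by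
  rw [← hom_coassoc_apply]
  generalize TensorProduct.map H.comul H.β (H.comul a) = w
  induction w with
  | zero => simp
  | add t s ht hs => simp only [TensorProduct.add_tmul, map_add, ht, hs]
  | tmul t c =>
    induction t with
    | zero => simp
    | add t s ht hs => simp only [TensorProduct.add_tmul, map_add, ht, hs]
    | tmul a b => simp

/-- The two ways of splitting a factor produced by a coproduct agree. -/
lemma comulAt_zero_consTwo_comul {n : ℕ} (a : A) (x : ⨂[R]^n A) :
    H.comulAt (n + 2) 0 (consTwoEquiv R A n (H.comul a ⊗ₜ x)) =
      H.comulAt (n + 2) (Fin.succ 0) (consTwoEquiv R A n (H.comul a ⊗ₜ x)) := by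
  rw [comulAt_zero_consTwo, comulAt_one_consTwo, consTwo_cons_comul]

/-- The maps splitting one factor satisfy the dual presimplicial identities. For equal indices
this is Hom-coassociativity. -/
lemma comulAt_comulAt {n : ℕ} {i j : Fin n} (hij : i ≤ j) (x : ⨂[R]^n A) :
    H.comulAt (n + 1) i.castSucc (H.comulAt n j x) = H.comulAt (n + 1) j.succ (H.comulAt n i x) := by
  induction n with
  | zero => exact i.elim0
  | succ n ih =>
    induction x using consInduction with
    | add x y hx hy => simp only [map_add, hx, hy]
    | cons a x =>
      cases i using Fin.cases with
      | zero =>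
        cases j using Fin.cases with
        | zero => rw [Fin.castSucc_zero, comulAt_zero_cons, comulAt_zero_consTwo_comul]
        | succ j =>
          rw [Fin.castSucc_zero, comulAt_succ_cons, comulAt_zero_cons, comulAt_zero_cons,
            comulAt_succ_succ_consTwo, comul_beta, H.comulAt_powMap H.comul_beta (fun _ => rfl)]
      | succ i =>
        cases j using Fin.cases with
        | zero => exact absurd hij (by simp)
        | succ j =>
          rw [← Fin.succ_castSucc, comulAt_succ_cons, comulAt_succ_cons, comulAt_succ_cons,
            comulAt_succ_cons, ih (Fin.succ_le_succ_iff.mp hij)]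

lemma iterComul_succ_succ (n : ℕ) (a : A) :
    H.iterComul (n + 2) a = H.comulAt (n + 1) 0 (H.iterComul (n + 1) a) := rfl

/-- Splitting any factor of an iterated coproduct gives the next one. -/
lemma comulAt_iterComul {n : ℕ} (i : Fin (n + 1)) (a : A) :
    H.comulAt (n + 1) i (H.iterComul (n + 1) a) = H.iterComul (n + 2) a := by
  induction n with
  | zero => obtain rfl : i = 0 := Fin.fin_one_eq_zero i; rfl
  | succ n ih =>
    cases i using Fin.cases with
    | zero => rfl
    | succ i =>
      rw [iterComul_succ_succ, ← H.comulAt_comulAt (Fin.zero_le i), ih]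
      rfl

lemma iterComul_one (a : A) :
    H.iterComul 1 a = consEquiv R A 0
      (a ⊗ₜ PiTensorProduct.tprod R (fun _ : Fin 0 => (0 : A))) := by
  rw [consEquiv_tprod]
  simp only [iterComul, LinearEquiv.coe_coe]
  rw [PiTensorProduct.subsingletonEquiv_symm_apply']
  congr 1
  ext i
  fin_cases i
  rfl

/-- The first factor of an iterated coproduct. -/
lemma iterComul_eq_cons {n : ℕ} (a : A) :
    H.iterComul (n + 2) a = (consEquiv R A (n + 1)).toLinearMap
      (TensorProduct.map (H.β ^ n) (H.iterComul (n + 1)) (H.comul a)) := by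
  induction n generalizing a with
  | zero =>
    rw [iterComul_succ_succ, iterComul_one, comulAt_zero_cons, powMap_zero]
    generalize H.comul a = t
    induction t with
    | zero => simp
    | add t s ht hs => simp only [TensorProduct.add_tmul, map_add, ht, hs]
    | tmul a b => simp [iterComul_one]
  | succ n ih =>
    rw [← H.comulAt_iterComul (Fin.succ 0), ih]
    generalize H.comul a = t
    induction t with
    | zero => simp
    | add t s ht hs => simp only [map_add, ht, hs]
    | tmul a b =>
      simp only [TensorProduct.map_tmul, LinearEquiv.coe_coe, comulAt_succ_cons, pow_succ',
        Module.End.mul_apply, iterComul_succ_succ]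

/-- The last factor of an iterated coproduct. -/
lemma iterComul_eq_snoc {n : ℕ} (a : A) :
    H.iterComul (n + 2) a = (snocEquiv R A (n + 1)).toLinearMap
      (TensorProduct.map (H.iterComul (n + 1)) (H.β ^ n) (H.comul a)) := by
  induction n generalizing a with
  | zero =>
    rw [iterComul_succ_succ, iterComul_one, comulAt_zero_cons, powMap_zero]
    generalize H.comul a = t
    induction t with
    | zero => simp
    | add t s ht hs => simp only [TensorProduct.add_tmul, map_add, ht, hs]
    | tmul a b => simp [iterComul_one, snocEquiv_consEquiv, snocEquiv_zero]
  | succ n ih =>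
    rw [← H.comulAt_iterComul (Fin.castSucc 0), ih]
    generalize H.comul a = t
    induction t with
    | zero => simp
    | add t s ht hs => simp only [map_add, ht, hs]
    | tmul a b =>
      simp only [TensorProduct.map_tmul, LinearEquiv.coe_coe, comulAt_castSucc_snoc, pow_succ',
        Module.End.mul_apply, iterComul_succ_succ]

lemma powMap_iterComul {f : A →ₗ[R] A}
    (hf : ∀ a, H.comul (f a) = TensorProduct.map f f (H.comul a))
    (hβ : ∀ a, f (H.β a) = H.β (f a)) {n : ℕ} (a : A) :
    powMap n f (H.iterComul n a) = H.iterComul n (f a) := by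
  cases n with
  | zero => simp [iterComul]
  | succ n =>
    induction n with
    | zero => rw [iterComul_one, iterComul_one, powMap_cons, powMap_zero]
    | succ n ih => rw [iterComul_succ_succ, ← H.comulAt_powMap hf hβ, ih, iterComul_succ_succ]

end HomCoassocCoalgebra

/-! ### Tensor powers as Hom-coalgebras -/

section ComulPow

variable {R A : Type*} [CommRing R] [AddCommGroup A] [Module R A]

lemma comulPow_zero (d : A →ₗ[R] A ⊗[R] A) :
    comulPow 0 d (PiTensorProduct.tprod R (fun _ : Fin 0 => (0 : A))) =
      PiTensorProduct.tprod R (fun _ : Fin 0 => (0 : A)) ⊗ₜ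
        PiTensorProduct.tprod R (fun _ : Fin 0 => (0 : A)) := by
  simp [comulPow, unzip]

lemma comulPow_powMap {f : A →ₗ[R] A} {d : A →ₗ[R] A ⊗[R] A}
    (hf : ∀ a, d (f a) = TensorProduct.map f f (d a)) {n : ℕ} (x : ⨂[R]^n A) :
    comulPow n d (powMap n f x) =
      TensorProduct.map (powMap n f) (powMap n f) (comulPow n d x) := by
  induction n with
  | zero =>
    induction x using zeroInduction with
    | smul r => simp only [powMap_zero, comulPow_zero, map_smul, TensorProduct.map_tmul]
  | succ n ih =>
    induction x using consInduction with
    | add x y hx hy => simp only [map_add, hx, hy]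
    | cons a x =>
      rw [powMap_cons, comulPow_cons, comulPow_cons, ih, hf]
      generalize d a = t
      generalize comulPow n d x = w
      induction t with
      | zero => simp
      | add t s ht hs => simp only [TensorProduct.add_tmul, map_add, ht, hs]
      | tmul a b =>
        induction w with
        | zero => simp
        | add t s ht hs => simp only [TensorProduct.tmul_add, map_add, ht, hs]
        | tmul x y => simp

end ComulPow

namespace HomCoassocCoalgebra

variable {R A : Type*} [CommRing R] [AddCommGroup A] [Module R A] (H : HomCoassocCoalgebra R A)

/-- Tensor powers are Hom-coassociative. -/
lemma comulPow_coassoc {n : ℕ} (x : ⨂[R]^n A) :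
    TensorProduct.assoc R _ _ _
        (TensorProduct.map (comulPow n H.comul) (powMap n H.β) (comulPow n H.comul x)) =
      TensorProduct.map (powMap n H.β) (comulPow n H.comul) (comulPow n H.comul x) := by
  induction n with
  | zero =>
    induction x using zeroInduction with
    | smul r =>
      simp only [powMap_zero, comulPow_zero, map_smul, TensorProduct.map_tmul,
        TensorProduct.assoc_tmul]
  | succ n ih =>
    induction x using consInduction with
    | add x y hx hy => simp only [map_add, hx, hy]
    | cons a x =>
      -- Both sides interleave the corresponding side for `a` with the one for `x`.
      have hl (t : A ⊗[R] A) (w : (⨂[R]^n A) ⊗[R] (⨂[R]^n A)) :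
          TensorProduct.assoc R _ _ _ (TensorProduct.map (comulPow (n + 1) H.comul)
            (powMap (n + 1) H.β) (TensorProduct.map (consEquiv R A n).toLinearMap
              (consEquiv R A n).toLinearMap (TensorProduct.tensorTensorTensorComm R _ _ _ _
                (t ⊗ₜ w)))) =
          TensorProduct.map (consEquiv R A n).toLinearMap (TensorProduct.map
            (consEquiv R A n).toLinearMap (consEquiv R A n).toLinearMap ∘ₗ
              (TensorProduct.tensorTensorTensorComm R _ _ _ _).toLinearMap)
            (TensorProduct.tensorTensorTensorComm R _ _ _ _
              (TensorProduct.assoc R _ _ _ (TensorProduct.map H.comul H.β t) ⊗ₜ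
                TensorProduct.assoc R _ _ _
                  (TensorProduct.map (comulPow n H.comul) (powMap n H.β) w))) := by
        induction t with
        | zero => simp
        | add t s ht hs => simp only [TensorProduct.add_tmul, map_add, ht, hs]
        | tmul b c =>
          induction w with
          | zero => simp
          | add t s ht hs => simp only [TensorProduct.tmul_add, map_add, ht, hs]
          | tmul y z =>
            simp only [TensorProduct.tensorTensorTensorComm_tmul, TensorProduct.map_tmul,
              LinearEquiv.coe_coe, comulPow_cons, powMap_cons]
            generalize H.comul b = t
            generalize comulPow n H.comul y = w
            induction t with
            | zero => simp
            | add t s ht hs => simp only [TensorProduct.add_tmul, map_add, ht, hs]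
            | tmul b b' =>
              induction w with
              | zero => simp
              | add t s ht hs =>
                simp only [TensorProduct.tmul_add, TensorProduct.add_tmul, map_add, ht, hs]
              | tmul y y' => simp
      have hr (t : A ⊗[R] A) (w : (⨂[R]^n A) ⊗[R] (⨂[R]^n A)) :
          TensorProduct.map (powMap (n + 1) H.β) (comulPow (n + 1) H.comul)
            (TensorProduct.map (consEquiv R A n).toLinearMap
              (consEquiv R A n).toLinearMap (TensorProduct.tensorTensorTensorComm R _ _ _ _
                (t ⊗ₜ w))) =
          TensorProduct.map (consEquiv R A n).toLinearMap (TensorProduct.map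
            (consEquiv R A n).toLinearMap (consEquiv R A n).toLinearMap ∘ₗ
              (TensorProduct.tensorTensorTensorComm R _ _ _ _).toLinearMap)
            (TensorProduct.tensorTensorTensorComm R _ _ _ _
              (TensorProduct.map H.β H.comul t ⊗ₜ
                  TensorProduct.map (powMap n H.β) (comulPow n H.comul) w)) := by
        induction t with
        | zero => simp
        | add t s ht hs => simp only [TensorProduct.add_tmul, map_add, ht, hs]
        | tmul b c =>
          induction w with
          | zero => simp
          | add t s ht hs => simp only [TensorProduct.tmul_add, map_add, ht, hs]
          | tmul y z =>
            simp only [TensorProduct.tensorTensorTensorComm_tmul, TensorProduct.map_tmul,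
              LinearEquiv.coe_coe, comulPow_cons, powMap_cons, LinearMap.comp_apply]
      rw [comulPow_cons, hl, hr, ih, hom_coassoc_apply]

end HomCoassocCoalgebra

namespace HomBialgebra

variable {R A : Type*} [CommRing R] [AddCommGroup A] [Module R A] (B : HomBialgebra R A)

lemma comul_mul_apply (a b : A) :
    B.comul (B.mul (a ⊗ₜ b)) = TensorProduct.map B.mul B.mul
      (TensorProduct.tensorTensorTensorComm R A A A A (B.comul a ⊗ₜ B.comul b)) :=
  LinearMap.congr_fun B.comul_mul (a ⊗ₜ b)

lemma comul_alpha_apply (a : A) : B.comul (B.α a) = TensorProduct.map B.α B.α (B.comul a) :=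
  LinearMap.congr_fun B.comul_alpha a

lemma comul_alpha_pow (e : ℕ) (a : A) :
    B.comul ((B.α ^ e) a) = TensorProduct.map (B.α ^ e) (B.α ^ e) (B.comul a) := by
  induction e with
  | zero => simp [Module.End.one_eq_id]
  | succ e ih =>
    rw [pow_succ', Module.End.mul_apply, comul_alpha_apply, ih, TensorProduct.map_map]
    rfl

lemma beta_mul_apply (a b : A) : B.β (B.mul (a ⊗ₜ b)) = B.mul (B.β a ⊗ₜ B.β b) :=
  LinearMap.congr_fun B.beta_mul (a ⊗ₜ b)

lemma beta_pow_mul (e : ℕ) (a b : A) :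
    (B.β ^ e) (B.mul (a ⊗ₜ b)) = B.mul ((B.β ^ e) a ⊗ₜ (B.β ^ e) b) := by
  induction e with
  | zero => rfl
  | succ e ih => simp only [pow_succ', Module.End.mul_apply, ih, beta_mul_apply]

lemma alpha_beta (a : A) : B.α (B.β a) = B.β (B.α a) := LinearMap.congr_fun B.comm a

lemma alpha_pow_beta (e : ℕ) (a : A) : (B.α ^ e) (B.β a) = B.β ((B.α ^ e) a) := by
  induction e with
  | zero => rfl
  | succ e ih => simp only [pow_succ', Module.End.mul_apply, ih, alpha_beta]

lemma beta_pow_alpha (e : ℕ) (a : A) : (B.β ^ e) (B.α a) = B.α ((B.β ^ e) a) := by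
  induction e with
  | zero => rfl
  | succ e ih => simp only [pow_succ', Module.End.mul_apply, ih, alpha_beta]

/-- Merging two adjacent factors is a morphism for the comultiplications of the tensor powers. -/
lemma comulPow_mulAt {n : ℕ} (i : Fin n) (x : ⨂[R]^(n + 1) A) :
    comulPow n B.comul (B.mulAt n i x) =
      TensorProduct.map (B.mulAt n i) (B.mulAt n i) (comulPow (n + 1) B.comul x) := by
  induction n with
  | zero => exact i.elim0
  | succ n ih =>
    induction x using consInduction with
    | add x y hx hy => simp only [map_add, hx, hy]
    | cons a x =>
      cases i using Fin.cases with
      | zero =>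
        induction x using consInduction with
        | add x y hx hy => simp only [TensorProduct.tmul_add, map_add, hx, hy]
        | cons b x =>
          rw [HomAssocAlgebra.mulAt_zero_cons, comulPow_cons, comulPow_cons, comulPow_cons,
            comul_mul_apply, comulPow_powMap B.comul_alpha_apply]
          generalize B.comul a = s
          generalize B.comul b = t
          generalize comulPow n B.comul x = w
          induction s with
          | zero => simp
          | add t s ht hs => simp only [TensorProduct.add_tmul, map_add, ht, hs]
          | tmul a a' =>
            induction t with
            | zero => simp
            | add t s ht hs =>
              simp only [TensorProduct.add_tmul, TensorProduct.tmul_add, map_add, ht, hs]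
            | tmul b b' =>
              induction w with
              | zero => simp
              | add t s ht hs => simp only [TensorProduct.tmul_add, map_add, ht, hs]
              | tmul y z => simp
      | succ i =>
        rw [HomAssocAlgebra.mulAt_succ_cons, comulPow_cons, comulPow_cons, ih,
          comul_alpha_apply]
        generalize B.comul a = s
        generalize comulPow (n + 1) B.comul x = w
        induction s with
        | zero => simp
        | add t s ht hs => simp only [TensorProduct.add_tmul, map_add, ht, hs]
        | tmul a a' =>
          induction w with
          | zero => simp
          | add t s ht hs => simp only [TensorProduct.tmul_add, map_add, ht, hs]
          | tmul y z => simp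

/-- The iterated product is a morphism of Hom-coalgebras. -/
lemma comul_iterMul {n : ℕ} (x : ⨂[R]^(n + 1) A) :
    B.comul (B.iterMul (n + 1) x) =
      TensorProduct.map (B.iterMul (n + 1)) (B.iterMul (n + 1)) (comulPow (n + 1) B.comul x) := by
  induction n with
  | zero =>
    induction x using consInduction with
    | add x y hx hy => simp only [map_add, hx, hy]
    | cons a x =>
      induction x using zeroInduction with
      | smul r =>
        have h1 (b : A) := B.iterMul_one_cons b 1
        simp only [one_smul] at h1
        rw [HomAssocAlgebra.iterMul_one_cons, comulPow_cons,
          map_smul (comulPow 0 B.comul), comulPow_zero, TensorProduct.tmul_smul]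
        simp only [map_smul]
        congr 1
        generalize B.comul a = t
        induction t with
        | zero => simp
        | add t s ht hs => simp only [TensorProduct.add_tmul, map_add, ← ht, ← hs]
        | tmul b c =>
          simp only [TensorProduct.tensorTensorTensorComm_tmul, TensorProduct.map_tmul,
            LinearEquiv.coe_coe, h1]
  | succ n ih =>
    rw [HomAssocAlgebra.iterMul_succ_succ, ih, comulPow_mulAt, TensorProduct.map_map]
    rfl

/-! ### Tensor powers as Hom-algebras -/

lemma mulPow_cons {n : ℕ} (a b : A) (x y : ⨂[R]^n A) :
    B.mulPow (n + 1) (consEquiv R A n (a ⊗ₜ x)) (consEquiv R A n (b ⊗ₜ y)) =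
      consEquiv R A n (B.mul (a ⊗ₜ b) ⊗ₜ B.mulPow n x y) := by
  refine apply_eq_of_tprod
    (f := (B.mulPow (n + 1)).flip (consEquiv R A n (b ⊗ₜ y)) ∘ₗ (consEquiv R A n).toLinearMap ∘ₗ
      TensorProduct.mk R _ _ a)
    (g := (consEquiv R A n).toLinearMap ∘ₗ TensorProduct.mk R _ _ (B.mul (a ⊗ₜ b)) ∘ₗ
      (B.mulPow n).flip y) (fun x => ?_) x
  refine apply_eq_of_tprod
    (f := B.mulPow (n + 1) (consEquiv R A n (a ⊗ₜ PiTensorProduct.tprod R x)) ∘ₗ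
      (consEquiv R A n).toLinearMap ∘ₗ TensorProduct.mk R _ _ b)
    (g := (consEquiv R A n).toLinearMap ∘ₗ TensorProduct.mk R _ _ (B.mul (a ⊗ₜ b)) ∘ₗ
      B.mulPow n (PiTensorProduct.tprod R x)) (fun y => ?_) y
  simp only [mulPow, LinearMap.coe_comp, LinearEquiv.coe_coe, Function.comp_apply,
    TensorProduct.mk_apply, consEquiv_tprod, PiTensorProduct.map₂_tprod_tprod]
  congr 1
  ext i
  refine Fin.cases ?_ (fun j => ?_) i <;> simp

lemma mulPow_snoc {n : ℕ} (a b : A) (x y : ⨂[R]^n A) :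
    B.mulPow (n + 1) (snocEquiv R A n (x ⊗ₜ a)) (snocEquiv R A n (y ⊗ₜ b)) =
      snocEquiv R A n (B.mulPow n x y ⊗ₜ B.mul (a ⊗ₜ b)) := by
  induction n with
  | zero => simp only [snocEquiv_zero, mulPow_cons]
  | succ n ih =>
    induction x using consInduction with
    | add x y hx hy => simp only [TensorProduct.add_tmul, map_add, LinearMap.add_apply, hx, hy]
    | cons c x =>
      induction y using consInduction with
      | add x y hx hy => simp only [TensorProduct.add_tmul, map_add, hx, hy]
      | cons d y => simp only [snocEquiv_consEquiv, mulPow_cons, ih]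

lemma mulPow_consTwo {n : ℕ} (s t : A ⊗[R] A) (x y : ⨂[R]^n A) :
    B.mulPow (n + 2) (consTwoEquiv R A n (s ⊗ₜ x)) (consTwoEquiv R A n (t ⊗ₜ y)) =
      consTwoEquiv R A n (TensorProduct.map B.mul B.mul
        (TensorProduct.tensorTensorTensorComm R A A A A (s ⊗ₜ t)) ⊗ₜ B.mulPow n x y) := by
  induction s with
  | zero => simp
  | add t s ht hs => simp only [TensorProduct.add_tmul, map_add, LinearMap.add_apply, ht, hs]
  | tmul a b =>
    induction t with
    | zero => simp
    | add t s ht hs => simp only [TensorProduct.add_tmul, TensorProduct.tmul_add, map_add, ht, hs]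
    | tmul c d => simp [mulPow_cons]

lemma mulPow_snocTwo {n : ℕ} (s t : A ⊗[R] A) (x y : ⨂[R]^n A) :
    B.mulPow (n + 2) (snocTwoEquiv R A n (x ⊗ₜ s)) (snocTwoEquiv R A n (y ⊗ₜ t)) =
      snocTwoEquiv R A n (B.mulPow n x y ⊗ₜ TensorProduct.map B.mul B.mul
        (TensorProduct.tensorTensorTensorComm R A A A A (s ⊗ₜ t))) := by
  induction s with
  | zero => simp
  | add t s ht hs =>
    simp only [TensorProduct.add_tmul, TensorProduct.tmul_add, map_add, LinearMap.add_apply, ht, hs]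
  | tmul a b =>
    induction t with
    | zero => simp
    | add t s ht hs => simp only [TensorProduct.tmul_add, map_add, ht, hs]
    | tmul c d => simp [mulPow_snoc]

lemma mulPow_zero (r s : R) :
    B.mulPow 0 (r • PiTensorProduct.tprod R (fun _ : Fin 0 => (0 : A)))
      (s • PiTensorProduct.tprod R (fun _ : Fin 0 => (0 : A))) =
    (s * r) • PiTensorProduct.tprod R (fun _ : Fin 0 => (0 : A)) := by
  simp only [map_smul, LinearMap.smul_apply, mulPow, PiTensorProduct.map₂_tprod_tprod, smul_smul]
  congr 2
  exact Subsingleton.elim _ _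

lemma powMap_mulPow {f : A →ₗ[R] A} (hf : ∀ a b, f (B.mul (a ⊗ₜ b)) = B.mul (f a ⊗ₜ f b)) {n : ℕ}
    (x y : ⨂[R]^n A) :
    powMap n f (B.mulPow n x y) = B.mulPow n (powMap n f x) (powMap n f y) := by
  induction n with
  | zero => simp only [powMap_zero]
  | succ n ih =>
    induction x using consInduction with
    | add x y hx hy => simp only [map_add, LinearMap.add_apply, hx, hy]
    | cons c x =>
      induction y using consInduction with
      | add x y hx hy => simp only [map_add, hx, hy]
      | cons d y => simp only [powMap_cons, mulPow_cons, hf, ih]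

/-- Tensor powers are Hom-associative. -/
lemma mulPow_assoc {n : ℕ} (x y z : ⨂[R]^n A) :
    B.mulPow n (B.mulPow n x y) (powMap n B.α z) =
      B.mulPow n (powMap n B.α x) (B.mulPow n y z) := by
  induction n with
  | zero =>
    induction x using zeroInduction with
    | smul r =>
      induction y using zeroInduction with
      | smul s =>
        induction z using zeroInduction with
        | smul t => simp only [powMap_zero, mulPow_zero, mul_assoc]
  | succ n ih =>
    induction x using consInduction with
    | add x y hx hy => simp only [map_add, LinearMap.add_apply, hx, hy]
    | cons a x =>
      induction y using consInduction with
      | add x y hx hy => simp only [map_add, LinearMap.add_apply, hx, hy]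
      | cons b y =>
        induction z using consInduction with
        | add x y hx hy => simp only [map_add, hx, hy]
        | cons c z => simp only [powMap_cons, mulPow_cons, ih, HomAssocAlgebra.hom_assoc_apply]

/-- Splitting one factor is a morphism for the multiplications of the tensor powers. -/
lemma comulAt_mulPow {n : ℕ} (i : Fin n) (x y : ⨂[R]^n A) :
    B.comulAt n i (B.mulPow n x y) = B.mulPow (n + 1) (B.comulAt n i x) (B.comulAt n i y) := by
  induction n with
  | zero => exact i.elim0
  | succ n ih =>
    induction x using consInduction with
    | add x y hx hy => simp only [map_add, LinearMap.add_apply, hx, hy]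
    | cons a x =>
      induction y using consInduction with
      | add x y hx hy => simp only [map_add, hx, hy]
      | cons b y =>
        cases i using Fin.cases with
        | zero =>
          rw [mulPow_cons, HomCoassocCoalgebra.comulAt_zero_cons,
            HomCoassocCoalgebra.comulAt_zero_cons, HomCoassocCoalgebra.comulAt_zero_cons,
            mulPow_consTwo, comul_mul_apply, B.powMap_mulPow B.beta_mul_apply]
        | succ i =>
          rw [mulPow_cons, HomCoassocCoalgebra.comulAt_succ_cons,
            HomCoassocCoalgebra.comulAt_succ_cons, HomCoassocCoalgebra.comulAt_succ_cons,
            mulPow_cons, ih, beta_mul_apply]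

/-- The iterated coproduct is a morphism of Hom-algebras. -/
lemma iterComul_mul {n : ℕ} (a b : A) :
    B.iterComul (n + 1) (B.mul (a ⊗ₜ b)) =
      B.mulPow (n + 1) (B.iterComul (n + 1) a) (B.iterComul (n + 1) b) := by
  induction n with
  | zero =>
    have h := B.mulPow_zero 1 1
    simp only [one_smul, mul_one] at h
    rw [zero_add, HomCoassocCoalgebra.iterComul_one, HomCoassocCoalgebra.iterComul_one,
      HomCoassocCoalgebra.iterComul_one]
    exact ((B.mulPow_cons a b _ _).trans (by rw [h])).symm
  | succ n ih =>
    rw [HomCoassocCoalgebra.iterComul_succ_succ, ih, comulAt_mulPow]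
    rfl

end HomBialgebra

/-! ### Alternating sums of cofaces -/

section AlternatingSums

variable {R X Y Z : Type*} [CommRing R] [AddCommGroup X] [Module R X] [AddCommGroup Y] [Module R Y]
  [AddCommGroup Z] [Module R Z]

/-- The terms of the double alternating sum of inner cofaces cancel in pairs. -/
lemma sum_sum_inner_cofaces {n : ℕ} {D : Fin n → X →ₗ[R] Y} {D' : Fin (n + 1) → Y →ₗ[R] Z} {x : X}
    (hD : ∀ i j, i ≤ j → D' (Fin.castSucc i) (D j x) = D' (Fin.succ j) (D i x)) :
    ∑ i : Fin (n + 1), (-1 : R) ^ ((i : ℕ) + 1) •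
      D' i (∑ j : Fin n, (-1 : R) ^ ((j : ℕ) + 1) • D j x) = 0 := by
  simp only [map_sum, map_smul, Finset.smul_sum, smul_smul]
  rw [← Fintype.sum_prod_type']
  refine Finset.sum_involution
    (fun p _ => if h : (p.1 : ℕ) ≤ p.2 then (p.2.succ, p.1.castLT (h.trans_lt p.2.2))
      else (p.2.castSucc, p.1.pred (fun h0 => h (by simp [h0])))) ?_ ?_ ?_ ?_
  · rintro ⟨i, j⟩ -
    by_cases h : (i : ℕ) ≤ j
    · have := hD (i.castLT (h.trans_lt j.2)) j h
      rw [Fin.castSucc_castLT] at this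
      simp only [h, dif_pos, this, Fin.val_succ, Fin.val_castLT, ← add_smul]
      rw [pow_succ (-1 : R) (j + 1)]
      ring_nf
      simp
    · have hi : i ≠ 0 := fun h0 => h (by simp [h0])
      have hv : ((i.pred hi : Fin n) : ℕ) + 1 = i := by
        have := Fin.val_pred i hi
        have : (i : ℕ) ≠ 0 := fun h0 => hi (Fin.ext h0)
        omega
      have := hD j (i.pred hi) (by rw [Fin.le_def]; omega)
      rw [Fin.succ_pred] at this
      simp only [h, dif_neg, not_false_eq_true, this, Fin.val_castSucc, hv, ← add_smul]
      rw [pow_succ (-1 : R) (i : ℕ)]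
      ring_nf
      simp
  · rintro ⟨i, j⟩ - - h
    by_cases h' : (i : ℕ) ≤ j
    · rw [dif_pos h'] at h
      have := congrArg (fun p => (p.1 : ℕ)) h
      simp only [Fin.val_succ] at this
      omega
    · rw [dif_neg h'] at h
      have := congrArg (fun p => (p.1 : ℕ)) h
      simp only [Fin.val_castSucc] at this
      omega
  · simp
  · rintro ⟨i, j⟩ -
    by_cases h : (i : ℕ) ≤ j
    · have h2 : ¬ ((j : ℕ) + 1 ≤ i) := by omega
      simp [h, h2]
    · have h2 : (j : ℕ) ≤ i - 1 := by omega
      simp [h, h2]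

/-- The square of an alternating sum of cofaces, all cosimplicial identities holding except for
those relating the two first and the two last cofaces. -/
lemma alternating_cofaces_sq {n : ℕ} {l r : X →ₗ[R] Y} {D : Fin n → X →ₗ[R] Y}
    {l' r' : Y →ₗ[R] Z} {D' : Fin (n + 1) → Y →ₗ[R] Z} {x : X}
    (hlr : r' (l x) = l' (r x)) (hl : ∀ i, D' (Fin.succ i) (l x) = l' (D i x))
    (hr : ∀ i, D' (Fin.castSucc i) (r x) = r' (D i x))
    (hD : ∀ i j, i ≤ j → D' (Fin.castSucc i) (D j x) = D' (Fin.succ j) (D i x))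
    {y : Y} (hy : y = l x + ∑ i : Fin n, (-1 : R) ^ ((i : ℕ) + 1) • D i x +
      (-1 : R) ^ (n + 1) • r x) :
    l' y + ∑ i : Fin (n + 1), (-1 : R) ^ ((i : ℕ) + 1) • D' i y + (-1 : R) ^ (n + 1 + 1) • r' y =
      (l' (l x) - D' 0 (l x)) - (r' (r x) - D' (Fin.last n) (r x)) := by
  have h1 : ∑ i : Fin (n + 1), (-1 : R) ^ ((i : ℕ) + 1) • D' i (l x) =
      -D' 0 (l x) - l' (∑ i : Fin n, (-1 : R) ^ ((i : ℕ) + 1) • D i x) := by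
    rw [Fin.sum_univ_succ, map_sum, sub_eq_add_neg, ← Finset.sum_neg_distrib]
    simp [hl, pow_succ]
  have h2 : ∑ i : Fin (n + 1), (-1 : R) ^ ((i : ℕ) + 1) • D' i (r x) =
      r' (∑ i : Fin n, (-1 : R) ^ ((i : ℕ) + 1) • D i x) +
        (-1 : R) ^ (n + 1) • D' (Fin.last n) (r x) := by
    rw [Fin.sum_univ_castSucc, map_sum]
    simp [hr]
  have h3 : ((-1 : R) ^ (n + 1)) * ((-1 : R) ^ (n + 1)) = 1 := by
    rw [← mul_pow]; simp
  have h4 : ∑ i : Fin (n + 1), (-1 : R) ^ ((i : ℕ) + 1) • D' i y =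
      ∑ i : Fin (n + 1), (-1 : R) ^ ((i : ℕ) + 1) • D' i (l x) +
      (-1 : R) ^ (n + 1) • ∑ i : Fin (n + 1), (-1 : R) ^ ((i : ℕ) + 1) • D' i (r x) := by
    rw [hy]
    simp only [map_add, smul_add, Finset.sum_add_distrib, sum_sum_inner_cofaces hD, add_zero,
      map_smul, Finset.smul_sum, smul_comm ((-1 : R) ^ (n + 1))]
  rw [h4, h1, h2, hy]
  simp only [map_add, map_smul, smul_add, smul_smul, pow_succ _ (n + 1), h3, hlr, mul_neg, mul_one,
    neg_mul, neg_smul, one_smul]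
  abel

/-- An operator `u - v`, where `u` is compatible with all cofaces up to a shift by two from the
left and `v` up to a shift by two from the right, commutes with alternating sums of cofaces. -/
lemma alternating_cofaces_comm {X' : Type*} [AddCommGroup X'] [Module R X'] {n : ℕ}
    {l r : X →ₗ[R] X'} {D : Fin n → X →ₗ[R] X'} {u v : X →ₗ[R] Y} {u' v' : X' →ₗ[R] Z}
    {l' r' : Y →ₗ[R] Z} {D' : Fin (n + 2) → Y →ₗ[R] Z} {x : X}
    (hlu : l' (u x) = u' (l x)) (hru : r' (u x) = u' (r x))
    (hlv : l' (v x) = v' (l x)) (hrv : r' (v x) = v' (r x))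
    (hu : ∀ i, D' (Fin.succ (Fin.succ i)) (u x) = u' (D i x))
    (hu0 : D' 0 (u x) = D' (Fin.succ 0) (u x))
    (hv : ∀ i, D' (Fin.castSucc (Fin.castSucc i)) (v x) = v' (D i x))
    (hv0 : D' (Fin.last (n + 1)) (v x) = D' (Fin.castSucc (Fin.last n)) (v x))
    {y : X'} (hy : y = l x + ∑ i : Fin n, (-1 : R) ^ ((i : ℕ) + 1) • D i x +
      (-1 : R) ^ (n + 1) • r x) :
    l' (u x - v x) + ∑ i : Fin (n + 2), (-1 : R) ^ ((i : ℕ) + 1) • D' i (u x - v x) +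
      (-1 : R) ^ (n + 2 + 1) • r' (u x - v x) = u' y - v' y := by
  have h1 : ∑ i : Fin (n + 2), (-1 : R) ^ ((i : ℕ) + 1) • D' i (u x) =
      ∑ i : Fin n, (-1 : R) ^ ((i : ℕ) + 1) • u' (D i x) := by
    rw [Fin.sum_univ_succ, Fin.sum_univ_succ, hu0]
    simp [hu, pow_succ]
  have h2 : ∑ i : Fin (n + 2), (-1 : R) ^ ((i : ℕ) + 1) • D' i (v x) =
      ∑ i : Fin n, (-1 : R) ^ ((i : ℕ) + 1) • v' (D i x) := by
    rw [Fin.sum_univ_castSucc, Fin.sum_univ_castSucc, hv0]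
    simp [hv, pow_succ]
  have h3 : (-1 : R) ^ (n + 2 + 1) = (-1 : R) ^ (n + 1) := by
    rw [show n + 2 + 1 = n + 1 + 2 by ring, pow_add]; simp
  simp only [hy, map_sub, map_add, map_sum, map_smul, smul_sub, Finset.sum_sub_distrib, h1, h2, h3,
    hlu, hru, hlv, hrv]
  abel

end AlternatingSums

/-! ### Outer cofaces -/

section Operators

variable {R A M M' N N' P : Type*} [CommRing R] [AddCommGroup A] [Module R A]
  [AddCommGroup M] [Module R M] [AddCommGroup M'] [Module R M'] [AddCommGroup N] [Module R N]
  [AddCommGroup N'] [Module R N'] [AddCommGroup P] [Module R P]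

/-- `φ ↦ (p ⊗ x ↦ g(p) · φ(x))`, on arguments split by `s`. -/
noncomputable def leftOp (l : A ⊗[R] M →ₗ[R] M) (g : P →ₗ[R] A) (s : P ⊗[R] N ≃ₗ[R] N') :
    (N →ₗ[R] M) →ₗ[R] (N' →ₗ[R] M) where
  toFun φ := l ∘ₗ TensorProduct.map g φ ∘ₗ s.symm.toLinearMap
  map_add' φ ψ := by
    simp only [TensorProduct.map_add_right, LinearMap.add_comp, LinearMap.comp_add]
  map_smul' c φ := by
    simp only [TensorProduct.map_smul_right, LinearMap.smul_comp, LinearMap.comp_smul,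
      RingHom.id_apply]

/-- `φ ↦ (x ⊗ p ↦ φ(x) · g(p))`, on arguments split by `s`. -/
noncomputable def rightOp (r : M ⊗[R] A →ₗ[R] M) (g : P →ₗ[R] A) (s : N ⊗[R] P ≃ₗ[R] N') :
    (N →ₗ[R] M) →ₗ[R] (N' →ₗ[R] M) where
  toFun φ := r ∘ₗ TensorProduct.map φ g ∘ₗ s.symm.toLinearMap
  map_add' φ ψ := by
    simp only [TensorProduct.map_add_left, LinearMap.add_comp, LinearMap.comp_add]
  map_smul' c φ := by
    simp only [TensorProduct.map_smul_left, LinearMap.smul_comp, LinearMap.comp_smul,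
      RingHom.id_apply]

/-- `φ ↦ (h ⊗ φ) l`, with values joined by `t`. -/
noncomputable def coleftOp (l : N →ₗ[R] A ⊗[R] N) (h : A →ₗ[R] P) (t : P ⊗[R] M ≃ₗ[R] M') :
    (N →ₗ[R] M) →ₗ[R] (N →ₗ[R] M') where
  toFun φ := t.toLinearMap ∘ₗ TensorProduct.map h φ ∘ₗ l
  map_add' φ ψ := by
    simp only [TensorProduct.map_add_right, LinearMap.add_comp, LinearMap.comp_add]
  map_smul' c φ := by
    simp only [TensorProduct.map_smul_right, LinearMap.smul_comp, LinearMap.comp_smul,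
      RingHom.id_apply]

/-- `φ ↦ (φ ⊗ h) r`, with values joined by `t`. -/
noncomputable def corightOp (r : N →ₗ[R] N ⊗[R] A) (h : A →ₗ[R] P) (t : M ⊗[R] P ≃ₗ[R] M') :
    (N →ₗ[R] M) →ₗ[R] (N →ₗ[R] M') where
  toFun φ := t.toLinearMap ∘ₗ TensorProduct.map φ h ∘ₗ r
  map_add' φ ψ := by
    simp only [TensorProduct.map_add_left, LinearMap.add_comp, LinearMap.comp_add]
  map_smul' c φ := by
    simp only [TensorProduct.map_smul_left, LinearMap.smul_comp, LinearMap.comp_smul,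
      RingHom.id_apply]

@[simp]
lemma leftOp_apply (l : A ⊗[R] M →ₗ[R] M) (g : P →ₗ[R] A) (s : P ⊗[R] N ≃ₗ[R] N')
    (φ : N →ₗ[R] M) (p : P) (x : N) : leftOp l g s φ (s (p ⊗ₜ x)) = l (g p ⊗ₜ φ x) := by
  simp [leftOp]

@[simp]
lemma rightOp_apply (r : M ⊗[R] A →ₗ[R] M) (g : P →ₗ[R] A) (s : N ⊗[R] P ≃ₗ[R] N')
    (φ : N →ₗ[R] M) (p : P) (x : N) : rightOp r g s φ (s (x ⊗ₜ p)) = r (φ x ⊗ₜ g p) := by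
  simp [rightOp]

lemma coleftOp_apply (l : N →ₗ[R] A ⊗[R] N) (h : A →ₗ[R] P) (t : P ⊗[R] M ≃ₗ[R] M')
    (φ : N →ₗ[R] M) (x : N) : coleftOp l h t φ x = t (TensorProduct.map h φ (l x)) := rfl

lemma corightOp_apply (r : N →ₗ[R] N ⊗[R] A) (h : A →ₗ[R] P) (t : M ⊗[R] P ≃ₗ[R] M')
    (φ : N →ₗ[R] M) (x : N) : corightOp r h t φ x = t (TensorProduct.map φ h (r x)) := rfl

end Operators

/-! ### The components as alternating sums -/

namespace HomAssocAlgebra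

variable {R A : Type*} [CommRing R] [AddCommGroup A] [Module R A] (H : HomAssocAlgebra R A)
variable {M : Type*} [AddCommGroup M] [Module R M]

lemma dHoch_eq (l : A ⊗[R] M →ₗ[R] M) (r : M ⊗[R] A →ₗ[R] M) (e n : ℕ)
    (φ : (⨂[R]^n A) →ₗ[R] M) :
    H.dHoch l r e n φ = leftOp l (H.α ^ e) (consEquiv R A n) φ +
      ∑ i : Fin n, (-1 : R) ^ ((i : ℕ) + 1) • LinearMap.lcomp R M (H.mulAt n i) φ +
      (-1 : R) ^ (n + 1) • rightOp r (H.α ^ e) (snocEquiv R A n) φ := rfl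

lemma dAlphaMu_eq (l : A ⊗[R] M →ₗ[R] M) (r : M ⊗[R] A →ₗ[R] M) (n : ℕ)
    (φ : (⨂[R]^n A) →ₗ[R] M) :
    H.dAlphaMu l r n φ = leftOp l ((H.α ^ (n - 1)) ∘ₗ H.mul) (consTwoEquiv R A n) φ -
      rightOp r ((H.α ^ (n - 1)) ∘ₗ H.mul) (snocTwoEquiv R A n) φ := rfl

end HomAssocAlgebra

namespace HomCoassocCoalgebra

variable {R A : Type*} [CommRing R] [AddCommGroup A] [Module R A] (H : HomCoassocCoalgebra R A)
variable {N : Type*} [AddCommGroup N] [Module R N]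

lemma dCoHoch_eq (l : N →ₗ[R] A ⊗[R] N) (r : N →ₗ[R] N ⊗[R] A) (e m : ℕ)
    (φ : N →ₗ[R] (⨂[R]^m A)) :
    H.dCoHoch l r e m φ = coleftOp l (H.β ^ e) (consEquiv R A m) φ +
      ∑ i : Fin m, (-1 : R) ^ ((i : ℕ) + 1) • LinearMap.compRight R (H.comulAt m i) φ +
      (-1 : R) ^ (m + 1) • corightOp r (H.β ^ e) (snocEquiv R A m) φ := rfl

lemma dBetaDelta_eq (l : N →ₗ[R] A ⊗[R] N) (r : N →ₗ[R] N ⊗[R] A) (m : ℕ)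
    (φ : N →ₗ[R] (⨂[R]^m A)) :
    H.dBetaDelta l r m φ = coleftOp l (H.comul ∘ₗ (H.β ^ (m - 1))) (consTwoEquiv R A m) φ -
      corightOp r (H.comul ∘ₗ (H.β ^ (m - 1))) (snocTwoEquiv R A m) φ := rfl

end HomCoassocCoalgebra

/-! ### The algebra complex with values in a Hom-bimodule -/

namespace HomAssocAlgebra

variable {R A : Type*} [CommRing R] [AddCommGroup A] [Module R A] (H : HomAssocAlgebra R A)
variable {M : Type*} [AddCommGroup M] [Module R M]

/-- `(M, α_M)` is a Hom-bimodule with left action `l` and right action `r`. -/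
structure IsBimodule (l : A ⊗[R] M →ₗ[R] M) (r : M ⊗[R] A →ₗ[R] M) (αM : M →ₗ[R] M) : Prop where
  left_left : ∀ a b v, l (H.α a ⊗ₜ l (b ⊗ₜ v)) = l (H.mul (a ⊗ₜ b) ⊗ₜ αM v)
  right_right : ∀ a b v, r (r (v ⊗ₜ a) ⊗ₜ H.α b) = r (αM v ⊗ₜ H.mul (a ⊗ₜ b))
  left_right : ∀ a b v, l (H.α a ⊗ₜ r (v ⊗ₜ b)) = r (l (a ⊗ₜ v) ⊗ₜ H.α b)
  map_left : ∀ a v, αM (l (a ⊗ₜ v)) = l (H.α a ⊗ₜ αM v)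
  map_right : ∀ a v, αM (r (v ⊗ₜ a)) = r (αM v ⊗ₜ H.α a)

variable {H} {l : A ⊗[R] M →ₗ[R] M} {r : M ⊗[R] A →ₗ[R] M} {αM : M →ₗ[R] M}

lemma dMuAlpha_apply (n : ℕ) (φ : (⨂[R]^n A) →ₗ[R] M) (x) :
    H.dMuAlpha αM n φ x = αM (φ x) - φ (powMap n H.α x) := rfl

lemma alpha_pow_succ (e : ℕ) (a : A) : (H.α ^ (e + 1)) a = H.α ((H.α ^ e) a) := by
  rw [pow_succ', Module.End.mul_apply]

lemma alpha_pow_alpha (e : ℕ) (a : A) : (H.α ^ e) (H.α a) = H.α ((H.α ^ e) a) := by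
  rw [← Module.End.mul_apply, ← pow_succ, alpha_pow_succ]

/-- A second Hochschild-type differential fails to annihilate the image of the first one only
because of the two first and the two last cofaces. -/
lemma dHoch_dHoch (hM : H.IsBimodule l r αM) (e n : ℕ) (φ : (⨂[R]^n A) →ₗ[R] M) :
    H.dHoch l r (e + 1) (n + 1) (H.dHoch l r e n φ) =
      leftOp l ((H.α ^ e) ∘ₗ H.mul) (consTwoEquiv R A n) (H.dMuAlpha αM n φ) -
        rightOp r ((H.α ^ e) ∘ₗ H.mul) (snocTwoEquiv R A n) (H.dMuAlpha αM n φ) := by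
  rw [dHoch_eq H l r (e + 1) (n + 1), alternating_cofaces_sq (y := H.dHoch l r e n φ) (x := φ)
    (hy := dHoch_eq H l r e n φ)]
  · congr 1
    · refine hom_ext_cons_cons fun a b x => ?_
      rw [← consTwoEquiv_tmul, leftOp_apply, LinearMap.sub_apply, LinearMap.lcomp_apply,
        mulAt_zero_consTwo, leftOp_apply, consTwoEquiv_tmul, leftOp_apply, leftOp_apply,
        alpha_pow_succ, hM.left_left, ← alpha_pow_mul, dMuAlpha_apply, TensorProduct.tmul_sub,
        map_sub]
      rfl
    · refine hom_ext_snoc_snoc fun x a b => ?_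
      rw [← snocTwoEquiv_tmul, rightOp_apply, LinearMap.sub_apply, LinearMap.lcomp_apply,
        mulAt_last_snocTwo, rightOp_apply, snocTwoEquiv_tmul, rightOp_apply, rightOp_apply,
        alpha_pow_succ, hM.right_right, ← alpha_pow_mul, dMuAlpha_apply,
        TensorProduct.sub_tmul, map_sub]
      rfl
  · refine hom_ext_cons_snoc fun a x b => ?_
    rw [leftOp_apply, rightOp_apply, ← snocEquiv_consEquiv, rightOp_apply, leftOp_apply,
      alpha_pow_succ, alpha_pow_succ, hM.left_right]
  · intro i
    refine hom_ext_cons fun a x => ?_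
    rw [leftOp_apply, LinearMap.lcomp_apply, LinearMap.lcomp_apply, mulAt_succ_cons,
      leftOp_apply, alpha_pow_succ, alpha_pow_alpha]
  · intro i
    refine hom_ext_snoc fun x a => ?_
    rw [rightOp_apply, LinearMap.lcomp_apply, LinearMap.lcomp_apply, mulAt_castSucc_snoc,
      rightOp_apply, alpha_pow_succ, alpha_pow_alpha]
  · intro i j hij
    refine LinearMap.ext fun x => ?_
    exact congrArg φ (H.mulAt_mulAt hij x)

/-- `∂_{μμ} ∂_{μμ} = ∂_{αμ} ∂_{μα}`. -/
lemma dHoch_dHoch_eq_dAlphaMu (hM : H.IsBimodule l r αM) (n : ℕ)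
    (φ : (⨂[R]^(n + 1) A) →ₗ[R] M) :
    H.dHoch l r (n + 1) (n + 2) (H.dHoch l r n (n + 1) φ) =
      H.dAlphaMu l r (n + 1) (H.dMuAlpha αM (n + 1) φ) :=
  dHoch_dHoch hM n (n + 1) φ

/-- `∂_{αα} ∂_{αα} = ∂_{μα} ∂_{αμ}`. -/
lemma dHoch_dHoch_eq_dMuAlpha (hM : H.IsBimodule l r αM) (n : ℕ)
    (φ : (⨂[R]^(n + 1) A) →ₗ[R] M) :
    H.dHoch l r (n + 2) (n + 2) (H.dHoch l r (n + 1) (n + 1) φ) =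
      H.dMuAlpha αM (n + 3) (H.dAlphaMu l r (n + 1) φ) := by
  rw [dHoch_dHoch hM, dAlphaMu_eq, map_sub]
  congr 1
  · refine hom_ext_cons_cons fun a b x => ?_
    simp only [← consTwoEquiv_tmul, leftOp_apply, dMuAlpha_apply, powMap_consTwo,
      TensorProduct.map_tmul, LinearMap.comp_apply, ← alpha_mul, alpha_pow_succ,
      alpha_pow_alpha, hM.map_left, TensorProduct.tmul_sub, map_sub, Nat.add_sub_cancel]
  · refine hom_ext_snoc_snoc fun x a b => ?_
    simp only [← snocTwoEquiv_tmul, rightOp_apply, dMuAlpha_apply, powMap_snocTwo,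
      TensorProduct.map_tmul, LinearMap.comp_apply, ← alpha_mul, alpha_pow_succ,
      alpha_pow_alpha, hM.map_right, TensorProduct.sub_tmul, map_sub, Nat.add_sub_cancel]

/-- `∂_{μα} ∂_{μμ} = ∂_{αα} ∂_{μα}`. -/
lemma dMuAlpha_dHoch (hM : H.IsBimodule l r αM) (e n : ℕ) (φ : (⨂[R]^n A) →ₗ[R] M) :
    H.dMuAlpha αM (n + 1) (H.dHoch l r e n φ) = H.dHoch l r (e + 1) n (H.dMuAlpha αM n φ) := by
  rw [dHoch_eq, dHoch_eq]
  simp only [map_add, map_sum, map_smul]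
  refine congrArg₂ _ (congrArg₂ _ ?_ (Finset.sum_congr rfl fun i _ => congrArg _ ?_))
    (congrArg _ ?_)
  · refine hom_ext_cons fun a x => ?_
    simp only [leftOp_apply, dMuAlpha_apply, powMap_cons, alpha_pow_succ, alpha_pow_alpha,
      hM.map_left, TensorProduct.tmul_sub, map_sub]
  · refine LinearMap.ext fun x => ?_
    simp only [dMuAlpha_apply, LinearMap.lcomp_apply, H.mulAt_powMap H.alpha_mul (fun _ => rfl)]
  · refine hom_ext_snoc fun x a => ?_
    simp only [rightOp_apply, dMuAlpha_apply, powMap_snoc, alpha_pow_succ, alpha_pow_alpha,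
      hM.map_right, TensorProduct.sub_tmul, map_sub]

/-- `∂_{μμ} ∂_{αμ} = ∂_{αμ} ∂_{αα}`. -/
lemma dHoch_dAlphaMu (hM : H.IsBimodule l r αM) (n : ℕ) (φ : (⨂[R]^(n + 1) A) →ₗ[R] M) :
    H.dHoch l r (n + 2) (n + 3) (H.dAlphaMu l r (n + 1) φ) =
      H.dAlphaMu l r (n + 2) (H.dHoch l r (n + 1) (n + 1) φ) := by
  rw [dAlphaMu_eq, dAlphaMu_eq, dHoch_eq H l r (n + 2) (n + 3), alternating_cofaces_comm
    (y := H.dHoch l r (n + 1) (n + 1) φ) (x := φ) (hy := dHoch_eq H l r (n + 1) (n + 1) φ)]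
  · refine hom_ext_cons_cons fun a b x => ?_
    induction x using consInduction with
    | add x y hx hy => simp only [TensorProduct.tmul_add, map_add, hx, hy]
    | cons c x =>
      rw [leftOp_apply, ← consTwoEquiv_tmul, leftOp_apply, alpha_pow_succ, hM.left_left,
        consTwoEquiv_tmul, ← consTwoEquiv_tmul a b, leftOp_apply, leftOp_apply]
      simp only [LinearMap.comp_apply, Nat.add_sub_cancel, show n + 2 - 1 = n + 1 from rfl,
        alpha_pow_mul, alpha_pow_succ n]
      rw [← hom_assoc_apply, hM.left_left]
  · refine hom_ext_cons_cons fun a b x => ?_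
    induction x using snocInduction with
    | add x y hx hy => simp only [TensorProduct.tmul_add, map_add, hx, hy]
    | snoc x c =>
      rw [← consTwoEquiv_tmul, leftOp_apply, rightOp_apply, ← snocEquiv_consTwoEquiv,
        rightOp_apply, leftOp_apply]
      simp only [LinearMap.comp_apply, Nat.add_sub_cancel,
        show n + 2 - 1 = n + 1 from rfl, alpha_pow_succ]
      rw [hM.left_right]
  · refine hom_ext_cons_snoc fun a x c => ?_
    induction x using snocInduction with
    | add x y hx hy =>
      simp only [TensorProduct.tmul_add, TensorProduct.add_tmul, map_add, hx, hy]
    | snoc x b =>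
      rw [← snocTwoEquiv_tmul, leftOp_apply, rightOp_apply, ← snocTwoEquiv_consEquiv,
        rightOp_apply, leftOp_apply]
      simp only [LinearMap.comp_apply, Nat.add_sub_cancel,
        show n + 2 - 1 = n + 1 from rfl, alpha_pow_succ]
      rw [hM.left_right]
  · refine hom_ext_snoc_snoc fun x b a => ?_
    induction x using snocInduction with
    | add x y hx hy => simp only [TensorProduct.add_tmul, map_add, hx, hy]
    | snoc x c =>
      rw [rightOp_apply, ← snocTwoEquiv_tmul, rightOp_apply, alpha_pow_succ, hM.right_right,
        snocTwoEquiv_tmul, ← snocTwoEquiv_tmul, rightOp_apply, rightOp_apply]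
      simp only [LinearMap.comp_apply, Nat.add_sub_cancel, show n + 2 - 1 = n + 1 from rfl,
        alpha_pow_mul, alpha_pow_succ n]
      rw [hM.right_right, hom_assoc_apply]
  · intro i
    refine hom_ext_cons_cons fun a b x => ?_
    rw [LinearMap.lcomp_apply, mulAt_succ_cons, mulAt_succ_cons, ← consTwoEquiv_tmul,
      leftOp_apply, ← consTwoEquiv_tmul, leftOp_apply, LinearMap.lcomp_apply]
    simp only [LinearMap.comp_apply, Nat.add_sub_cancel, ← alpha_mul,
        show n + 2 - 1 = n + 1 from rfl, alpha_pow_succ, alpha_pow_alpha]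
  · refine hom_ext_cons_cons fun a b x => ?_
    induction x using consInduction with
    | add x y hx hy => simp only [TensorProduct.tmul_add, map_add, hx, hy]
    | cons c x =>
      rw [LinearMap.lcomp_apply, LinearMap.lcomp_apply, mulAt_succ_cons, mulAt_zero_cons,
        mulAt_zero_cons, powMap_cons, ← consTwoEquiv_tmul, leftOp_apply, ← consTwoEquiv_tmul,
        leftOp_apply, LinearMap.comp_apply, LinearMap.comp_apply, hom_assoc_apply]
  · intro i
    refine hom_ext_snoc_snoc fun x b a => ?_
    rw [LinearMap.lcomp_apply, mulAt_castSucc_snoc, mulAt_castSucc_snoc, ← snocTwoEquiv_tmul,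
      rightOp_apply, ← snocTwoEquiv_tmul, rightOp_apply, LinearMap.lcomp_apply]
    simp only [LinearMap.comp_apply, Nat.add_sub_cancel, ← alpha_mul,
        show n + 2 - 1 = n + 1 from rfl, alpha_pow_succ, alpha_pow_alpha]
  · refine hom_ext_snoc_snoc fun x b a => ?_
    induction x using snocInduction with
    | add x y hx hy => simp only [TensorProduct.add_tmul, map_add, hx, hy]
    | snoc x c =>
      rw [LinearMap.lcomp_apply, LinearMap.lcomp_apply, mulAt_castSucc_snoc, mulAt_last_snoc,
        mulAt_last_snoc, powMap_snoc, ← snocTwoEquiv_tmul, rightOp_apply, ← snocTwoEquiv_tmul,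
        rightOp_apply, LinearMap.comp_apply, LinearMap.comp_apply, hom_assoc_apply]

end HomAssocAlgebra

/-! ### The coalgebra complex on maps from a Hom-bicomodule -/

namespace HomCoassocCoalgebra

variable {R A : Type*} [CommRing R] [AddCommGroup A] [Module R A] (H : HomCoassocCoalgebra R A)

section

variable {M : Type*} [AddCommGroup M] [Module R M]

lemma comulAt_succ_cons_map {n : ℕ} (i : Fin n) (h : A →ₗ[R] A) (φ : M →ₗ[R] (⨂[R]^n A))
    (w : A ⊗[R] M) :
    H.comulAt (n + 1) i.succ (consEquiv R A n (TensorProduct.map h φ w)) =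
      consEquiv R A (n + 1) (TensorProduct.map (H.β ∘ₗ h) (H.comulAt n i ∘ₗ φ) w) := by
  induction w with
  | zero => simp
  | add t s ht hs => simp only [map_add, ht, hs]
  | tmul a y => simp

lemma comulAt_castSucc_snoc_map {n : ℕ} (i : Fin n) (h : A →ₗ[R] A) (φ : M →ₗ[R] (⨂[R]^n A))
    (w : M ⊗[R] A) :
    H.comulAt (n + 1) i.castSucc (snocEquiv R A n (TensorProduct.map φ h w)) =
      snocEquiv R A (n + 1) (TensorProduct.map (H.comulAt n i ∘ₗ φ) (H.β ∘ₗ h) w) := by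
  induction w with
  | zero => simp
  | add t s ht hs => simp only [map_add, ht, hs]
  | tmul a y => simp

lemma comulAt_zero_cons_map {n : ℕ} (h : A →ₗ[R] A) (φ : M →ₗ[R] (⨂[R]^n A)) (w : A ⊗[R] M) :
    H.comulAt (n + 1) 0 (consEquiv R A n (TensorProduct.map h φ w)) =
      consTwoEquiv R A n (TensorProduct.map (H.comul ∘ₗ h) (powMap n H.β ∘ₗ φ) w) := by
  induction w with
  | zero => simp
  | add t s ht hs => simp only [map_add, ht, hs]
  | tmul a y => simp

lemma comulAt_last_snoc_map {n : ℕ} (h : A →ₗ[R] A) (φ : M →ₗ[R] (⨂[R]^n A)) (w : M ⊗[R] A) :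
    H.comulAt (n + 1) (Fin.last n) (snocEquiv R A n (TensorProduct.map φ h w)) =
      snocTwoEquiv R A n (TensorProduct.map (powMap n H.β ∘ₗ φ) (H.comul ∘ₗ h) w) := by
  induction w with
  | zero => simp
  | add t s ht hs => simp only [map_add, ht, hs]
  | tmul a y => simp

lemma comulAt_succ_succ_consTwo_map {n : ℕ} (i : Fin n) (h : A →ₗ[R] A)
    (φ : M →ₗ[R] (⨂[R]^n A)) (w : A ⊗[R] M) :
    H.comulAt (n + 2) i.succ.succ (consTwoEquiv R A n (TensorProduct.map (H.comul ∘ₗ h) φ w)) =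
      consTwoEquiv R A (n + 1)
        (TensorProduct.map (H.comul ∘ₗ H.β ∘ₗ h) (H.comulAt n i ∘ₗ φ) w) := by
  induction w with
  | zero => simp
  | add t s ht hs => simp only [map_add, ht, hs]
  | tmul a y => simp [comulAt_succ_succ_consTwo, comul_beta]

lemma comulAt_castSucc_castSucc_snocTwo {n : ℕ} (j : Fin n) (t : A ⊗[R] A) (x : ⨂[R]^n A) :
    H.comulAt (n + 2) j.castSucc.castSucc (snocTwoEquiv R A n (x ⊗ₜ t)) =
      snocTwoEquiv R A (n + 1) (H.comulAt n j x ⊗ₜ TensorProduct.map H.β H.β t) := by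
  induction t with
  | zero => simp
  | tmul a b => simp
  | add t s ht hs => simp only [TensorProduct.tmul_add, map_add, ht, hs]

lemma comulAt_castSucc_castSucc_snocTwo_map {n : ℕ} (i : Fin n) (h : A →ₗ[R] A)
    (φ : M →ₗ[R] (⨂[R]^n A)) (w : M ⊗[R] A) :
    H.comulAt (n + 2) i.castSucc.castSucc
        (snocTwoEquiv R A n (TensorProduct.map φ (H.comul ∘ₗ h) w)) =
      snocTwoEquiv R A (n + 1)
        (TensorProduct.map (H.comulAt n i ∘ₗ φ) (H.comul ∘ₗ H.β ∘ₗ h) w) := by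
  induction w with
  | zero => simp
  | add t s ht hs => simp only [map_add, ht, hs]
  | tmul a y => simp [comulAt_castSucc_castSucc_snocTwo, comul_beta]

/-- Hom-coassociativity behind a tensor `x`. -/
lemma snocTwo_snoc_comul {n : ℕ} (a : A) (x : ⨂[R]^n A) :
    (snocEquiv R A (n + 2)).toLinearMap (TensorProduct.map
        (snocTwoEquiv R A n).toLinearMap LinearMap.id ((TensorProduct.assoc R _ (A ⊗[R] A) A).symm
          (x ⊗ₜ TensorProduct.map H.comul H.β (H.comul a)))) =
    (snocTwoEquiv R A (n + 1)).toLinearMap (TensorProduct.map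
        (snocEquiv R A n).toLinearMap LinearMap.id ((TensorProduct.assoc R _ A (A ⊗[R] A)).symm
          (x ⊗ₜ TensorProduct.map H.β H.comul (H.comul a)))) := by
  rw [← hom_coassoc_apply]
  generalize TensorProduct.map H.comul H.β (H.comul a) = w
  induction w with
  | zero => simp
  | add t s ht hs => simp only [TensorProduct.tmul_add, map_add, ht, hs]
  | tmul t c =>
    induction t with
    | zero => simp
    | add t s ht hs => simp only [TensorProduct.add_tmul, TensorProduct.tmul_add, map_add, ht, hs]
    | tmul a b => simp

lemma comulAt_zero_consTwo_map {n : ℕ} (h : A →ₗ[R] A) (φ : M →ₗ[R] (⨂[R]^n A)) (w : A ⊗[R] M) :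
    H.comulAt (n + 2) 0 (consTwoEquiv R A n (TensorProduct.map (H.comul ∘ₗ h) φ w)) =
      H.comulAt (n + 2) (Fin.succ 0)
        (consTwoEquiv R A n (TensorProduct.map (H.comul ∘ₗ h) φ w)) := by
  induction w with
  | zero => simp
  | add t s ht hs => simp only [map_add, ht, hs]
  | tmul a y =>
    rw [TensorProduct.map_tmul, LinearMap.comp_apply, comulAt_zero_consTwo_comul]

lemma comulAt_last_snocTwo_map {n : ℕ} (h : A →ₗ[R] A) (φ : M →ₗ[R] (⨂[R]^n A)) (w : M ⊗[R] A) :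
    H.comulAt (n + 2) (Fin.last (n + 1))
        (snocTwoEquiv R A n (TensorProduct.map φ (H.comul ∘ₗ h) w)) =
      H.comulAt (n + 2) (Fin.castSucc (Fin.last n))
        (snocTwoEquiv R A n (TensorProduct.map φ (H.comul ∘ₗ h) w)) := by
  have hl (x : ⨂[R]^n A) (t : A ⊗[R] A) :
      H.comulAt (n + 2) (Fin.last (n + 1)) (snocTwoEquiv R A n (x ⊗ₜ t)) =
        (snocTwoEquiv R A (n + 1)).toLinearMap (TensorProduct.map (snocEquiv R A n).toLinearMap
          LinearMap.id ((TensorProduct.assoc R _ A (A ⊗[R] A)).symm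
            (powMap n H.β x ⊗ₜ TensorProduct.map H.β H.comul t))) := by
    induction t with
    | zero => simp
    | add t s ht hs => simp only [TensorProduct.tmul_add, map_add, ht, hs]
    | tmul a b => simp
  have hr (x : ⨂[R]^n A) (t : A ⊗[R] A) :
      H.comulAt (n + 2) (Fin.castSucc (Fin.last n)) (snocTwoEquiv R A n (x ⊗ₜ t)) =
        (snocEquiv R A (n + 2)).toLinearMap (TensorProduct.map (snocTwoEquiv R A n).toLinearMap
          LinearMap.id ((TensorProduct.assoc R _ (A ⊗[R] A) A).symm
            (powMap n H.β x ⊗ₜ TensorProduct.map H.comul H.β t))) := by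
    induction t with
    | zero => simp
    | add t s ht hs => simp only [TensorProduct.tmul_add, map_add, ht, hs]
    | tmul a b => simp
  induction w with
  | zero => simp
  | add t s ht hs => simp only [map_add, ht, hs]
  | tmul y a =>
    rw [TensorProduct.map_tmul, LinearMap.comp_apply, hl, hr, snocTwo_snoc_comul]

end

variable {N : Type*} [AddCommGroup N] [Module R N]

/-- `(N, β_N)` is a Hom-bicomodule with left coaction `l` and right coaction `r`. -/
structure IsBicomodule (l : N →ₗ[R] A ⊗[R] N) (r : N →ₗ[R] N ⊗[R] A) (βN : N →ₗ[R] N) : Prop where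
  left_left : ∀ x, TensorProduct.assoc R _ _ _ (TensorProduct.map H.comul βN (l x)) =
    TensorProduct.map H.β l (l x)
  right_right : ∀ x, TensorProduct.assoc R _ _ _ (TensorProduct.map r H.β (r x)) =
    TensorProduct.map βN H.comul (r x)
  left_right : ∀ x, TensorProduct.assoc R _ _ _ (TensorProduct.map l H.β (r x)) =
    TensorProduct.map H.β r (l x)
  map_left : ∀ x, l (βN x) = TensorProduct.map H.β βN (l x)
  map_right : ∀ x, r (βN x) = TensorProduct.map βN H.β (r x)

variable {H} {l : N →ₗ[R] A ⊗[R] N} {r : N →ₗ[R] N ⊗[R] A} {βN : N →ₗ[R] N}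

section Iterated

variable {M M' M'' P Q : Type*} [AddCommGroup M] [Module R M] [AddCommGroup M'] [Module R M']
  [AddCommGroup M''] [Module R M''] [AddCommGroup P] [Module R P] [AddCommGroup Q] [Module R Q]

/-- Two left outer cofaces in a row depend on the Hom-coassociativity of the coaction only. -/
lemma coleftOp_coleftOp (hN : H.IsBicomodule l r βN) (h : A →ₗ[R] P) (t : P ⊗[R] M ≃ₗ[R] M')
    (k : A →ₗ[R] Q) (t' : Q ⊗[R] M' ≃ₗ[R] M'') (φ : N →ₗ[R] M) (x : N) :
    coleftOp l (k ∘ₗ H.β) t' (coleftOp l h t φ) x =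
      t' (TensorProduct.map k (t.toLinearMap ∘ₗ TensorProduct.map h φ)
        (TensorProduct.assoc R _ _ _ (TensorProduct.map H.comul βN (l x)))) := by
  rw [hN.left_left, TensorProduct.map_map]
  rfl

lemma corightOp_corightOp (hN : H.IsBicomodule l r βN) (h : A →ₗ[R] P) (t : M ⊗[R] P ≃ₗ[R] M')
    (k : A →ₗ[R] Q) (t' : M' ⊗[R] Q ≃ₗ[R] M'') (φ : N →ₗ[R] M) (x : N) :
    corightOp r (k ∘ₗ H.β) t' (corightOp r h t φ) x =
      t' (TensorProduct.map (t.toLinearMap ∘ₗ TensorProduct.map φ h) k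
        ((TensorProduct.assoc R _ _ _).symm (TensorProduct.map βN H.comul (r x)))) := by
  rw [← hN.right_right, LinearEquiv.symm_apply_apply, TensorProduct.map_map]
  rfl

/-- Left and right outer cofaces commute as soon as the splittings of the target do. -/
lemma corightOp_coleftOp (hN : H.IsBicomodule l r βN) {M₁ M₂ : Type*} [AddCommGroup M₁]
    [Module R M₁] [AddCommGroup M₂] [Module R M₂] (h : A →ₗ[R] P) (k : A →ₗ[R] Q)
    (t : P ⊗[R] M ≃ₗ[R] M₁) (t' : M₁ ⊗[R] Q ≃ₗ[R] M'') (s : M ⊗[R] Q ≃ₗ[R] M₂)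
    (s' : P ⊗[R] M₂ ≃ₗ[R] M'')
    (hst : ∀ p m q, t' (t (p ⊗ₜ m) ⊗ₜ q) = s' (p ⊗ₜ s (m ⊗ₜ q))) (φ : N →ₗ[R] M) :
    corightOp r (k ∘ₗ H.β) t' (coleftOp l h t φ) = coleftOp l (h ∘ₗ H.β) s' (corightOp r k s φ) := by
  refine LinearMap.ext fun x => ?_
  have h1 : corightOp r (k ∘ₗ H.β) t' (coleftOp l h t φ) x =
      t' (TensorProduct.map (t.toLinearMap ∘ₗ TensorProduct.map h φ) k
        (TensorProduct.map l H.β (r x))) := by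
    rw [TensorProduct.map_map]
    rfl
  have h2 : coleftOp l (h ∘ₗ H.β) s' (corightOp r k s φ) x =
      s' (TensorProduct.map h (s.toLinearMap ∘ₗ TensorProduct.map φ k)
        (TensorProduct.assoc R _ _ _ (TensorProduct.map l H.β (r x)))) := by
    rw [hN.left_right, TensorProduct.map_map]
    rfl
  rw [h1, h2]
  generalize TensorProduct.map l H.β (r x) = w
  induction w with
  | zero => simp
  | add t s ht hs => simp only [map_add, ht, hs]
  | tmul v c =>
    induction v with
    | zero => simp
    | add t s ht hs => simp only [TensorProduct.add_tmul, map_add, ht, hs]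
    | tmul a b => simp [hst]

end Iterated

lemma dDeltaBeta_eq (m : ℕ) (φ : N →ₗ[R] (⨂[R]^m A)) :
    H.dDeltaBeta βN m φ = φ ∘ₗ βN - powMap m H.β ∘ₗ φ := rfl

/-- A second Cartier-type differential fails to annihilate the image of the first one only
because of the two first and the two last cofaces. -/
lemma dCoHoch_dCoHoch (hN : H.IsBicomodule l r βN) (e m : ℕ) (φ : N →ₗ[R] (⨂[R]^m A)) :
    H.dCoHoch l r (e + 1) (m + 1) (H.dCoHoch l r e m φ) =
      coleftOp l (H.comul ∘ₗ (H.β ^ e)) (consTwoEquiv R A m) (H.dDeltaBeta βN m φ) -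
        corightOp r (H.comul ∘ₗ (H.β ^ e)) (snocTwoEquiv R A m) (H.dDeltaBeta βN m φ) := by
  rw [dCoHoch_eq H l r (e + 1) (m + 1), alternating_cofaces_sq (y := H.dCoHoch l r e m φ) (x := φ)
    (hy := dCoHoch_eq H l r e m φ), dDeltaBeta_eq, map_sub, map_sub]
  · refine congrArg₂ _ (congrArg₂ _ (LinearMap.ext fun x => ?_) (LinearMap.ext fun x => ?_))
      (congrArg₂ _ (LinearMap.ext fun x => ?_) (LinearMap.ext fun x => ?_))
    · rw [pow_succ, Module.End.mul_eq_comp, coleftOp_coleftOp hN, coleftOp_apply]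
      generalize l x = w
      induction w with
      | zero => simp
      | add t s ht hs => simp only [map_add, ht, hs]
      | tmul a y =>
        simp only [TensorProduct.map_tmul, LinearMap.comp_apply, comul_beta_pow]
        generalize H.comul a = t
        induction t with
        | zero => simp
        | add t s ht hs => simp only [TensorProduct.add_tmul, map_add, ht, hs]
        | tmul b c => simp
    · exact comulAt_zero_cons_map H (H.β ^ e) φ (l x)
    · rw [pow_succ, Module.End.mul_eq_comp, corightOp_corightOp hN, corightOp_apply]
      generalize r x = w
      induction w with
      | zero => simp
      | add t s ht hs => simp only [map_add, ht, hs]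
      | tmul y a =>
        simp only [TensorProduct.map_tmul, LinearMap.comp_apply, comul_beta_pow]
        generalize H.comul a = t
        induction t with
        | zero => simp
        | add t s ht hs => simp only [TensorProduct.tmul_add, map_add, ht, hs]
        | tmul b c => simp
    · exact comulAt_last_snoc_map H (H.β ^ e) φ (r x)
  · rw [pow_succ, Module.End.mul_eq_comp]
    exact corightOp_coleftOp hN _ _ _ _ _ _ (fun p m q => snocEquiv_consEquiv p q m) φ
  · intro i
    rw [pow_succ', Module.End.mul_eq_comp]
    exact LinearMap.ext fun x => comulAt_succ_cons_map H i _ _ _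
  · intro i
    rw [pow_succ', Module.End.mul_eq_comp]
    exact LinearMap.ext fun x => comulAt_castSucc_snoc_map H i _ _ _
  · intro i j hij
    exact LinearMap.ext fun x => H.comulAt_comulAt hij (φ x)

/-- `∂_{ΔΔ} ∂_{ΔΔ} = ∂_{βΔ} ∂_{Δβ}`. -/
lemma dCoHoch_dCoHoch_eq_dBetaDelta (hN : H.IsBicomodule l r βN) (m : ℕ)
    (φ : N →ₗ[R] (⨂[R]^(m + 1) A)) :
    H.dCoHoch l r (m + 1) (m + 2) (H.dCoHoch l r m (m + 1) φ) =
      H.dBetaDelta l r (m + 1) (H.dDeltaBeta βN (m + 1) φ) :=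
  dCoHoch_dCoHoch hN m (m + 1) φ

lemma dDeltaBeta_coleftOp (hN : H.IsBicomodule l r βN) {m m' : ℕ} {P : Type*} [AddCommGroup P]
    [Module R P] {h : A →ₗ[R] P} {h' : A →ₗ[R] P} {t : P ⊗[R] (⨂[R]^m A) ≃ₗ[R] (⨂[R]^m' A)}
    (f : P →ₗ[R] P) (hf : f ∘ₗ h = h') (hβ : h ∘ₗ H.β = h')
    (ht : ∀ p y, powMap m' H.β (t (p ⊗ₜ y)) = t (f p ⊗ₜ powMap m H.β y))
    (φ : N →ₗ[R] (⨂[R]^m A)) :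
    H.dDeltaBeta βN m' (coleftOp l h t φ) = coleftOp l h' t (H.dDeltaBeta βN m φ) := by
  rw [dDeltaBeta_eq, dDeltaBeta_eq, map_sub]
  refine congrArg₂ _ (LinearMap.ext fun x => ?_) (LinearMap.ext fun x => ?_)
  · rw [LinearMap.comp_apply, coleftOp_apply, coleftOp_apply, hN.map_left, TensorProduct.map_map, hβ]
  · rw [LinearMap.comp_apply, coleftOp_apply, coleftOp_apply, ← hf]
    generalize l x = w
    induction w with
    | zero => simp
    | add t s ht hs => simp only [map_add, ht, hs]
    | tmul a y => simp [ht]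

lemma dDeltaBeta_corightOp (hN : H.IsBicomodule l r βN) {m m' : ℕ} {P : Type*} [AddCommGroup P]
    [Module R P] {h : A →ₗ[R] P} {h' : A →ₗ[R] P} {t : (⨂[R]^m A) ⊗[R] P ≃ₗ[R] (⨂[R]^m' A)}
    (f : P →ₗ[R] P) (hf : f ∘ₗ h = h') (hβ : h ∘ₗ H.β = h')
    (ht : ∀ p y, powMap m' H.β (t (y ⊗ₜ p)) = t (powMap m H.β y ⊗ₜ f p))
    (φ : N →ₗ[R] (⨂[R]^m A)) :
    H.dDeltaBeta βN m' (corightOp r h t φ) = corightOp r h' t (H.dDeltaBeta βN m φ) := by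
  rw [dDeltaBeta_eq, dDeltaBeta_eq, map_sub]
  refine congrArg₂ _ (LinearMap.ext fun x => ?_) (LinearMap.ext fun x => ?_)
  · rw [LinearMap.comp_apply, corightOp_apply, corightOp_apply, hN.map_right,
      TensorProduct.map_map, hβ]
  · rw [LinearMap.comp_apply, corightOp_apply, corightOp_apply, ← hf]
    generalize r x = w
    induction w with
    | zero => simp
    | add t s ht hs => simp only [map_add, ht, hs]
    | tmul a y => simp [ht]

lemma map_beta_comp_comul_beta_pow (e : ℕ) :
    TensorProduct.map H.β H.β ∘ₗ H.comul ∘ₗ (H.β ^ e) = H.comul ∘ₗ (H.β ^ (e + 1)) := by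
  rw [pow_succ', Module.End.mul_eq_comp, ← LinearMap.comp_assoc, ← H.comultiplicative,
    LinearMap.comp_assoc]

/-- `∂_{ββ} ∂_{ββ} = ∂_{Δβ} ∂_{βΔ}`. -/
lemma dCoHoch_dCoHoch_eq_dDeltaBeta (hN : H.IsBicomodule l r βN) (m : ℕ)
    (φ : N →ₗ[R] (⨂[R]^(m + 1) A)) :
    H.dCoHoch l r (m + 2) (m + 2) (H.dCoHoch l r (m + 1) (m + 1) φ) =
      H.dDeltaBeta βN (m + 3) (H.dBetaDelta l r (m + 1) φ) := by
  rw [dCoHoch_dCoHoch hN, dBetaDelta_eq, map_sub]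
  refine congrArg₂ _ ?_ ?_
  · refine (dDeltaBeta_coleftOp hN (TensorProduct.map H.β H.β) (map_beta_comp_comul_beta_pow m) ?_
      (powMap_consTwo H.β) φ).symm
    rw [pow_succ, Module.End.mul_eq_comp]
    rfl
  · refine (dDeltaBeta_corightOp hN (TensorProduct.map H.β H.β) (map_beta_comp_comul_beta_pow m) ?_
      (powMap_snocTwo H.β) φ).symm
    rw [pow_succ, Module.End.mul_eq_comp]
    rfl

/-- `∂_{Δβ} ∂_{ΔΔ} = ∂_{ββ} ∂_{Δβ}`. -/
lemma dDeltaBeta_dCoHoch (hN : H.IsBicomodule l r βN) (e m : ℕ) (φ : N →ₗ[R] (⨂[R]^m A)) :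
    H.dDeltaBeta βN (m + 1) (H.dCoHoch l r e m φ) =
      H.dCoHoch l r (e + 1) m (H.dDeltaBeta βN m φ) := by
  rw [dCoHoch_eq, dCoHoch_eq]
  simp only [map_add, map_sum, map_smul]
  refine congrArg₂ _ (congrArg₂ _ ?_ (Finset.sum_congr rfl fun i _ => congrArg _ ?_))
    (congrArg _ ?_)
  · refine dDeltaBeta_coleftOp hN H.β ?_ ?_ (powMap_cons H.β) φ
    · rw [pow_succ', Module.End.mul_eq_comp]
    · rw [pow_succ, Module.End.mul_eq_comp]
  · refine LinearMap.ext fun x => ?_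
    simp only [dDeltaBeta_eq, LinearMap.compRight_apply, LinearMap.sub_apply, LinearMap.comp_apply,
      map_sub, H.comulAt_powMap H.comul_beta (fun _ => rfl)]
  · refine dDeltaBeta_corightOp hN H.β ?_ ?_ (powMap_snoc H.β) φ
    · rw [pow_succ', Module.End.mul_eq_comp]
    · rw [pow_succ, Module.End.mul_eq_comp]

/-- `∂_{ΔΔ} ∂_{βΔ} = ∂_{βΔ} ∂_{ββ}`. -/
lemma dCoHoch_dBetaDelta (hN : H.IsBicomodule l r βN) (m : ℕ) (φ : N →ₗ[R] (⨂[R]^(m + 1) A)) :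
    H.dCoHoch l r (m + 2) (m + 3) (H.dBetaDelta l r (m + 1) φ) =
      H.dBetaDelta l r (m + 2) (H.dCoHoch l r (m + 1) (m + 1) φ) := by
  have e1 : H.β ^ (m + 2) = (H.β ^ (m + 1)) ∘ₗ H.β := pow_succ _ _
  have e2 : H.comul ∘ₗ (H.β ^ (m + 1)) = (H.comul ∘ₗ (H.β ^ m)) ∘ₗ H.β := by
    rw [pow_succ, Module.End.mul_eq_comp, LinearMap.comp_assoc]
  have e3 : H.β ^ (m + 1) = H.β ∘ₗ (H.β ^ m) := pow_succ' _ _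
  rw [dBetaDelta_eq, dBetaDelta_eq, dCoHoch_eq H l r (m + 2) (m + 3), alternating_cofaces_comm
    (y := H.dCoHoch l r (m + 1) (m + 1) φ) (x := φ) (hy := dCoHoch_eq H l r (m + 1) (m + 1) φ)]
  · refine LinearMap.ext fun x => ?_
    rw [show m + 2 - 1 = m + 1 from rfl, Nat.add_sub_cancel, e1, e2, coleftOp_coleftOp hN,
      coleftOp_coleftOp hN]
    generalize l x = w
    induction w with
    | zero => simp
    | add t s ht hs => simp only [map_add, ht, hs]
    | tmul a y =>
      have key := consTwo_cons_comul H ((H.β ^ m) a) (φ (βN y))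
      rw [comul_beta_pow] at key
      rw [TensorProduct.map_tmul, e3]
      revert key
      generalize H.comul a = t
      intro key
      convert key.symm using 1
      · clear key
        induction t with
        | zero => simp
        | add t s ht hs => simp only [TensorProduct.add_tmul, map_add, ht, hs]
        | tmul b c => simp
      · clear key
        induction t with
        | zero => simp
        | add t s ht hs => simp only [TensorProduct.add_tmul, map_add, ht, hs]
        | tmul b c => simp
  · rw [show m + 2 - 1 = m + 1 from rfl, Nat.add_sub_cancel, e1, e2]
    exact corightOp_coleftOp hN _ _ _ _ _ _ (fun p m q => snocEquiv_consTwoEquiv p m q) φ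
  · rw [show m + 2 - 1 = m + 1 from rfl, Nat.add_sub_cancel, e1, e2]
    exact (corightOp_coleftOp hN _ _ _ _ _ _ (fun p m q => snocTwoEquiv_consEquiv q m p) φ).symm
  · refine LinearMap.ext fun x => ?_
    rw [show m + 2 - 1 = m + 1 from rfl, Nat.add_sub_cancel, e1, e2, corightOp_corightOp hN,
      corightOp_corightOp hN]
    generalize r x = w
    induction w with
    | zero => simp
    | add t s ht hs => simp only [map_add, ht, hs]
    | tmul y a =>
      have key := snocTwo_snoc_comul H ((H.β ^ m) a) (φ (βN y))
      rw [comul_beta_pow] at key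
      rw [TensorProduct.map_tmul, e3]
      revert key
      generalize H.comul a = t
      intro key
      convert key using 1
      · clear key
        induction t with
        | zero => simp
        | add t s ht hs => simp only [TensorProduct.tmul_add, map_add, ht, hs]
        | tmul b c => simp
      · clear key
        induction t with
        | zero => simp
        | add t s ht hs => simp only [TensorProduct.tmul_add, map_add, ht, hs]
        | tmul b c => simp
  · intro i
    rw [show m + 2 - 1 = m + 1 from rfl, Nat.add_sub_cancel, e3]
    exact LinearMap.ext fun x => comulAt_succ_succ_consTwo_map H i _ _ _
  · exact LinearMap.ext fun x => comulAt_zero_consTwo_map H (H.β ^ m) φ (l x)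
  · intro i
    rw [show m + 2 - 1 = m + 1 from rfl, Nat.add_sub_cancel, e3]
    exact LinearMap.ext fun x => comulAt_castSucc_castSucc_snocTwo_map H i _ _ _
  · exact LinearMap.ext fun x => comulAt_last_snocTwo_map H (H.β ^ m) φ (r x)

end HomCoassocCoalgebra

/-! ### Actions and coactions along morphisms -/

namespace HomBialgebra

variable {R A : Type*} [CommRing R] [AddCommGroup A] [Module R A] (B : HomBialgebra R A)

section Induced

variable {M N : Type*} [AddCommGroup M] [Module R M] [AddCommGroup N] [Module R N]

/-- The left action `a · v = u(a) v` of `A` on an algebra `M` along a map `u : A → M`. -/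
noncomputable def leftAction (mulM : M →ₗ[R] M →ₗ[R] M) (u : A →ₗ[R] M) : A ⊗[R] M →ₗ[R] M :=
  TensorProduct.lift (mulM ∘ₗ u)

/-- The right action `v · a = v u(a)` of `A` on an algebra `M` along a map `u : A → M`. -/
noncomputable def rightAction (mulM : M →ₗ[R] M →ₗ[R] M) (u : A →ₗ[R] M) : M ⊗[R] A →ₗ[R] M :=
  TensorProduct.lift (mulM.compl₂ u)

@[simp]
lemma leftAction_tmul (mulM : M →ₗ[R] M →ₗ[R] M) (u : A →ₗ[R] M) (a : A) (v : M) :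
    leftAction mulM u (a ⊗ₜ v) = mulM (u a) v := by
  simp [leftAction]

@[simp]
lemma rightAction_tmul (mulM : M →ₗ[R] M →ₗ[R] M) (u : A →ₗ[R] M) (a : A) (v : M) :
    rightAction mulM u (v ⊗ₜ a) = mulM v (u a) := by
  simp [rightAction]

/-- The left coaction `x ↦ c(x⁽¹⁾) ⊗ x⁽²⁾` of `A` on a coalgebra `N` along a map `c : N → A`. -/
noncomputable def leftCoaction (comulN : N →ₗ[R] N ⊗[R] N) (c : N →ₗ[R] A) : N →ₗ[R] A ⊗[R] N :=
  TensorProduct.map c LinearMap.id ∘ₗ comulN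

/-- The right coaction `x ↦ x⁽¹⁾ ⊗ c(x⁽²⁾)` of `A` on a coalgebra `N` along a map `c : N → A`. -/
noncomputable def rightCoaction (comulN : N →ₗ[R] N ⊗[R] N) (c : N →ₗ[R] A) : N →ₗ[R] N ⊗[R] A :=
  TensorProduct.map LinearMap.id c ∘ₗ comulN

/-- A Hom-associative algebra is a Hom-bimodule along a morphism of Hom-algebras. -/
lemma isBimodule_of_hom {mulM : M →ₗ[R] M →ₗ[R] M} {αM : M →ₗ[R] M} {u : A →ₗ[R] M}
    (hassoc : ∀ x y z, mulM (mulM x y) (αM z) = mulM (αM x) (mulM y z))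
    (hα : ∀ x y, αM (mulM x y) = mulM (αM x) (αM y))
    (hu : ∀ a b, u (B.mul (a ⊗ₜ b)) = mulM (u a) (u b)) (huα : ∀ a, αM (u a) = u (B.α a)) :
    B.IsBimodule (leftAction mulM u) (rightAction mulM u) αM where
  left_left a b v := by simp only [leftAction_tmul, ← huα, hu, hassoc]
  right_right a b v := by simp only [rightAction_tmul, ← huα, hu, hassoc]
  left_right a b v := by simp only [leftAction_tmul, rightAction_tmul, ← huα, hassoc]
  map_left a v := by simp only [leftAction_tmul, ← huα, hα]
  map_right a v := by simp only [rightAction_tmul, ← huα, hα]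

/-- A Hom-coassociative coalgebra is a Hom-bicomodule along a morphism of Hom-coalgebras. -/
lemma isBicomodule_of_hom {comulN : N →ₗ[R] N ⊗[R] N} {βN : N →ₗ[R] N} {c : N →ₗ[R] A}
    (hcoassoc : ∀ x, TensorProduct.assoc R _ _ _ (TensorProduct.map comulN βN (comulN x)) =
      TensorProduct.map βN comulN (comulN x))
    (hβ : ∀ x, comulN (βN x) = TensorProduct.map βN βN (comulN x))
    (hc : ∀ x, B.comul (c x) = TensorProduct.map c c (comulN x))
    (hcβ : ∀ x, c (βN x) = B.β (c x)) :
    B.IsBicomodule (leftCoaction comulN c) (rightCoaction comulN c) βN := by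
  have hc' : B.comul ∘ₗ c = TensorProduct.map c c ∘ₗ comulN := LinearMap.ext hc
  have hcβ' : c ∘ₗ βN = B.β ∘ₗ c := LinearMap.ext hcβ
  refine ⟨fun x => ?_, fun x => ?_, fun x => ?_, fun x => ?_, fun x => ?_⟩
  · have h := congrArg (TensorProduct.map c (TensorProduct.map c LinearMap.id)) (hcoassoc x)
    rw [TensorProduct.map_map_assoc] at h
    simp only [TensorProduct.map_map] at h
    simp only [leftCoaction, LinearMap.comp_apply, TensorProduct.map_map, hc', ← hcβ',
      LinearMap.id_comp, LinearMap.comp_id] at h ⊢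
    exact h
  · have h := congrArg (TensorProduct.map LinearMap.id (TensorProduct.map c c)) (hcoassoc x)
    rw [TensorProduct.map_map_assoc] at h
    simp only [TensorProduct.map_map] at h
    simp only [rightCoaction, LinearMap.comp_apply, TensorProduct.map_map, hc', ← hcβ',
      LinearMap.id_comp, LinearMap.comp_id] at h ⊢
    exact h
  · have h := congrArg (TensorProduct.map c (TensorProduct.map LinearMap.id c)) (hcoassoc x)
    rw [TensorProduct.map_map_assoc] at h
    simp only [TensorProduct.map_map] at h
    simp only [leftCoaction, rightCoaction, LinearMap.comp_apply, TensorProduct.map_map, ← hcβ',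
      LinearMap.comp_id] at h ⊢
    exact h
  · simp only [leftCoaction, LinearMap.comp_apply, hβ, TensorProduct.map_map, ← hcβ',
      LinearMap.id_comp, LinearMap.comp_id]
  · simp only [rightCoaction, LinearMap.comp_apply, hβ, TensorProduct.map_map, ← hcβ',
      LinearMap.id_comp, LinearMap.comp_id]

end Induced

lemma actL_eq (m : ℕ) : B.actL m = leftAction (B.mulPow m) (B.iterComul m) := rfl

lemma actR_eq (m : ℕ) : B.actR m = rightAction (B.mulPow m) (B.iterComul m) := rfl

lemma actLβ_eq (m : ℕ) : B.actLβ m = leftAction (B.mulPow m) (B.iterComul m ∘ₗ B.β) :=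
  TensorProduct.ext' fun a v => by simp [actLβ, actL_eq]

lemma actRβ_eq (m : ℕ) : B.actRβ m = rightAction (B.mulPow m) (B.iterComul m ∘ₗ B.β) :=
  TensorProduct.ext' fun a v => by simp [actRβ, actR_eq]

lemma coactL_eq (n : ℕ) : B.coactL n = leftCoaction (comulPow n B.comul) (B.iterMul n) := rfl

lemma coactR_eq (n : ℕ) : B.coactR n = rightCoaction (comulPow n B.comul) (B.iterMul n) := rfl

lemma coactLα_eq (n : ℕ) :
    B.coactLα n = leftCoaction (comulPow n B.comul) (B.α ∘ₗ B.iterMul n) := by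
  rw [coactLα, coactL_eq, leftCoaction, leftCoaction, ← LinearMap.comp_assoc,
    ← TensorProduct.map_comp, LinearMap.id_comp]

lemma coactRα_eq (n : ℕ) :
    B.coactRα n = rightCoaction (comulPow n B.comul) (B.α ∘ₗ B.iterMul n) := by
  rw [coactRα, coactR_eq, rightCoaction, rightCoaction, ← LinearMap.comp_assoc,
    ← TensorProduct.map_comp, LinearMap.id_comp]

/-- `A^{⊗ m}` is a Hom-bimodule along the iterated coproduct, a morphism of Hom-algebras. -/
lemma isBimodule_act (m : ℕ) :
    B.IsBimodule (B.actL (m + 1)) (B.actR (m + 1)) (powMap (m + 1) B.α) :=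
  B.isBimodule_of_hom B.mulPow_assoc (B.powMap_mulPow B.alpha_mul) B.iterComul_mul
    (B.powMap_iterComul B.comul_alpha_apply B.alpha_beta)

lemma isBimodule_actβ (m : ℕ) :
    B.IsBimodule (B.actLβ (m + 1)) (B.actRβ (m + 1)) (powMap (m + 1) B.α) := by
  rw [actLβ_eq, actRβ_eq]
  refine B.isBimodule_of_hom B.mulPow_assoc (B.powMap_mulPow B.alpha_mul) (fun a b => ?_)
    (fun a => ?_)
  · simp only [LinearMap.comp_apply, beta_mul_apply, iterComul_mul]
  · simp only [LinearMap.comp_apply, B.powMap_iterComul B.comul_alpha_apply B.alpha_beta,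
      alpha_beta]

/-- `A^{⊗ n}` is a Hom-bicomodule along the iterated product, a morphism of Hom-coalgebras. -/
lemma isBicomodule_coact (n : ℕ) :
    B.IsBicomodule (B.coactL (n + 1)) (B.coactR (n + 1)) (powMap (n + 1) B.β) :=
  B.isBicomodule_of_hom B.comulPow_coassoc (comulPow_powMap B.comul_beta) B.comul_iterMul
    (B.iterMul_powMap B.beta_mul_apply (fun a => (B.alpha_beta a).symm))

lemma isBicomodule_coactα (n : ℕ) :
    B.IsBicomodule (B.coactLα (n + 1)) (B.coactRα (n + 1)) (powMap (n + 1) B.β) := by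
  rw [coactLα_eq, coactRα_eq]
  refine B.isBicomodule_of_hom B.comulPow_coassoc (comulPow_powMap B.comul_beta) (fun x => ?_)
    (fun x => ?_)
  · rw [LinearMap.comp_apply, comul_alpha_apply, comul_iterMul, TensorProduct.map_map]
  · rw [LinearMap.comp_apply, LinearMap.comp_apply,
      B.iterMul_powMap B.beta_mul_apply (fun a => (B.alpha_beta a).symm), alpha_beta]

end HomBialgebra

/-! ### Outer cofaces in the two directions commute -/

namespace HomBialgebra

variable {R A : Type*} [CommRing R] [AddCommGroup A] [Module R A] (B : HomBialgebra R A)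
variable {M M' N N' P Q : Type*} [AddCommGroup M] [Module R M] [AddCommGroup M'] [Module R M']
  [AddCommGroup N] [Module R N] [AddCommGroup N'] [Module R N'] [AddCommGroup P] [Module R P]
  [AddCommGroup Q] [Module R Q]

/-- `s` identifies the coalgebra `N'` with `P ⊗ N`, the map `g : P → A` is a morphism of
coalgebras, and `c'(p ⊗ x) = g(p) c(x)`. -/
structure IsLeftSplitting (comulN : N →ₗ[R] N ⊗[R] N) (c : N →ₗ[R] A)
    (comulN' : N' →ₗ[R] N' ⊗[R] N') (c' : N' →ₗ[R] A) (comulP : P →ₗ[R] P ⊗[R] P) (g : P →ₗ[R] A)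
    (s : P ⊗[R] N ≃ₗ[R] N') : Prop where
  comul_split : ∀ p x, comulN' (s (p ⊗ₜ x)) = TensorProduct.map s.toLinearMap s.toLinearMap
    (TensorProduct.tensorTensorTensorComm R _ _ _ _ (comulP p ⊗ₜ comulN x))
  map_split : ∀ p x, c' (s (p ⊗ₜ x)) = B.mul (g p ⊗ₜ c x)
  comul_map : ∀ p, B.comul (g p) = TensorProduct.map g g (comulP p)

/-- `s` identifies the coalgebra `N'` with `N ⊗ P`, the map `g : P → A` is a morphism of
coalgebras, and `c'(x ⊗ p) = c(x) g(p)`. -/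
structure IsRightSplitting (comulN : N →ₗ[R] N ⊗[R] N) (c : N →ₗ[R] A)
    (comulN' : N' →ₗ[R] N' ⊗[R] N') (c' : N' →ₗ[R] A) (comulP : P →ₗ[R] P ⊗[R] P) (g : P →ₗ[R] A)
    (s : N ⊗[R] P ≃ₗ[R] N') : Prop where
  comul_split : ∀ p x, comulN' (s (x ⊗ₜ p)) = TensorProduct.map s.toLinearMap s.toLinearMap
    (TensorProduct.tensorTensorTensorComm R _ _ _ _ (comulN x ⊗ₜ comulP p))
  map_split : ∀ p x, c' (s (x ⊗ₜ p)) = B.mul (c x ⊗ₜ g p)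
  comul_map : ∀ p, B.comul (g p) = TensorProduct.map g g (comulP p)

/-- `t` identifies the algebra `M'` with `Q ⊗ M`, the map `h : A → Q` is a morphism of algebras,
and `u'(a) = h(a⁽¹⁾) ⊗ u(a⁽²⁾)`. -/
structure IsLeftJoining (mulM : M →ₗ[R] M →ₗ[R] M) (u : A →ₗ[R] M) (mulM' : M' →ₗ[R] M' →ₗ[R] M')
    (u' : A →ₗ[R] M') (mulQ : Q ⊗[R] Q →ₗ[R] Q) (h : A →ₗ[R] Q) (t : Q ⊗[R] M ≃ₗ[R] M') :
    Prop where
  mul_join : ∀ p q v w, mulM' (t (p ⊗ₜ v)) (t (q ⊗ₜ w)) = t (mulQ (p ⊗ₜ q) ⊗ₜ mulM v w)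
  map_join : ∀ a, u' a = t (TensorProduct.map h u (B.comul a))
  map_mul : ∀ a b, h (B.mul (a ⊗ₜ b)) = mulQ (h a ⊗ₜ h b)

/-- `t` identifies the algebra `M'` with `M ⊗ Q`, the map `h : A → Q` is a morphism of algebras,
and `u'(a) = u(a⁽¹⁾) ⊗ h(a⁽²⁾)`. -/
structure IsRightJoining (mulM : M →ₗ[R] M →ₗ[R] M) (u : A →ₗ[R] M) (mulM' : M' →ₗ[R] M' →ₗ[R] M')
    (u' : A →ₗ[R] M') (mulQ : Q ⊗[R] Q →ₗ[R] Q) (h : A →ₗ[R] Q) (t : M ⊗[R] Q ≃ₗ[R] M') :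
    Prop where
  mul_join : ∀ p q v w, mulM' (t (v ⊗ₜ p)) (t (w ⊗ₜ q)) = t (mulM v w ⊗ₜ mulQ (p ⊗ₜ q))
  map_join : ∀ a, u' a = t (TensorProduct.map u h (B.comul a))
  map_mul : ∀ a b, h (B.mul (a ⊗ₜ b)) = mulQ (h a ⊗ₜ h b)

variable {B} {comulN : N →ₗ[R] N ⊗[R] N} {c : N →ₗ[R] A} {comulN' : N' →ₗ[R] N' ⊗[R] N'}
  {c' : N' →ₗ[R] A} {comulP : P →ₗ[R] P ⊗[R] P} {g : P →ₗ[R] A}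
  {mulM : M →ₗ[R] M →ₗ[R] M} {u : A →ₗ[R] M} {mulM' : M' →ₗ[R] M' →ₗ[R] M'}
  {u' : A →ₗ[R] M'} {mulQ : Q ⊗[R] Q →ₗ[R] Q} {h : A →ₗ[R] Q}

/-- Both sides send `p ⊗ x` to the join of `h(g(p⁽¹⁾) c(x⁽¹⁾))` and `u(g(p⁽²⁾)) φ(x⁽²⁾)`, since `h` is
multiplicative and `g` is comultiplicative. The other three corners are similar. -/
lemma coleftOp_leftOp {s : P ⊗[R] N ≃ₗ[R] N'} {t : Q ⊗[R] M ≃ₗ[R] M'}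
    (hs : B.IsLeftSplitting comulN c comulN' c' comulP g s)
    (ht : B.IsLeftJoining mulM u mulM' u' mulQ h t) (φ : N →ₗ[R] M) :
    coleftOp (leftCoaction comulN' c') h t (leftOp (leftAction mulM u) g s φ) =
      leftOp (leftAction mulM' u') g s (coleftOp (leftCoaction comulN c) h t φ) := by
  refine LinearMap.ext fun x => ?_
  obtain ⟨z, rfl⟩ := s.surjective x
  induction z with
  | zero => simp only [map_zero]
  | add z w hz hw => simp only [map_add, hz, hw]
  | tmul p x =>
    rw [leftOp_apply, leftAction_tmul, ht.map_join, hs.comul_map, coleftOp_apply, coleftOp_apply,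
      leftCoaction, leftCoaction, LinearMap.comp_apply, LinearMap.comp_apply, hs.comul_split]
    generalize comulP p = X
    generalize comulN x = Y
    induction X with
    | zero => simp
    | add X X' hX hX' => simp only [TensorProduct.add_tmul, map_add, LinearMap.add_apply, hX, hX']
    | tmul p p' =>
      induction Y with
      | zero => simp
      | add Y Y' hY hY' => simp only [TensorProduct.tmul_add, map_add, hY, hY']
      | tmul x x' => simp [hs.map_split, ht.mul_join, ht.map_mul]

lemma corightOp_leftOp {s : P ⊗[R] N ≃ₗ[R] N'} {t : M ⊗[R] Q ≃ₗ[R] M'}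
    (hs : B.IsLeftSplitting comulN c comulN' c' comulP g s)
    (ht : B.IsRightJoining mulM u mulM' u' mulQ h t) (φ : N →ₗ[R] M) :
    corightOp (rightCoaction comulN' c') h t (leftOp (leftAction mulM u) g s φ) =
      leftOp (leftAction mulM' u') g s (corightOp (rightCoaction comulN c) h t φ) := by
  refine LinearMap.ext fun x => ?_
  obtain ⟨z, rfl⟩ := s.surjective x
  induction z with
  | zero => simp only [map_zero]
  | add z w hz hw => simp only [map_add, hz, hw]
  | tmul p x =>
    rw [leftOp_apply, leftAction_tmul, ht.map_join, hs.comul_map, corightOp_apply, corightOp_apply,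
      rightCoaction, rightCoaction, LinearMap.comp_apply, LinearMap.comp_apply, hs.comul_split]
    generalize comulP p = X
    generalize comulN x = Y
    induction X with
    | zero => simp
    | add X X' hX hX' => simp only [TensorProduct.add_tmul, map_add, LinearMap.add_apply, hX, hX']
    | tmul p p' =>
      induction Y with
      | zero => simp
      | add Y Y' hY hY' => simp only [TensorProduct.tmul_add, map_add, hY, hY']
      | tmul x x' => simp [hs.map_split, ht.mul_join, ht.map_mul]

lemma coleftOp_rightOp {s : N ⊗[R] P ≃ₗ[R] N'} {t : Q ⊗[R] M ≃ₗ[R] M'}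
    (hs : B.IsRightSplitting comulN c comulN' c' comulP g s)
    (ht : B.IsLeftJoining mulM u mulM' u' mulQ h t) (φ : N →ₗ[R] M) :
    coleftOp (leftCoaction comulN' c') h t (rightOp (rightAction mulM u) g s φ) =
      rightOp (rightAction mulM' u') g s (coleftOp (leftCoaction comulN c) h t φ) := by
  refine LinearMap.ext fun x => ?_
  obtain ⟨z, rfl⟩ := s.surjective x
  induction z with
  | zero => simp only [map_zero]
  | add z w hz hw => simp only [map_add, hz, hw]
  | tmul x p =>
    rw [rightOp_apply, rightAction_tmul, ht.map_join, hs.comul_map, coleftOp_apply, coleftOp_apply,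
      leftCoaction, leftCoaction, LinearMap.comp_apply, LinearMap.comp_apply, hs.comul_split]
    generalize comulP p = X
    generalize comulN x = Y
    induction X with
    | zero => simp
    | add X X' hX hX' => simp only [TensorProduct.tmul_add, map_add, hX, hX']
    | tmul p p' =>
      induction Y with
      | zero => simp
      | add Y Y' hY hY' => simp only [TensorProduct.add_tmul, map_add, LinearMap.add_apply, hY, hY']
      | tmul x x' => simp [hs.map_split, ht.mul_join, ht.map_mul]

lemma corightOp_rightOp {s : N ⊗[R] P ≃ₗ[R] N'} {t : M ⊗[R] Q ≃ₗ[R] M'}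
    (hs : B.IsRightSplitting comulN c comulN' c' comulP g s)
    (ht : B.IsRightJoining mulM u mulM' u' mulQ h t) (φ : N →ₗ[R] M) :
    corightOp (rightCoaction comulN' c') h t (rightOp (rightAction mulM u) g s φ) =
      rightOp (rightAction mulM' u') g s (corightOp (rightCoaction comulN c) h t φ) := by
  refine LinearMap.ext fun x => ?_
  obtain ⟨z, rfl⟩ := s.surjective x
  induction z with
  | zero => simp only [map_zero]
  | add z w hz hw => simp only [map_add, hz, hw]
  | tmul x p =>
    rw [rightOp_apply, rightAction_tmul, ht.map_join, hs.comul_map, corightOp_apply,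
      corightOp_apply, rightCoaction, rightCoaction, LinearMap.comp_apply, LinearMap.comp_apply,
      hs.comul_split]
    generalize comulP p = X
    generalize comulN x = Y
    induction X with
    | zero => simp
    | add X X' hX hX' => simp only [TensorProduct.tmul_add, map_add, hX, hX']
    | tmul p p' =>
      induction Y with
      | zero => simp
      | add Y Y' hY hY' => simp only [TensorProduct.add_tmul, map_add, LinearMap.add_apply, hY, hY']
      | tmul x x' => simp [hs.map_split, ht.mul_join, ht.map_mul]

/-! ### Outer cofaces commute with inner ones -/

lemma comp_leftOp {s : P ⊗[R] N ≃ₗ[R] N'} {E : M →ₗ[R] M'}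
    (hE : ∀ v w, E (mulM v w) = mulM' (E v) (E w)) (hu : ∀ a, E (u a) = u' a) (φ : N →ₗ[R] M) :
    E ∘ₗ leftOp (leftAction mulM u) g s φ = leftOp (leftAction mulM' u') g s (E ∘ₗ φ) := by
  refine LinearMap.ext fun x => ?_
  obtain ⟨z, rfl⟩ := s.surjective x
  induction z with
  | zero => simp only [map_zero]
  | add z w hz hw => simp only [map_add, hz, hw]
  | tmul p x => simp [hE, hu]

lemma comp_rightOp {s : N ⊗[R] P ≃ₗ[R] N'} {E : M →ₗ[R] M'}
    (hE : ∀ v w, E (mulM v w) = mulM' (E v) (E w)) (hu : ∀ a, E (u a) = u' a) (φ : N →ₗ[R] M) :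
    E ∘ₗ rightOp (rightAction mulM u) g s φ = rightOp (rightAction mulM' u') g s (E ∘ₗ φ) := by
  refine LinearMap.ext fun x => ?_
  obtain ⟨z, rfl⟩ := s.surjective x
  induction z with
  | zero => simp only [map_zero]
  | add z w hz hw => simp only [map_add, hz, hw]
  | tmul p x => simp [hE, hu]

lemma coleftOp_comp {t : Q ⊗[R] M ≃ₗ[R] M'} {D : N' →ₗ[R] N}
    (hD : ∀ x, comulN (D x) = TensorProduct.map D D (comulN' x)) (hc : ∀ x, c (D x) = c' x)
    (φ : N →ₗ[R] M) :
    coleftOp (leftCoaction comulN' c') h t (φ ∘ₗ D) =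
      coleftOp (leftCoaction comulN c) h t φ ∘ₗ D := by
  obtain rfl : c ∘ₗ D = c' := LinearMap.ext hc
  refine LinearMap.ext fun x => ?_
  simp only [coleftOp_apply, leftCoaction, LinearMap.comp_apply, hD, TensorProduct.map_map,
    LinearMap.comp_id, LinearMap.id_comp]

lemma corightOp_comp {t : M ⊗[R] Q ≃ₗ[R] M'} {D : N' →ₗ[R] N}
    (hD : ∀ x, comulN (D x) = TensorProduct.map D D (comulN' x)) (hc : ∀ x, c (D x) = c' x)
    (φ : N →ₗ[R] M) :
    corightOp (rightCoaction comulN' c') h t (φ ∘ₗ D) =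
      corightOp (rightCoaction comulN c) h t φ ∘ₗ D := by
  obtain rfl : c ∘ₗ D = c' := LinearMap.ext hc
  refine LinearMap.ext fun x => ?_
  simp only [corightOp_apply, rightCoaction, LinearMap.comp_apply, hD, TensorProduct.map_map,
    LinearMap.comp_id, LinearMap.id_comp]

end HomBialgebra

/-! ### Splittings and joinings of tensor powers -/

namespace HomBialgebra

variable {R A : Type*} [CommRing R] [AddCommGroup A] [Module R A] (B : HomBialgebra R A)

/-- The maps `c` and `c'` on consecutive tensor powers are compatible with all cofaces of the
Hochschild-type differential with exponent `e`. -/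
structure IsHochStep (e n : ℕ) (c : (⨂[R]^n A) →ₗ[R] A) (c' : (⨂[R]^(n + 1) A) →ₗ[R] A) :
    Prop where
  left : B.IsLeftSplitting (comulPow n B.comul) c (comulPow (n + 1) B.comul) c' B.comul (B.α ^ e)
    (consEquiv R A n)
  right : B.IsRightSplitting (comulPow n B.comul) c (comulPow (n + 1) B.comul) c' B.comul
    (B.α ^ e) (snocEquiv R A n)
  inner : ∀ i x, c (B.mulAt n i x) = c' x

/-- The maps `u` and `u'` to consecutive tensor powers are compatible with all cofaces of the
Cartier-type differential with exponent `e`. -/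
structure IsCoHochStep (e m : ℕ) (u : A →ₗ[R] (⨂[R]^m A)) (u' : A →ₗ[R] (⨂[R]^(m + 1) A)) :
    Prop where
  left : B.IsLeftJoining (B.mulPow m) u (B.mulPow (m + 1)) u' B.mul (B.β ^ e) (consEquiv R A m)
  right : B.IsRightJoining (B.mulPow m) u (B.mulPow (m + 1)) u' B.mul (B.β ^ e) (snocEquiv R A m)
  inner : ∀ i a, B.comulAt m i (u a) = u' a

lemma isHochStep_iterMul (n : ℕ) : B.IsHochStep n (n + 1) (B.iterMul (n + 1)) (B.iterMul (n + 2)) :=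
  ⟨⟨comulPow_cons B.comul, B.iterMul_cons, B.comul_alpha_pow n⟩,
    ⟨comulPow_snoc B.comul, B.iterMul_snoc, B.comul_alpha_pow n⟩, B.iterMul_mulAt⟩

lemma isHochStep_alpha_iterMul (n : ℕ) :
    B.IsHochStep (n + 1) (n + 1) (B.α ∘ₗ B.iterMul (n + 1)) (B.α ∘ₗ B.iterMul (n + 2)) := by
  refine ⟨⟨comulPow_cons B.comul, fun a x => ?_, B.comul_alpha_pow (n + 1)⟩,
    ⟨comulPow_snoc B.comul, fun a x => ?_, B.comul_alpha_pow (n + 1)⟩, fun i x => ?_⟩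
  · simp only [LinearMap.comp_apply, HomAssocAlgebra.iterMul_cons, HomAssocAlgebra.alpha_mul,
      HomAssocAlgebra.alpha_pow_succ]
  · simp only [LinearMap.comp_apply, HomAssocAlgebra.iterMul_snoc, HomAssocAlgebra.alpha_mul,
      HomAssocAlgebra.alpha_pow_succ]
  · simp only [LinearMap.comp_apply, HomAssocAlgebra.iterMul_mulAt]

lemma isCoHochStep_iterComul (m : ℕ) :
    B.IsCoHochStep m (m + 1) (B.iterComul (m + 1)) (B.iterComul (m + 2)) :=
  ⟨⟨B.mulPow_cons, B.iterComul_eq_cons, B.beta_pow_mul m⟩,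
    ⟨B.mulPow_snoc, B.iterComul_eq_snoc, B.beta_pow_mul m⟩, B.comulAt_iterComul⟩

lemma isCoHochStep_iterComul_beta (m : ℕ) :
    B.IsCoHochStep (m + 1) (m + 1) (B.iterComul (m + 1) ∘ₗ B.β) (B.iterComul (m + 2) ∘ₗ B.β) := by
  have e : B.β ^ (m + 1) = (B.β ^ m) ∘ₗ B.β := pow_succ _ _
  refine ⟨⟨B.mulPow_cons, fun a => ?_, B.beta_pow_mul (m + 1)⟩,
    ⟨B.mulPow_snoc, fun a => ?_, B.beta_pow_mul (m + 1)⟩, fun i x => ?_⟩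
  · rw [LinearMap.comp_apply, HomCoassocCoalgebra.iterComul_eq_cons,
      HomCoassocCoalgebra.comul_beta, TensorProduct.map_map, e]
    rfl
  · rw [LinearMap.comp_apply, HomCoassocCoalgebra.iterComul_eq_snoc,
      HomCoassocCoalgebra.comul_beta, TensorProduct.map_map, e]
    rfl
  · simp only [LinearMap.comp_apply, HomCoassocCoalgebra.comulAt_iterComul]

/-- The comultiplication of `A ⊗ A`. -/
noncomputable def comulTwo : A ⊗[R] A →ₗ[R] (A ⊗[R] A) ⊗[R] (A ⊗[R] A) :=
  (TensorProduct.tensorTensorTensorComm R A A A A).toLinearMap ∘ₗ TensorProduct.map B.comul B.comul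

/-- The multiplication of `A ⊗ A`. -/
noncomputable def mulTwo : (A ⊗[R] A) ⊗[R] (A ⊗[R] A) →ₗ[R] A ⊗[R] A :=
  TensorProduct.map B.mul B.mul ∘ₗ (TensorProduct.tensorTensorTensorComm R A A A A).toLinearMap

lemma comulPow_consTwo {n : ℕ} (t : A ⊗[R] A) (x : ⨂[R]^n A) :
    comulPow (n + 2) B.comul (consTwoEquiv R A n (t ⊗ₜ x)) =
      TensorProduct.map (consTwoEquiv R A n).toLinearMap (consTwoEquiv R A n).toLinearMap
        (TensorProduct.tensorTensorTensorComm R _ _ _ _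
          (B.comulTwo t ⊗ₜ comulPow n B.comul x)) := by
  induction t with
  | zero => simp
  | add t s ht hs => simp only [TensorProduct.add_tmul, map_add, ht, hs]
  | tmul a b =>
    rw [consTwoEquiv_tmul, comulPow_cons, comulPow_cons, comulTwo, LinearMap.comp_apply,
      TensorProduct.map_tmul]
    generalize B.comul a = X
    generalize B.comul b = Y
    generalize comulPow n B.comul x = Z
    induction X with
    | zero => simp
    | add t s ht hs => simp only [TensorProduct.add_tmul, map_add, ht, hs]
    | tmul a a' =>
      induction Y with
      | zero => simp
      | add t s ht hs =>
        simp only [TensorProduct.add_tmul, TensorProduct.tmul_add, map_add, ht, hs]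
      | tmul b b' =>
        induction Z with
        | zero => simp
        | add t s ht hs => simp only [TensorProduct.tmul_add, map_add, ht, hs]
        | tmul x x' => simp

lemma comulPow_snocTwo {n : ℕ} (t : A ⊗[R] A) (x : ⨂[R]^n A) :
    comulPow (n + 2) B.comul (snocTwoEquiv R A n (x ⊗ₜ t)) =
      TensorProduct.map (snocTwoEquiv R A n).toLinearMap (snocTwoEquiv R A n).toLinearMap
        (TensorProduct.tensorTensorTensorComm R _ _ _ _
          (comulPow n B.comul x ⊗ₜ B.comulTwo t)) := by
  induction t with
  | zero => simp
  | add t s ht hs => simp only [TensorProduct.tmul_add, map_add, ht, hs]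
  | tmul a b =>
    rw [snocTwoEquiv_tmul, comulPow_snoc, comulPow_snoc, comulTwo, LinearMap.comp_apply,
      TensorProduct.map_tmul]
    generalize B.comul a = X
    generalize B.comul b = Y
    generalize comulPow n B.comul x = Z
    induction X with
    | zero => simp
    | add t s ht hs =>
      simp only [TensorProduct.add_tmul, TensorProduct.tmul_add, map_add, ht, hs]
    | tmul a a' =>
      induction Y with
      | zero => simp
      | add t s ht hs => simp only [TensorProduct.tmul_add, map_add, ht, hs]
      | tmul b b' =>
        induction Z with
        | zero => simp
        | add t s ht hs => simp only [TensorProduct.add_tmul, map_add, ht, hs]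
        | tmul x x' => simp

lemma comul_alpha_pow_mul (e : ℕ) (t : A ⊗[R] A) :
    B.comul (((B.α ^ e) ∘ₗ B.mul) t) =
      TensorProduct.map ((B.α ^ e) ∘ₗ B.mul) ((B.α ^ e) ∘ₗ B.mul) (B.comulTwo t) := by
  rw [LinearMap.comp_apply, comul_alpha_pow, TensorProduct.map_comp, LinearMap.comp_apply]
  exact congrArg _ (LinearMap.congr_fun B.comul_mul t)

lemma comul_beta_pow_mul (e : ℕ) (a b : A) :
    (B.comul ∘ₗ (B.β ^ e)) (B.mul (a ⊗ₜ b)) =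
      B.mulTwo ((B.comul ∘ₗ (B.β ^ e)) a ⊗ₜ (B.comul ∘ₗ (B.β ^ e)) b) := by
  simp only [LinearMap.comp_apply, beta_pow_mul, comul_mul_apply, mulTwo, LinearEquiv.coe_coe]

/-- The operator `∂_{αμ}` shifts the number of arguments by two, and splitting two factors off an
iterated product leaves the `α`-twisted one: by Hom-associativity,
`α^{n+1}(a) (α^n(b) c(x)) = α^n(ab) α(c(x))`. This is why `ψ` and `ξ` carry `α`-twisted coactions. -/
lemma isLeftSplitting_consTwo (n : ℕ) :
    B.IsLeftSplitting (comulPow (n + 1) B.comul) (B.α ∘ₗ B.iterMul (n + 1))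
      (comulPow (n + 3) B.comul) (B.iterMul (n + 3)) B.comulTwo ((B.α ^ n) ∘ₗ B.mul)
      (consTwoEquiv R A (n + 1)) := by
  refine ⟨B.comulPow_consTwo, fun t x => ?_, B.comul_alpha_pow_mul n⟩
  induction t with
  | zero => simp
  | add t s ht hs => simp only [TensorProduct.add_tmul, map_add, ht, hs]
  | tmul a b =>
    rw [consTwoEquiv_tmul, HomAssocAlgebra.iterMul_cons, HomAssocAlgebra.iterMul_cons,
      HomAssocAlgebra.alpha_pow_succ, ← HomAssocAlgebra.hom_assoc_apply,
      ← HomAssocAlgebra.alpha_pow_mul]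
    rfl

lemma isRightSplitting_snocTwo (n : ℕ) :
    B.IsRightSplitting (comulPow (n + 1) B.comul) (B.α ∘ₗ B.iterMul (n + 1))
      (comulPow (n + 3) B.comul) (B.iterMul (n + 3)) B.comulTwo ((B.α ^ n) ∘ₗ B.mul)
      (snocTwoEquiv R A (n + 1)) := by
  refine ⟨B.comulPow_snocTwo, fun t x => ?_, B.comul_alpha_pow_mul n⟩
  induction t with
  | zero => simp
  | add t s ht hs => simp only [TensorProduct.tmul_add, map_add, ht, hs]
  | tmul a b =>
    rw [snocTwoEquiv_tmul, HomAssocAlgebra.iterMul_snoc, HomAssocAlgebra.iterMul_snoc,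
      HomAssocAlgebra.alpha_pow_succ, HomAssocAlgebra.hom_assoc_apply,
      ← HomAssocAlgebra.alpha_pow_mul]
    rfl

/-- Dually, the operator `∂_{βΔ}` turns the `β`-twisted iterated coproduct into one with two more
factors. This is why `χ` and `ξ` carry `β`-twisted actions. -/
lemma isLeftJoining_consTwo (m : ℕ) :
    B.IsLeftJoining (B.mulPow (m + 1)) (B.iterComul (m + 1) ∘ₗ B.β) (B.mulPow (m + 3))
      (B.iterComul (m + 3)) B.mulTwo (B.comul ∘ₗ (B.β ^ m)) (consTwoEquiv R A (m + 1)) := by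
  refine ⟨B.mulPow_consTwo, fun a => ?_, B.comul_beta_pow_mul m⟩
  have h : TensorProduct.map (B.β ^ (m + 1)) (B.iterComul (m + 2)) (B.comul a) =
      TensorProduct.map (B.β ^ m) ((consEquiv R A (m + 1)).toLinearMap ∘ₗ
        TensorProduct.map (B.β ^ m) (B.iterComul (m + 1)))
        (TensorProduct.map B.β B.comul (B.comul a)) := by
    rw [TensorProduct.map_map, pow_succ, Module.End.mul_eq_comp]
    congr 2
    exact LinearMap.ext fun b => B.iterComul_eq_cons b
  rw [HomCoassocCoalgebra.iterComul_eq_cons, h, ← HomCoassocCoalgebra.hom_coassoc_apply]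
  generalize B.comul a = w
  induction w with
  | zero => simp
  | add t s ht hs => simp only [map_add, ht, hs]
  | tmul b c =>
    simp only [TensorProduct.map_tmul, LinearMap.comp_apply, HomCoassocCoalgebra.comul_beta_pow]
    generalize B.comul b = t
    induction t with
    | zero => simp
    | add t s ht hs => simp only [TensorProduct.add_tmul, map_add, ht, hs]
    | tmul a b => simp

lemma isRightJoining_snocTwo (m : ℕ) :
    B.IsRightJoining (B.mulPow (m + 1)) (B.iterComul (m + 1) ∘ₗ B.β) (B.mulPow (m + 3))
      (B.iterComul (m + 3)) B.mulTwo (B.comul ∘ₗ (B.β ^ m)) (snocTwoEquiv R A (m + 1)) := by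
  refine ⟨fun s t x y => B.mulPow_snocTwo s t x y, fun a => ?_, B.comul_beta_pow_mul m⟩
  have h : TensorProduct.map (B.iterComul (m + 2)) (B.β ^ (m + 1)) (B.comul a) =
      TensorProduct.map ((snocEquiv R A (m + 1)).toLinearMap ∘ₗ
        TensorProduct.map (B.iterComul (m + 1)) (B.β ^ m)) (B.β ^ m)
        (TensorProduct.map B.comul B.β (B.comul a)) := by
    rw [TensorProduct.map_map, pow_succ, Module.End.mul_eq_comp]
    congr 2
    exact LinearMap.ext fun b => B.iterComul_eq_snoc b
  rw [HomCoassocCoalgebra.iterComul_eq_snoc, h,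
    ← (TensorProduct.assoc R A A A).symm_apply_apply (TensorProduct.map B.comul B.β (B.comul a)),
    HomCoassocCoalgebra.hom_coassoc_apply]
  generalize B.comul a = w
  induction w with
  | zero => simp
  | add t s ht hs => simp only [map_add, ht, hs]
  | tmul b c =>
    simp only [TensorProduct.map_tmul, LinearMap.comp_apply, HomCoassocCoalgebra.comul_beta_pow]
    generalize B.comul c = t
    induction t with
    | zero => simp
    | add t s ht hs => simp only [TensorProduct.tmul_add, map_add, ht, hs]
    | tmul a b => simp

/-! ### The algebra and the coalgebra differential commute -/

section Commutation

variable {B}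

section Algebra

variable {M M' Q : Type*} [AddCommGroup M] [Module R M] [AddCommGroup M'] [Module R M']
  [AddCommGroup Q] [Module R Q] {mulM : M →ₗ[R] M →ₗ[R] M} {u : A →ₗ[R] M}
  {mulM' : M' →ₗ[R] M' →ₗ[R] M'} {u' : A →ₗ[R] M'} {mulQ : Q ⊗[R] Q →ₗ[R] Q} {h : A →ₗ[R] Q}

/-- A left outer coface in the coalgebra direction commutes with the Hochschild-type differential. -/
lemma coleftOp_dHoch {e n : ℕ} {c : (⨂[R]^n A) →ₗ[R] A} {c' : (⨂[R]^(n + 1) A) →ₗ[R] A}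
    {t : Q ⊗[R] M ≃ₗ[R] M'} (hs : B.IsHochStep e n c c')
    (ht : B.IsLeftJoining mulM u mulM' u' mulQ h t) (φ : (⨂[R]^n A) →ₗ[R] M) :
    coleftOp (leftCoaction (comulPow (n + 1) B.comul) c') h t
        (B.dHoch (leftAction mulM u) (rightAction mulM u) e n φ) =
      B.dHoch (leftAction mulM' u') (rightAction mulM' u') e n
        (coleftOp (leftCoaction (comulPow n B.comul) c) h t φ) := by
  simp only [HomAssocAlgebra.dHoch_eq, map_add, map_sum, map_smul, LinearMap.lcomp_apply',
    coleftOp_leftOp hs.left ht, coleftOp_rightOp hs.right ht,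
    coleftOp_comp (B.comulPow_mulAt _) (hs.inner _)]

lemma corightOp_dHoch {e n : ℕ} {c : (⨂[R]^n A) →ₗ[R] A} {c' : (⨂[R]^(n + 1) A) →ₗ[R] A}
    {t : M ⊗[R] Q ≃ₗ[R] M'} (hs : B.IsHochStep e n c c')
    (ht : B.IsRightJoining mulM u mulM' u' mulQ h t) (φ : (⨂[R]^n A) →ₗ[R] M) :
    corightOp (rightCoaction (comulPow (n + 1) B.comul) c') h t
        (B.dHoch (leftAction mulM u) (rightAction mulM u) e n φ) =
      B.dHoch (leftAction mulM' u') (rightAction mulM' u') e n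
        (corightOp (rightCoaction (comulPow n B.comul) c) h t φ) := by
  simp only [HomAssocAlgebra.dHoch_eq, map_add, map_sum, map_smul, LinearMap.lcomp_apply',
    corightOp_leftOp hs.left ht, corightOp_rightOp hs.right ht,
    corightOp_comp (B.comulPow_mulAt _) (hs.inner _)]

/-- Composition with a morphism of algebras over `A` commutes with the Hochschild-type
differential. -/
lemma comp_dHoch {e n : ℕ} {E : M →ₗ[R] M'} (hE : ∀ v w, E (mulM v w) = mulM' (E v) (E w))
    (hu : ∀ a, E (u a) = u' a) (φ : (⨂[R]^n A) →ₗ[R] M) :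
    E ∘ₗ B.dHoch (leftAction mulM u) (rightAction mulM u) e n φ =
      B.dHoch (leftAction mulM' u') (rightAction mulM' u') e n (E ∘ₗ φ) := by
  rw [HomAssocAlgebra.dHoch_eq, HomAssocAlgebra.dHoch_eq, ← comp_leftOp hE hu,
    ← comp_rightOp hE hu]
  refine LinearMap.ext fun x => ?_
  simp [map_sum, LinearMap.sum_apply]

lemma comp_dAlphaMu {n : ℕ} {E : M →ₗ[R] M'} (hE : ∀ v w, E (mulM v w) = mulM' (E v) (E w))
    (hu : ∀ a, E (u a) = u' a) (φ : (⨂[R]^n A) →ₗ[R] M) :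
    E ∘ₗ B.dAlphaMu (leftAction mulM u) (rightAction mulM u) n φ =
      B.dAlphaMu (leftAction mulM' u') (rightAction mulM' u') n (E ∘ₗ φ) := by
  rw [HomAssocAlgebra.dAlphaMu_eq, HomAssocAlgebra.dAlphaMu_eq, ← comp_leftOp hE hu,
    ← comp_rightOp hE hu, LinearMap.comp_sub]

lemma coleftOp_dAlphaMu {n : ℕ} {t : Q ⊗[R] M ≃ₗ[R] M'}
    (ht : B.IsLeftJoining mulM u mulM' u' mulQ h t) (φ : (⨂[R]^(n + 1) A) →ₗ[R] M) :
    coleftOp (B.coactL (n + 3)) h t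
        (B.dAlphaMu (leftAction mulM u) (rightAction mulM u) (n + 1) φ) =
      B.dAlphaMu (leftAction mulM' u') (rightAction mulM' u') (n + 1)
        (coleftOp (B.coactLα (n + 1)) h t φ) := by
  rw [coactLα_eq, coactL_eq, HomAssocAlgebra.dAlphaMu_eq, HomAssocAlgebra.dAlphaMu_eq, map_sub]
  exact congrArg₂ _ (coleftOp_leftOp (B.isLeftSplitting_consTwo n) ht φ)
    (coleftOp_rightOp (B.isRightSplitting_snocTwo n) ht φ)

lemma corightOp_dAlphaMu {n : ℕ} {t : M ⊗[R] Q ≃ₗ[R] M'}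
    (ht : B.IsRightJoining mulM u mulM' u' mulQ h t) (φ : (⨂[R]^(n + 1) A) →ₗ[R] M) :
    corightOp (B.coactR (n + 3)) h t
        (B.dAlphaMu (leftAction mulM u) (rightAction mulM u) (n + 1) φ) =
      B.dAlphaMu (leftAction mulM' u') (rightAction mulM' u') (n + 1)
        (corightOp (B.coactRα (n + 1)) h t φ) := by
  rw [coactRα_eq, coactR_eq, HomAssocAlgebra.dAlphaMu_eq, HomAssocAlgebra.dAlphaMu_eq, map_sub]
  exact congrArg₂ _ (corightOp_leftOp (B.isLeftSplitting_consTwo n) ht φ)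
    (corightOp_rightOp (B.isRightSplitting_snocTwo n) ht φ)

/-- Precomposition with `β` replaces the actions by the `β`-twisted ones. -/
lemma dHoch_comp_powMap_beta (e n : ℕ) (φ : (⨂[R]^n A) →ₗ[R] M) :
    B.dHoch (leftAction mulM u) (rightAction mulM u) e n φ ∘ₗ powMap (n + 1) B.β =
      B.dHoch (leftAction mulM (u ∘ₗ B.β)) (rightAction mulM (u ∘ₗ B.β)) e n
        (φ ∘ₗ powMap n B.β) := by
  rw [HomAssocAlgebra.dHoch_eq, HomAssocAlgebra.dHoch_eq]
  have h (ω : (⨂[R]^(n + 1) A) →ₗ[R] M) :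
      ω ∘ₗ powMap (n + 1) B.β = LinearMap.lcomp R M (powMap (n + 1) B.β) ω := rfl
  rw [h]
  simp only [map_add, map_sum, map_smul]
  refine congrArg₂ _ (congrArg₂ _ (hom_ext_cons fun a x => ?_)
    (Finset.sum_congr rfl fun i _ => congrArg _ ?_)) (congrArg _ (hom_ext_snoc fun x a => ?_))
  · simp [alpha_pow_beta]
  · refine LinearMap.ext fun x => ?_
    simp only [LinearMap.comp_apply, LinearMap.lcomp_apply,
      B.mulAt_powMap B.beta_mul_apply (fun a => (B.alpha_beta a).symm)]
  · simp [alpha_pow_beta]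

lemma dAlphaMu_comp_powMap_beta (n : ℕ) (φ : (⨂[R]^n A) →ₗ[R] M) :
    B.dAlphaMu (leftAction mulM u) (rightAction mulM u) n φ ∘ₗ powMap (n + 2) B.β =
      B.dAlphaMu (leftAction mulM (u ∘ₗ B.β)) (rightAction mulM (u ∘ₗ B.β)) n
        (φ ∘ₗ powMap n B.β) := by
  rw [HomAssocAlgebra.dAlphaMu_eq, HomAssocAlgebra.dAlphaMu_eq, LinearMap.sub_comp]
  refine congrArg₂ _ (hom_ext_cons_cons fun a b x => ?_) (hom_ext_snoc_snoc fun x a b => ?_)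
  · rw [← consTwoEquiv_tmul, LinearMap.comp_apply, powMap_consTwo, leftOp_apply, leftOp_apply]
    simp [alpha_pow_beta, ← beta_mul_apply]
  · rw [← snocTwoEquiv_tmul, LinearMap.comp_apply, powMap_snocTwo, rightOp_apply, rightOp_apply]
    simp [alpha_pow_beta, ← beta_mul_apply]

end Algebra

lemma dCoHoch_dHoch {e n f m : ℕ} {c : (⨂[R]^n A) →ₗ[R] A} {c' : (⨂[R]^(n + 1) A) →ₗ[R] A}
    {u : A →ₗ[R] (⨂[R]^m A)} {u' : A →ₗ[R] (⨂[R]^(m + 1) A)} (hs : B.IsHochStep e n c c')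
    (ht : B.IsCoHochStep f m u u') (φ : (⨂[R]^n A) →ₗ[R] (⨂[R]^m A)) :
    B.dCoHoch (leftCoaction (comulPow (n + 1) B.comul) c')
        (rightCoaction (comulPow (n + 1) B.comul) c') f m
        (B.dHoch (leftAction (B.mulPow m) u) (rightAction (B.mulPow m) u) e n φ) =
      B.dHoch (leftAction (B.mulPow (m + 1)) u') (rightAction (B.mulPow (m + 1)) u') e n
        (B.dCoHoch (leftCoaction (comulPow n B.comul) c) (rightCoaction (comulPow n B.comul) c)
          f m φ) := by
  simp only [HomCoassocCoalgebra.dCoHoch_eq, map_add, map_sum, map_smul,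
    LinearMap.compRight_apply, coleftOp_dHoch hs ht.left, corightOp_dHoch hs ht.right,
    comp_dHoch (B.comulAt_mulPow _) (ht.inner _)]

lemma dCoHoch_dAlphaMu {n f m : ℕ} {u : A →ₗ[R] (⨂[R]^m A)} {u' : A →ₗ[R] (⨂[R]^(m + 1) A)}
    (ht : B.IsCoHochStep f m u u') (φ : (⨂[R]^(n + 1) A) →ₗ[R] (⨂[R]^m A)) :
    B.dCoHoch (B.coactL (n + 1 + 2)) (B.coactR (n + 1 + 2)) f m
        (B.dAlphaMu (leftAction (B.mulPow m) u) (rightAction (B.mulPow m) u) (n + 1) φ) =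
      B.dAlphaMu (leftAction (B.mulPow (m + 1)) u') (rightAction (B.mulPow (m + 1)) u') (n + 1)
        (B.dCoHoch (B.coactLα (n + 1)) (B.coactRα (n + 1)) f m φ) := by
  simp only [HomCoassocCoalgebra.dCoHoch_eq, map_add, map_sum, map_smul,
    LinearMap.compRight_apply, coleftOp_dAlphaMu ht.left, corightOp_dAlphaMu ht.right,
    comp_dAlphaMu (B.comulAt_mulPow _) (ht.inner _)]

lemma dBetaDelta_dHoch {e n m : ℕ} {c : (⨂[R]^n A) →ₗ[R] A} {c' : (⨂[R]^(n + 1) A) →ₗ[R] A}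
    (hs : B.IsHochStep e n c c') (φ : (⨂[R]^n A) →ₗ[R] (⨂[R]^(m + 1) A)) :
    B.dBetaDelta (leftCoaction (comulPow (n + 1) B.comul) c')
        (rightCoaction (comulPow (n + 1) B.comul) c') (m + 1)
        (B.dHoch (B.actLβ (m + 1)) (B.actRβ (m + 1)) e n φ) =
      B.dHoch (B.actL (m + 1 + 2)) (B.actR (m + 1 + 2)) e n
        (B.dBetaDelta (leftCoaction (comulPow n B.comul) c) (rightCoaction (comulPow n B.comul) c)
          (m + 1) φ) := by
  rw [actLβ_eq, actRβ_eq, actL_eq, actR_eq, HomCoassocCoalgebra.dBetaDelta_eq,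
    HomCoassocCoalgebra.dBetaDelta_eq, map_sub]
  exact congrArg₂ _ (coleftOp_dHoch hs (B.isLeftJoining_consTwo m) φ)
    (corightOp_dHoch hs (B.isRightJoining_snocTwo m) φ)

lemma dBetaDelta_dAlphaMu {n m : ℕ} (φ : (⨂[R]^(n + 1) A) →ₗ[R] (⨂[R]^(m + 1) A)) :
    B.dBetaDelta (B.coactL (n + 1 + 2)) (B.coactR (n + 1 + 2)) (m + 1)
        (B.dAlphaMu (B.actLβ (m + 1)) (B.actRβ (m + 1)) (n + 1) φ) =
      B.dAlphaMu (B.actL (m + 1 + 2)) (B.actR (m + 1 + 2)) (n + 1)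
        (B.dBetaDelta (B.coactLα (n + 1)) (B.coactRα (n + 1)) (m + 1) φ) := by
  rw [actLβ_eq, actRβ_eq, actL_eq, actR_eq, HomCoassocCoalgebra.dBetaDelta_eq,
    HomCoassocCoalgebra.dBetaDelta_eq, map_sub]
  exact congrArg₂ _ (coleftOp_dAlphaMu (B.isLeftJoining_consTwo m) φ)
    (corightOp_dAlphaMu (B.isRightJoining_snocTwo m) φ)

lemma powMap_beta_iterComul (m : ℕ) (a : A) :
    powMap m B.β (B.iterComul m a) = (B.iterComul m ∘ₗ B.β) a :=
  B.powMap_iterComul B.comul_beta (fun _ => rfl) a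

lemma dDeltaBeta_dHoch (e n m : ℕ) (φ : (⨂[R]^n A) →ₗ[R] (⨂[R]^m A)) :
    B.dDeltaBeta (powMap (n + 1) B.β) m (B.dHoch (B.actL m) (B.actR m) e n φ) =
      B.dHoch (B.actLβ m) (B.actRβ m) e n (B.dDeltaBeta (powMap n B.β) m φ) := by
  rw [HomCoassocCoalgebra.dDeltaBeta_eq, HomCoassocCoalgebra.dDeltaBeta_eq, map_sub, actL_eq,
    actR_eq, actLβ_eq, actRβ_eq, dHoch_comp_powMap_beta,
    comp_dHoch (B.powMap_mulPow B.beta_mul_apply) (powMap_beta_iterComul m)]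

lemma dDeltaBeta_dAlphaMu (n m : ℕ) (φ : (⨂[R]^n A) →ₗ[R] (⨂[R]^m A)) :
    B.dDeltaBeta (powMap (n + 2) B.β) m (B.dAlphaMu (B.actL m) (B.actR m) n φ) =
      B.dAlphaMu (B.actLβ m) (B.actRβ m) n (B.dDeltaBeta (powMap n B.β) m φ) := by
  rw [HomCoassocCoalgebra.dDeltaBeta_eq, HomCoassocCoalgebra.dDeltaBeta_eq, map_sub, actL_eq,
    actR_eq, actLβ_eq, actRβ_eq, dAlphaMu_comp_powMap_beta,
    comp_dAlphaMu (B.powMap_mulPow B.beta_mul_apply) (powMap_beta_iterComul m)]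

lemma dMuAlpha_eq (n m : ℕ) (φ : (⨂[R]^n A) →ₗ[R] (⨂[R]^m A)) :
    B.dMuAlpha (powMap m B.α) n φ = powMap m B.α ∘ₗ φ - φ ∘ₗ powMap n B.α := rfl

lemma coleftOp_dMuAlpha {n m m' : ℕ} {P : Type*} [AddCommGroup P] [Module R P] {h : A →ₗ[R] P}
    {t : P ⊗[R] (⨂[R]^m A) ≃ₗ[R] (⨂[R]^m' A)} (f : P →ₗ[R] P) (hf : ∀ a, h (B.α a) = f (h a))
    (ht : ∀ p y, powMap m' B.α (t (p ⊗ₜ y)) = t (f p ⊗ₜ powMap m B.α y))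
    (φ : (⨂[R]^n A) →ₗ[R] (⨂[R]^m A)) :
    coleftOp (B.coactLα n) h t (B.dMuAlpha (powMap m B.α) n φ) =
      B.dMuAlpha (powMap m' B.α) n (coleftOp (B.coactL n) h t φ) := by
  rw [dMuAlpha_eq, dMuAlpha_eq, map_sub]
  refine congrArg₂ _ (LinearMap.ext fun x => ?_) ?_
  · rw [LinearMap.comp_apply, coleftOp_apply, coleftOp_apply, coactLα, LinearMap.comp_apply]
    generalize B.coactL n x = w
    induction w with
    | zero => simp
    | add t s ht hs => simp only [map_add, ht, hs]
    | tmul a y => simp [ht, hf]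
  · rw [coactLα_eq, coactL_eq]
    exact coleftOp_comp (comulPow_powMap B.comul_alpha_apply)
      (B.iterMul_powMap B.alpha_mul (fun _ => rfl)) φ

lemma corightOp_dMuAlpha {n m m' : ℕ} {P : Type*} [AddCommGroup P] [Module R P] {h : A →ₗ[R] P}
    {t : (⨂[R]^m A) ⊗[R] P ≃ₗ[R] (⨂[R]^m' A)} (f : P →ₗ[R] P) (hf : ∀ a, h (B.α a) = f (h a))
    (ht : ∀ p y, powMap m' B.α (t (y ⊗ₜ p)) = t (powMap m B.α y ⊗ₜ f p))
    (φ : (⨂[R]^n A) →ₗ[R] (⨂[R]^m A)) :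
    corightOp (B.coactRα n) h t (B.dMuAlpha (powMap m B.α) n φ) =
      B.dMuAlpha (powMap m' B.α) n (corightOp (B.coactR n) h t φ) := by
  rw [dMuAlpha_eq, dMuAlpha_eq, map_sub]
  refine congrArg₂ _ (LinearMap.ext fun x => ?_) ?_
  · rw [LinearMap.comp_apply, corightOp_apply, corightOp_apply, coactRα, LinearMap.comp_apply]
    generalize B.coactR n x = w
    induction w with
    | zero => simp
    | add t s ht hs => simp only [map_add, ht, hs]
    | tmul a y => simp [ht, hf]
  · rw [coactRα_eq, coactR_eq]
    exact corightOp_comp (comulPow_powMap B.comul_alpha_apply)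
      (B.iterMul_powMap B.alpha_mul (fun _ => rfl)) φ

lemma dCoHoch_dMuAlpha (e n m : ℕ) (φ : (⨂[R]^n A) →ₗ[R] (⨂[R]^m A)) :
    B.dCoHoch (B.coactLα n) (B.coactRα n) e m (B.dMuAlpha (powMap m B.α) n φ) =
      B.dMuAlpha (powMap (m + 1) B.α) n (B.dCoHoch (B.coactL n) (B.coactR n) e m φ) := by
  rw [HomCoassocCoalgebra.dCoHoch_eq, HomCoassocCoalgebra.dCoHoch_eq]
  simp only [map_add, map_sum, map_smul]
  refine congrArg₂ _ (congrArg₂ _ ?_ (Finset.sum_congr rfl fun i _ => congrArg _ ?_))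
    (congrArg _ ?_)
  · exact coleftOp_dMuAlpha B.α (B.beta_pow_alpha e) (powMap_cons B.α) φ
  · refine LinearMap.ext fun x => ?_
    simp only [dMuAlpha_eq, LinearMap.compRight_apply, LinearMap.sub_apply, LinearMap.comp_apply,
      map_sub, B.comulAt_powMap B.comul_alpha_apply B.alpha_beta]
  · exact corightOp_dMuAlpha B.α (B.beta_pow_alpha e) (powMap_snoc B.α) φ

lemma dBetaDelta_dMuAlpha (n m : ℕ) (φ : (⨂[R]^n A) →ₗ[R] (⨂[R]^m A)) :
    B.dBetaDelta (B.coactLα n) (B.coactRα n) m (B.dMuAlpha (powMap m B.α) n φ) =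
      B.dMuAlpha (powMap (m + 2) B.α) n (B.dBetaDelta (B.coactL n) (B.coactR n) m φ) := by
  have h (a : A) : (B.comul ∘ₗ (B.β ^ (m - 1))) (B.α a) =
      TensorProduct.map B.α B.α ((B.comul ∘ₗ (B.β ^ (m - 1))) a) := by
    simp only [LinearMap.comp_apply, beta_pow_alpha, comul_alpha_apply]
  rw [HomCoassocCoalgebra.dBetaDelta_eq, HomCoassocCoalgebra.dBetaDelta_eq, map_sub]
  exact congrArg₂ _ (coleftOp_dMuAlpha _ h (powMap_consTwo B.α) φ)
    (corightOp_dMuAlpha _ h (powMap_snocTwo B.α) φ)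

lemma dDeltaBeta_dMuAlpha (n m : ℕ) (φ : (⨂[R]^n A) →ₗ[R] (⨂[R]^m A)) :
    B.dDeltaBeta (powMap n B.β) m (B.dMuAlpha (powMap m B.α) n φ) =
      B.dMuAlpha (powMap m B.α) n (B.dDeltaBeta (powMap n B.β) m φ) := by
  refine LinearMap.ext fun x => ?_
  simp only [dMuAlpha_eq, HomCoassocCoalgebra.dDeltaBeta_eq, LinearMap.sub_apply,
    LinearMap.comp_apply, map_sub, powMap_comm B.alpha_beta]
  abel

end Commutation

end HomBialgebra

/-! ### The bicomplex -/

namespace HomSpace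

variable {R A : Type*} [CommRing R] [AddCommGroup A] [Module R A] {n m n' m' : ℕ}

/-- The linear map underlying a cochain. -/
def val : HomSpace R A n m →ₗ[R] ((⨂[R]^n A) →ₗ[R] (⨂[R]^m A)) :=
  (homSubmodule R A n m).subtype

lemma val_injective : Function.Injective (val : HomSpace R A n m →ₗ[R] _) :=
  (homSubmodule R A n m).injective_subtype

@[simp]
lemma val_restrict (f : ((⨂[R]^n A) →ₗ[R] (⨂[R]^m A)) →ₗ[R] ((⨂[R]^n' A) →ₗ[R] (⨂[R]^m' A)))
    (h : n' = 0 ∨ m' = 0 → n = 0 ∨ m = 0) (x : HomSpace R A n m) :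
    (restrict f h x).val = f x.val := rfl

lemma val_eq_zero (x : HomSpace R A n m) (h : n = 0 ∨ m = 0) : x.val = 0 :=
  Subtype.prop (p := (· ∈ homSubmodule R A n m)) x h

end HomSpace

namespace HomAssocAlgebra

variable {R A : Type*} [CommRing R] [AddCommGroup A] [Module R A] {H : HomAssocAlgebra R A}
variable {M : Type*} [AddCommGroup M] [Module R M] {l : A ⊗[R] M →ₗ[R] M} {r : M ⊗[R] A →ₗ[R] M}
  {αM : M →ₗ[R] M}

/-- The component of `∂∂ = 0` with values in maps of `n + 3` arguments. -/
lemma dHoch_sub_dAlphaMu (hM : H.IsBimodule l r αM) {n : ℕ} (φ : (⨂[R]^(n + 1) A) →ₗ[R] M)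
    {ψ : (⨂[R]^n A) →ₗ[R] M} (hψ : n = 0 → ψ = 0) :
    H.dHoch l r (n + 1) (n + 2) (H.dHoch l r n (n + 1) φ - H.dAlphaMu l r n ψ) -
      H.dAlphaMu l r (n + 1) (H.dMuAlpha αM (n + 1) φ - H.dHoch l r n n ψ) = 0 := by
  cases n with
  | zero => simp only [hψ rfl, map_zero, sub_zero, dHoch_dHoch_eq_dAlphaMu hM, sub_self]
  | succ n =>
    simp only [map_sub, dHoch_dHoch_eq_dAlphaMu hM, dHoch_dAlphaMu hM]
    abel

/-- The component of `∂∂ = 0` with values in maps of `n + 2` arguments. -/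
lemma dMuAlpha_sub_dHoch (hM : H.IsBimodule l r αM) {n : ℕ} (φ : (⨂[R]^(n + 1) A) →ₗ[R] M)
    {ψ : (⨂[R]^n A) →ₗ[R] M} (hψ : n = 0 → ψ = 0) :
    H.dMuAlpha αM (n + 2) (H.dHoch l r n (n + 1) φ - H.dAlphaMu l r n ψ) -
      H.dHoch l r (n + 1) (n + 1) (H.dMuAlpha αM (n + 1) φ - H.dHoch l r n n ψ) = 0 := by
  cases n with
  | zero => simp only [hψ rfl, map_zero, sub_zero, dMuAlpha_dHoch hM, sub_self]
  | succ n =>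
    simp only [map_sub, dMuAlpha_dHoch hM, dHoch_dHoch_eq_dMuAlpha hM]
    abel

end HomAssocAlgebra

namespace HomCoassocCoalgebra

variable {R A : Type*} [CommRing R] [AddCommGroup A] [Module R A] {H : HomCoassocCoalgebra R A}
variable {N : Type*} [AddCommGroup N] [Module R N] {l : N →ₗ[R] A ⊗[R] N} {r : N →ₗ[R] N ⊗[R] A}
  {βN : N →ₗ[R] N}

/-- The component of `∂ᶜ∂ᶜ = 0` with values in `A^{⊗ (m+3)}`. -/
lemma dCoHoch_sub_dBetaDelta (hN : H.IsBicomodule l r βN) {m : ℕ} (φ : N →ₗ[R] (⨂[R]^(m + 1) A))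
    {χ : N →ₗ[R] (⨂[R]^m A)} (hχ : m = 0 → χ = 0) :
    H.dCoHoch l r (m + 1) (m + 2) (H.dCoHoch l r m (m + 1) φ - H.dBetaDelta l r m χ) -
      H.dBetaDelta l r (m + 1) (H.dDeltaBeta βN (m + 1) φ - H.dCoHoch l r m m χ) = 0 := by
  cases m with
  | zero => simp only [hχ rfl, map_zero, sub_zero, dCoHoch_dCoHoch_eq_dBetaDelta hN, sub_self]
  | succ m =>
    simp only [map_sub, dCoHoch_dCoHoch_eq_dBetaDelta hN, dCoHoch_dBetaDelta hN]
    abel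

/-- The component of `∂ᶜ∂ᶜ = 0` with values in `A^{⊗ (m+2)}`. -/
lemma dDeltaBeta_sub_dCoHoch (hN : H.IsBicomodule l r βN) {m : ℕ} (φ : N →ₗ[R] (⨂[R]^(m + 1) A))
    {χ : N →ₗ[R] (⨂[R]^m A)} (hχ : m = 0 → χ = 0) :
    H.dDeltaBeta βN (m + 2) (H.dCoHoch l r m (m + 1) φ - H.dBetaDelta l r m χ) -
      H.dCoHoch l r (m + 1) (m + 1) (H.dDeltaBeta βN (m + 1) φ - H.dCoHoch l r m m χ) = 0 := by
  cases m with
  | zero => simp only [hχ rfl, map_zero, sub_zero, dDeltaBeta_dCoHoch hN, sub_self]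
  | succ m =>
    simp only [map_sub, dDeltaBeta_dCoHoch hN, dCoHoch_dCoHoch_eq_dDeltaBeta hN]
    abel

end HomCoassocCoalgebra

namespace HomBialgebra

variable {R A : Type*} [CommRing R] [AddCommGroup A] [Module R A] (B : HomBialgebra R A)

/-- The first two components only involve values in `A^{⊗ m}`, the last two values in `A^{⊗ m'}`. -/
lemma dAlgAux_comp_dAlgAux (n m m' : ℕ) :
    B.dAlgAux (n + 1) m m' ∘ₗ B.dAlgAux n m m' = 0 := by
  refine LinearMap.ext fun ⟨φ, ψ, χ, ξ⟩ => ?_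
  refine Prod.ext ?_ (Prod.ext ?_ (Prod.ext ?_ ?_)) <;> refine HomSpace.val_injective ?_ <;>
    simp only [dAlgAux, LinearMap.comp_apply, LinearMap.coe_mk, AddHom.coe_mk, map_sub,
      HomSpace.val_restrict, LinearMap.zero_apply, Prod.fst_zero, Prod.snd_zero, map_zero] <;>
    simp only [← map_sub]
  · -- Tensor powers are bimodules only in positive degree; cochains with values in `A^{⊗ 0}` vanish.
    cases m with
    | zero => simp [φ.val_eq_zero (Or.inr rfl), ψ.val_eq_zero (Or.inr rfl)]
    | succ m =>
      exact HomAssocAlgebra.dHoch_sub_dAlphaMu (B.isBimodule_act m) _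
        (fun h => ψ.val_eq_zero (Or.inl h))
  · cases m with
    | zero => simp [φ.val_eq_zero (Or.inr rfl), ψ.val_eq_zero (Or.inr rfl)]
    | succ m =>
      exact HomAssocAlgebra.dMuAlpha_sub_dHoch (B.isBimodule_act m) _
        (fun h => ψ.val_eq_zero (Or.inl h))
  · cases m' with
    | zero => simp [χ.val_eq_zero (Or.inr rfl), ξ.val_eq_zero (Or.inr rfl)]
    | succ m =>
      exact HomAssocAlgebra.dHoch_sub_dAlphaMu (B.isBimodule_actβ m) _
        (fun h => ξ.val_eq_zero (Or.inl h))
  · cases m' with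
    | zero => simp [χ.val_eq_zero (Or.inr rfl), ξ.val_eq_zero (Or.inr rfl)]
    | succ m =>
      exact HomAssocAlgebra.dMuAlpha_sub_dHoch (B.isBimodule_actβ m) _
        (fun h => ξ.val_eq_zero (Or.inl h))

/-- The first and third components only involve `n` arguments, the other two `n'` arguments. -/
lemma dCoalgAux_comp_dCoalgAux (n n' m : ℕ) :
    B.dCoalgAux n n' (m + 1) ∘ₗ B.dCoalgAux n n' m = 0 := by
  refine LinearMap.ext fun ⟨φ, ψ, χ, ξ⟩ => ?_
  refine Prod.ext ?_ (Prod.ext ?_ (Prod.ext ?_ ?_)) <;> refine HomSpace.val_injective ?_ <;>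
    simp only [dCoalgAux, LinearMap.comp_apply, LinearMap.coe_mk, AddHom.coe_mk, map_sub,
      HomSpace.val_restrict, LinearMap.zero_apply, Prod.fst_zero, Prod.snd_zero, map_zero] <;>
    simp only [← map_sub]
  · -- Tensor powers are bicomodules only in positive degree; cochains of no arguments vanish.
    cases n with
    | zero => simp [φ.val_eq_zero (Or.inl rfl), χ.val_eq_zero (Or.inl rfl)]
    | succ n =>
      exact HomCoassocCoalgebra.dCoHoch_sub_dBetaDelta (B.isBicomodule_coact n) _
        (fun h => χ.val_eq_zero (Or.inr h))
  · cases n' with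
    | zero => simp [ψ.val_eq_zero (Or.inl rfl), ξ.val_eq_zero (Or.inl rfl)]
    | succ n =>
      exact HomCoassocCoalgebra.dCoHoch_sub_dBetaDelta (B.isBicomodule_coactα n) _
        (fun h => ξ.val_eq_zero (Or.inr h))
  · cases n with
    | zero => simp [φ.val_eq_zero (Or.inl rfl), χ.val_eq_zero (Or.inl rfl)]
    | succ n =>
      exact HomCoassocCoalgebra.dDeltaBeta_sub_dCoHoch (B.isBicomodule_coact n) _
        (fun h => χ.val_eq_zero (Or.inr h))
  · cases n' with
    | zero => simp [ψ.val_eq_zero (Or.inl rfl), ξ.val_eq_zero (Or.inl rfl)]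
    | succ n =>
      exact HomCoassocCoalgebra.dDeltaBeta_sub_dCoHoch (B.isBicomodule_coactα n) _
        (fun h => ξ.val_eq_zero (Or.inr h))

section Components

variable {B} {n m : ℕ} (φ : (⨂[R]^(n + 1) A) →ₗ[R] (⨂[R]^(m + 1) A))
  {ψ : (⨂[R]^n A) →ₗ[R] (⨂[R]^(m + 1) A)} {χ : (⨂[R]^(n + 1) A) →ₗ[R] (⨂[R]^m A)}
  {ξ : (⨂[R]^n A) →ₗ[R] (⨂[R]^m A)}

/-- The component `μΔ` of `∂ᶜ∂ = ∂∂ᶜ`. -/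
lemma comm_component_mulComul (hψ : n = 0 → ψ = 0) (hχ : m = 0 → χ = 0)
    (hξ : n = 0 ∨ m = 0 → ξ = 0) :
    B.dCoHoch (B.coactL (n + 2)) (B.coactR (n + 2)) m (m + 1)
        (B.dHoch (B.actL (m + 1)) (B.actR (m + 1)) n (n + 1) φ -
          B.dAlphaMu (B.actL (m + 1)) (B.actR (m + 1)) n ψ) -
      B.dBetaDelta (B.coactL (n + 2)) (B.coactR (n + 2)) m
        (B.dHoch (B.actLβ m) (B.actRβ m) n (n + 1) χ -
          B.dAlphaMu (B.actLβ m) (B.actRβ m) n ξ) =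
    B.dHoch (B.actL (m + 2)) (B.actR (m + 2)) n (n + 1)
        (B.dCoHoch (B.coactL (n + 1)) (B.coactR (n + 1)) m (m + 1) φ -
          B.dBetaDelta (B.coactL (n + 1)) (B.coactR (n + 1)) m χ) -
      B.dAlphaMu (B.actL (m + 2)) (B.actR (m + 2)) n
        (B.dCoHoch (B.coactLα n) (B.coactRα n) m (m + 1) ψ -
          B.dBetaDelta (B.coactLα n) (B.coactRα n) m ξ) := by
  have h1 : B.dCoHoch (B.coactL (n + 2)) (B.coactR (n + 2)) m (m + 1)
      (B.dHoch (B.actL (m + 1)) (B.actR (m + 1)) n (n + 1) φ) =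
      B.dHoch (B.actL (m + 2)) (B.actR (m + 2)) n (n + 1)
        (B.dCoHoch (B.coactL (n + 1)) (B.coactR (n + 1)) m (m + 1) φ) :=
    dCoHoch_dHoch (B.isHochStep_iterMul n) (B.isCoHochStep_iterComul m) φ
  have h2 : B.dCoHoch (B.coactL (n + 2)) (B.coactR (n + 2)) m (m + 1)
      (B.dAlphaMu (B.actL (m + 1)) (B.actR (m + 1)) n ψ) =
      B.dAlphaMu (B.actL (m + 2)) (B.actR (m + 2)) n
        (B.dCoHoch (B.coactLα n) (B.coactRα n) m (m + 1) ψ) := by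
    cases n with
    | zero => simp only [hψ rfl, map_zero]
    | succ n => exact dCoHoch_dAlphaMu (B.isCoHochStep_iterComul m) ψ
  have h3 : B.dBetaDelta (B.coactL (n + 2)) (B.coactR (n + 2)) m
      (B.dHoch (B.actLβ m) (B.actRβ m) n (n + 1) χ) =
      B.dHoch (B.actL (m + 2)) (B.actR (m + 2)) n (n + 1)
        (B.dBetaDelta (B.coactL (n + 1)) (B.coactR (n + 1)) m χ) := by
    cases m with
    | zero => simp only [hχ rfl, map_zero]
    | succ m => exact dBetaDelta_dHoch (B.isHochStep_iterMul n) χ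
  have h4 : B.dBetaDelta (B.coactL (n + 2)) (B.coactR (n + 2)) m
      (B.dAlphaMu (B.actLβ m) (B.actRβ m) n ξ) =
      B.dAlphaMu (B.actL (m + 2)) (B.actR (m + 2)) n
        (B.dBetaDelta (B.coactLα n) (B.coactRα n) m ξ) := by
    cases n with
    | zero => simp only [hξ (Or.inl rfl), map_zero]
    | succ n =>
      cases m with
      | zero => simp only [hξ (Or.inr rfl), map_zero]
      | succ m => exact dBetaDelta_dAlphaMu ξ
  rw [map_sub, map_sub, map_sub, map_sub, h1, h2, h3, h4]
  abel

/-- The component `αΔ` of `∂ᶜ∂ = ∂∂ᶜ`. -/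
lemma comm_component_alphaComul (hψ : n = 0 → ψ = 0) (hξ : n = 0 ∨ m = 0 → ξ = 0) :
    B.dCoHoch (B.coactLα (n + 1)) (B.coactRα (n + 1)) m (m + 1)
        (B.dMuAlpha (powMap (m + 1) B.α) (n + 1) φ -
          B.dHoch (B.actL (m + 1)) (B.actR (m + 1)) n n ψ) -
      B.dBetaDelta (B.coactLα (n + 1)) (B.coactRα (n + 1)) m
        (B.dMuAlpha (powMap m B.α) (n + 1) χ - B.dHoch (B.actLβ m) (B.actRβ m) n n ξ) =
    B.dMuAlpha (powMap (m + 2) B.α) (n + 1)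
        (B.dCoHoch (B.coactL (n + 1)) (B.coactR (n + 1)) m (m + 1) φ -
          B.dBetaDelta (B.coactL (n + 1)) (B.coactR (n + 1)) m χ) -
      B.dHoch (B.actL (m + 2)) (B.actR (m + 2)) n n
        (B.dCoHoch (B.coactLα n) (B.coactRα n) m (m + 1) ψ -
          B.dBetaDelta (B.coactLα n) (B.coactRα n) m ξ) := by
  have h2 : B.dCoHoch (B.coactLα (n + 1)) (B.coactRα (n + 1)) m (m + 1)
      (B.dHoch (B.actL (m + 1)) (B.actR (m + 1)) n n ψ) =
      B.dHoch (B.actL (m + 2)) (B.actR (m + 2)) n n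
        (B.dCoHoch (B.coactLα n) (B.coactRα n) m (m + 1) ψ) := by
    cases n with
    | zero => simp only [hψ rfl, map_zero]
    | succ n =>
      simp only [coactLα_eq, coactRα_eq]
      exact dCoHoch_dHoch (B.isHochStep_alpha_iterMul n) (B.isCoHochStep_iterComul m) ψ
  have h4 : B.dBetaDelta (B.coactLα (n + 1)) (B.coactRα (n + 1)) m
      (B.dHoch (B.actLβ m) (B.actRβ m) n n ξ) =
      B.dHoch (B.actL (m + 2)) (B.actR (m + 2)) n n
        (B.dBetaDelta (B.coactLα n) (B.coactRα n) m ξ) := by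
    cases n with
    | zero => simp only [hξ (Or.inl rfl), map_zero]
    | succ n =>
      cases m with
      | zero => simp only [hξ (Or.inr rfl), map_zero]
      | succ m =>
        simp only [coactLα_eq, coactRα_eq]
        exact dBetaDelta_dHoch (B.isHochStep_alpha_iterMul n) ξ
  rw [map_sub, map_sub, map_sub, map_sub, dCoHoch_dMuAlpha, h2, dBetaDelta_dMuAlpha, h4]
  abel

/-- The component `μβ` of `∂ᶜ∂ = ∂∂ᶜ`. -/
lemma comm_component_mulBeta (hχ : m = 0 → χ = 0) (hξ : n = 0 ∨ m = 0 → ξ = 0) :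
    B.dDeltaBeta (powMap (n + 2) B.β) (m + 1)
        (B.dHoch (B.actL (m + 1)) (B.actR (m + 1)) n (n + 1) φ -
          B.dAlphaMu (B.actL (m + 1)) (B.actR (m + 1)) n ψ) -
      B.dCoHoch (B.coactL (n + 2)) (B.coactR (n + 2)) m m
        (B.dHoch (B.actLβ m) (B.actRβ m) n (n + 1) χ -
          B.dAlphaMu (B.actLβ m) (B.actRβ m) n ξ) =
    B.dHoch (B.actLβ (m + 1)) (B.actRβ (m + 1)) n (n + 1)
        (B.dDeltaBeta (powMap (n + 1) B.β) (m + 1) φ -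
          B.dCoHoch (B.coactL (n + 1)) (B.coactR (n + 1)) m m χ) -
      B.dAlphaMu (B.actLβ (m + 1)) (B.actRβ (m + 1)) n
        (B.dDeltaBeta (powMap n B.β) (m + 1) ψ -
          B.dCoHoch (B.coactLα n) (B.coactRα n) m m ξ) := by
  have h3 : B.dCoHoch (B.coactL (n + 2)) (B.coactR (n + 2)) m m
      (B.dHoch (B.actLβ m) (B.actRβ m) n (n + 1) χ) =
      B.dHoch (B.actLβ (m + 1)) (B.actRβ (m + 1)) n (n + 1)
        (B.dCoHoch (B.coactL (n + 1)) (B.coactR (n + 1)) m m χ) := by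
    cases m with
    | zero => simp only [hχ rfl, map_zero]
    | succ m =>
      simp only [actLβ_eq, actRβ_eq]
      exact dCoHoch_dHoch (B.isHochStep_iterMul n) (B.isCoHochStep_iterComul_beta m) χ
  have h4 : B.dCoHoch (B.coactL (n + 2)) (B.coactR (n + 2)) m m
      (B.dAlphaMu (B.actLβ m) (B.actRβ m) n ξ) =
      B.dAlphaMu (B.actLβ (m + 1)) (B.actRβ (m + 1)) n
        (B.dCoHoch (B.coactLα n) (B.coactRα n) m m ξ) := by
    cases n with
    | zero => simp only [hξ (Or.inl rfl), map_zero]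
    | succ n =>
      cases m with
      | zero => simp only [hξ (Or.inr rfl), map_zero]
      | succ m =>
        simp only [actLβ_eq, actRβ_eq]
        exact dCoHoch_dAlphaMu (B.isCoHochStep_iterComul_beta m) ξ
  rw [map_sub, map_sub, map_sub, map_sub, dDeltaBeta_dHoch, dDeltaBeta_dAlphaMu, h3, h4]
  abel

/-- The component `αβ` of `∂ᶜ∂ = ∂∂ᶜ`. -/
lemma comm_component_alphaBeta (hξ : n = 0 ∨ m = 0 → ξ = 0) :
    B.dDeltaBeta (powMap (n + 1) B.β) (m + 1)
        (B.dMuAlpha (powMap (m + 1) B.α) (n + 1) φ -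
          B.dHoch (B.actL (m + 1)) (B.actR (m + 1)) n n ψ) -
      B.dCoHoch (B.coactLα (n + 1)) (B.coactRα (n + 1)) m m
        (B.dMuAlpha (powMap m B.α) (n + 1) χ - B.dHoch (B.actLβ m) (B.actRβ m) n n ξ) =
    B.dMuAlpha (powMap (m + 1) B.α) (n + 1)
        (B.dDeltaBeta (powMap (n + 1) B.β) (m + 1) φ -
          B.dCoHoch (B.coactL (n + 1)) (B.coactR (n + 1)) m m χ) -
      B.dHoch (B.actLβ (m + 1)) (B.actRβ (m + 1)) n n
        (B.dDeltaBeta (powMap n B.β) (m + 1) ψ -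
          B.dCoHoch (B.coactLα n) (B.coactRα n) m m ξ) := by
  have h4 : B.dCoHoch (B.coactLα (n + 1)) (B.coactRα (n + 1)) m m
      (B.dHoch (B.actLβ m) (B.actRβ m) n n ξ) =
      B.dHoch (B.actLβ (m + 1)) (B.actRβ (m + 1)) n n
        (B.dCoHoch (B.coactLα n) (B.coactRα n) m m ξ) := by
    cases n with
    | zero => simp only [hξ (Or.inl rfl), map_zero]
    | succ n =>
      cases m with
      | zero => simp only [hξ (Or.inr rfl), map_zero]
      | succ m =>
        simp only [coactLα_eq, coactRα_eq, actLβ_eq, actRβ_eq]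
        exact dCoHoch_dHoch (B.isHochStep_alpha_iterMul n) (B.isCoHochStep_iterComul_beta m) ξ
  rw [map_sub, map_sub, map_sub, map_sub, dDeltaBeta_dMuAlpha, dDeltaBeta_dHoch, dCoHoch_dMuAlpha,
    h4]
  abel

end Components

lemma dCoalgAux_comp_dAlgAux (n m : ℕ) :
    B.dCoalgAux (n + 2) (n + 1) m ∘ₗ B.dAlgAux n (m + 1) m =
      B.dAlgAux n (m + 2) (m + 1) ∘ₗ B.dCoalgAux (n + 1) n m := by
  refine LinearMap.ext fun ⟨φ, ψ, χ, ξ⟩ => ?_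
  refine Prod.ext ?_ (Prod.ext ?_ (Prod.ext ?_ ?_)) <;> refine HomSpace.val_injective ?_ <;>
    simp only [dAlgAux, dCoalgAux, LinearMap.comp_apply, LinearMap.coe_mk, AddHom.coe_mk, map_sub,
      HomSpace.val_restrict] <;>
    simp only [← map_sub]
  · exact comm_component_mulComul _ (fun h => ψ.val_eq_zero (Or.inl h))
      (fun h => χ.val_eq_zero (Or.inr h)) ξ.val_eq_zero
  · exact comm_component_alphaComul _ (fun h => ψ.val_eq_zero (Or.inl h)) ξ.val_eq_zero
  · exact comm_component_mulBeta _ (fun h => χ.val_eq_zero (Or.inr h)) ξ.val_eq_zero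
  · exact comm_component_alphaBeta _ ξ.val_eq_zero

lemma dAlg_comp_dAlg (n m : ℕ) : B.dAlg (n + 1) m ∘ₗ B.dAlg n m = 0 := by
  cases n with
  | zero => exact LinearMap.comp_zero _
  | succ n => exact B.dAlgAux_comp_dAlgAux n m (m - 1)

lemma dCoalg_comp_dCoalg (n m : ℕ) : B.dCoalg n (m + 1) ∘ₗ B.dCoalg n m = 0 := by
  cases m with
  | zero => exact LinearMap.comp_zero _
  | succ m => exact B.dCoalgAux_comp_dCoalgAux n (n - 1) m

lemma dCoalg_comp_dAlg (n m : ℕ) :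
    B.dCoalg (n + 1) m ∘ₗ B.dAlg n m = B.dAlg n (m + 1) ∘ₗ B.dCoalg n m := by
  cases n with
  | zero => exact (LinearMap.comp_zero _).trans (LinearMap.zero_comp _).symm
  | succ n =>
    cases m with
    | zero => exact (LinearMap.zero_comp _).trans (LinearMap.comp_zero _).symm
    | succ m => exact B.dCoalgAux_comp_dAlgAux n m

/-! ### The total complex -/

section Total

open Finset.HasAntidiagonal

variable {k : ℕ}

/-- The inclusion of `C_GS^{n,m}` into the total space of degree `k = n + m`. -/
noncomputable def inclTot (n m : ℕ) (h : n + m = k) : GS R A n m →ₗ[R] GSTot R A k :=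
  LinearMap.single R (fun q : antidiagonal k => GS R A q.1.1 q.1.2)
    ⟨(n, m), mem_antidiagonal.mpr h⟩

lemma dTot_inclTot (n m : ℕ) (h : n + m = k) (x : GS R A n m) :
    B.dTot k (inclTot n m h x) =
      inclTot (n + 1) m (by omega) (B.dAlg n m x) +
        (-1 : R) ^ n • inclTot n (m + 1) (by omega) (B.dCoalg n m x) := by
  rw [dTot, LinearMap.sum_apply, Finset.sum_eq_single
    (⟨(n, m), mem_antidiagonal.mpr h⟩ : antidiagonal k)]
  · simp [inclTot]
  · intro q _ hq
    rw [LinearMap.comp_apply, LinearMap.proj_apply, inclTot, LinearMap.single_apply,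
      Pi.single_eq_of_ne hq, map_zero]
  · intro hq
    exact absurd (Finset.mem_univ _) hq

/-- The total differential squares to zero, the mixed terms cancelling because of the sign
`(-1) ^ n`. -/
lemma dTot_comp_dTot (k : ℕ) : B.dTot (k + 1) ∘ₗ B.dTot k = 0 := by
  refine LinearMap.pi_ext' fun ⟨⟨n, m⟩, hp⟩ => LinearMap.ext fun x => ?_
  have h := mem_antidiagonal.mp hp
  change B.dTot (k + 1) (B.dTot k (inclTot n m h x)) = 0
  have h1 : B.dAlg (n + 1) m (B.dAlg n m x) = 0 := LinearMap.congr_fun (B.dAlg_comp_dAlg n m) x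
  have h2 : B.dCoalg n (m + 1) (B.dCoalg n m x) = 0 :=
    LinearMap.congr_fun (B.dCoalg_comp_dCoalg n m) x
  have h3 : B.dCoalg (n + 1) m (B.dAlg n m x) = B.dAlg n (m + 1) (B.dCoalg n m x) :=
    LinearMap.congr_fun (B.dCoalg_comp_dAlg n m) x
  simp only [dTot_inclTot, map_add, map_smul, h1, h2, h3, map_zero, smul_zero, zero_add, add_zero,
    pow_succ, mul_neg, mul_one, neg_smul, neg_add_cancel]

end Total

end HomBialgebra

end AlphaGS

theorem mainTheorem6 {𝕜 A : Type*} [Field 𝕜] [CharZero 𝕜] [AddCommGroup A] [Module 𝕜 A]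
    (B : AlphaGS.HomBialgebra 𝕜 A) :
    (∀ n m : ℕ, B.dAlg (n + 1) m ∘ₗ B.dAlg n m = 0) ∧
    (∀ n m : ℕ, B.dCoalg n (m + 1) ∘ₗ B.dCoalg n m = 0) ∧
    (∀ n m : ℕ, B.dCoalg (n + 1) m ∘ₗ B.dAlg n m = B.dAlg n (m + 1) ∘ₗ B.dCoalg n m) ∧
    (∀ k : ℕ, B.dTot (k + 1) ∘ₗ B.dTot k = 0) :=
  ⟨B.dAlg_comp_dAlg, B.dCoalg_comp_dCoalg, B.dCoalg_comp_dAlg, B.dTot_comp_dTot⟩
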